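/- Let $n\ge 2$ and let $\Omega\subset\mathbb R^n$ be open. All functions are real-valued, derivatives and the Laplacian $\Delta=\sum_i\partial_i^2$ are taken in the sense of distributions on $\Omega$; $W^{1,q}_0(\Omega)$ is the closure of $C_c^\infty(\Omega)$ in $W^{1,q}(\Omega)$, and $H^1_0=W^{1,2}_0$. (1) If $u\in L^1_{loc}(\Omega)$ and $\Delta u\in L^1_{loc}(\Omega)$, then $u\in W^{1,1}_{loc}(\Omega)$, and moreover $u\in W^{1,q}_{loc}(\Omega)$ for every real $q$ with $1\le q<\frac{n}{n-1}$. (2) Suppose in addition that $\Omega$ is bounded with boundary of class $C^2$, and let $f\in L^1(\Omega)$. There is a function $u_0$, belonging to $W^{1,q}_0(\Omega)$ for every $1\le q<\frac n{n-1}$ and satisfying $-\Delta u_0=f$ in $\Omega$, with the following properties. (a) There are sequences $f_j\in C_c^\infty(\Omega)$ with $f_j\to f$ in $L^1(\Omega)$. For every such sequence the problems $-\Delta u_j=f_j$ have solutions $u_j\in H^1_0(\Omega)$, which may be chosen in $C^\infty(\Omega)\cap C(\overline\Omega)$ with $u_j=0$ on $\partial\Omega$; and for every choice of solutions $u_j\in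 H_0^1(\Omega)$ one has $u_j\to u_0$ in $W^{1,q}(\Omega)$ for every $1\le q<\frac n{n-1}$. (b) Every $u\in W^{1,1}_0(\Omega)$ with $-\Delta u=f$ in $\Omega$ coincides with $u_0$ almost everywhere in $\Omega$. (c) If $n=2$ and $f$ is not almost everywhere zero, then every such $u$ satisfies the Brezis–Merle inequality: for every $\delta\in(0,4\pi)$, $$\int_\Omega \exp\!\left(\frac{(4\pi-\delta)\,|u(x)|}{\|f\|_{L^1(\Omega)}}\right)dx\;\le\;\frac{4\pi^2}{\delta}\,(\operatorname{diam}\Omega)^2 .$$ -/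

import Mathlib

open MeasureTheory Set Filter Topology TopologicalSpace
open scoped ENNReal ContDiff Distributions Laplacian

noncomputable section

/-- Euclidean space of dimension `n`. -/
abbrev RSpace (n : ℕ) : Type := EuclideanSpace ℝ (Fin n)

/-- `g` is the weak gradient of `u` on `Ω`; both are locally integrable on `Ω`. -/
def HasWeakGradient {n : ℕ} (Ω : Opens (RSpace n)) (u : RSpace n → ℝ)
    (g : RSpace n → RSpace n) : Prop :=
  LocallyIntegrableOn u (Ω : Set (RSpace n)) ∧
  LocallyIntegrableOn g (Ω : Set (RSpace n)) ∧
  ∀ (φ : 𝓓(Ω, ℝ)) (v : RSpace n),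
    ∫ x in (Ω : Set (RSpace n)), u x * fderiv ℝ φ x v =
      -∫ x in (Ω : Set (RSpace n)), inner ℝ (g x) v * φ x

/-- `Δ u = f` on `Ω` in the sense of distributions; both are locally integrable on `Ω`. -/
def HasWeakLaplacian {n : ℕ} (Ω : Opens (RSpace n)) (u f : RSpace n → ℝ) : Prop :=
  LocallyIntegrableOn u (Ω : Set (RSpace n)) ∧
  LocallyIntegrableOn f (Ω : Set (RSpace n)) ∧
  ∀ φ : 𝓓(Ω, ℝ),
    ∫ x in (Ω : Set (RSpace n)), u x * (Δ (φ : RSpace n → ℝ)) x =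
      ∫ x in (Ω : Set (RSpace n)), f x * φ x

/-- The Sobolev space `W^{1,p}(Ω)`. -/
def MemW1 {n : ℕ} (Ω : Opens (RSpace n)) (p : ℝ≥0∞) (u : RSpace n → ℝ) : Prop :=
  ∃ g : RSpace n → RSpace n, HasWeakGradient Ω u g ∧
    MemLp u p (volume.restrict (Ω : Set (RSpace n))) ∧
    MemLp g p (volume.restrict (Ω : Set (RSpace n)))

/-- The local Sobolev space `W^{1,p}_loc(Ω)`. -/
def MemW1Loc {n : ℕ} (Ω : Opens (RSpace n)) (p : ℝ≥0∞) (u : RSpace n → ℝ) : Prop :=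
  ∃ g : RSpace n → RSpace n, HasWeakGradient Ω u g ∧
    ∀ K : Set (RSpace n), IsCompact K → K ⊆ Ω →
      MemLp u p (volume.restrict K) ∧ MemLp g p (volume.restrict K)

/-- `U j → u` in the norm of `W^{1,p}(Ω)`. -/
def TendstoW1 {n : ℕ} (Ω : Opens (RSpace n)) (p : ℝ≥0∞) (U : ℕ → RSpace n → ℝ)
    (u : RSpace n → ℝ) : Prop :=
  ∃ (G : ℕ → RSpace n → RSpace n) (g : RSpace n → RSpace n),
    (∀ j, HasWeakGradient Ω (U j) (G j)) ∧ HasWeakGradient Ω u g ∧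
    Tendsto (fun j => eLpNorm (U j - u) p (volume.restrict (Ω : Set (RSpace n)))) atTop (𝓝 0) ∧
    Tendsto (fun j => eLpNorm (G j - g) p (volume.restrict (Ω : Set (RSpace n)))) atTop (𝓝 0)

/-- The space `W^{1,p}_0(Ω)`: the closure of the test functions in `W^{1,p}(Ω)`. -/
def MemW10 {n : ℕ} (Ω : Opens (RSpace n)) (p : ℝ≥0∞) (u : RSpace n → ℝ) : Prop :=
  MemW1 Ω p u ∧ ∃ φ : ℕ → 𝓓(Ω, ℝ), TendstoW1 Ω p (fun k => ⇑(φ k)) u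

/-- `Ω` has a boundary of class `C²`: near each boundary point, `Ω` is the negative set of a
`C²` function whose differential does not vanish at that point. -/
def HasC2Boundary {n : ℕ} (Ω : Opens (RSpace n)) : Prop :=
  ∀ x₀ ∈ frontier (Ω : Set (RSpace n)), ∃ (V : Set (RSpace n)) (ρ : RSpace n → ℝ),
    IsOpen V ∧ x₀ ∈ V ∧ ContDiffOn ℝ 2 ρ V ∧ fderiv ℝ ρ x₀ ≠ 0 ∧
    (Ω : Set (RSpace n)) ∩ V = {x | x ∈ V ∧ ρ x < 0}

/-- `F j → f` in `L¹(Ω)`. -/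
def TendstoL1 {n : ℕ} (Ω : Opens (RSpace n)) (F : ℕ → 𝓓(Ω, ℝ)) (f : RSpace n → ℝ) : Prop :=
  Tendsto (fun j => eLpNorm (⇑(F j) - f) 1 (volume.restrict (Ω : Set (RSpace n)))) atTop (𝓝 0)

/-- For each `j`, `U j` is the variational solution in `H¹_0(Ω)` of `-Δ (U j) = F j`. -/
def AreApproxSolutions {n : ℕ} (Ω : Opens (RSpace n)) (F : ℕ → 𝓓(Ω, ℝ))
    (U : ℕ → RSpace n → ℝ) : Prop :=
  ∀ j, MemW10 Ω 2 (U j) ∧ HasWeakLaplacian Ω (U j) (fun x => -F j x)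

end

/-! Everything grows out of one a priori estimate: for 1 ≤ q < n/(n-1), the W^{1,q} norm of a
variational solution of -Δu = F is at most a constant times ‖F‖ in L¹
(`exists_eLpNorm_le_of_isWeakSol`). Heuristically, test with S(u), where S' = (1+t²)^{-a} and 1/2 <
a < 1. As 2a > 1, S is bounded, so ∫ (1+u²)^{-a}|∇u|² is controlled by ‖F‖₁. Hölder splits ∇u into
(1+|u|)^a times an L² field, Sobolev bounds the first factor by the power a of a constant plus a
multiple of ‖∇u‖_q, and since a < 1 the inequality closes. An a satisfying the Sobolev condition
exists because q < n/(n-1).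

By linearity, variational solutions whose data converge in L¹ are Cauchy; their limit is u₀
(`exists_isLimitSol`). No boundary regularity is used up to here, so part (1) follows locally: on a
bounded open subset, subtract the limit solution with the same Laplacian; the difference is weakly
harmonic, hence smooth by Weyl's lemma. The latter is proved quantitatively: a radial mollifier ρ
with potential ψ, ∇ψ = -ρx, represents a solution at distance more than r from the complement as a
mollification of itself plus an average of F over a finite measure
(`HasWeakLaplacian.ae_eq_mollify_add_avg`).

The C² boundary enters through exterior balls. Barriers and the weak maximum principle bound a
solution with smooth data by C·dist to the complement, and the interior representation at scale
dist/4 then bounds its gradient (`exists_isRegularSol`). This gives continuity up to the boundary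
and, by duality, uniqueness in W^{1,1}_0: if v solves the homogeneous problem and U the one with
datum G, then ∫vG = ∫∇v·∇U, and the right side vanishes because cutoffs of U are admissible test
functions with uniformly bounded gradients.

In the plane, the maximum principle compares |u| with a regularized logarithmic potential of |F|.
Jensen's inequality, Tonelli and an explicit integral over a disc give the Brezis–Merle bound for
smooth data, and Fatou's lemma carries it to u₀. -/

noncomputable section

/-! ### Calculus of test functions -/

section TestFunctions

variable {n : ℕ}

/-- The standard orthonormal basis vectors. -/
abbrev stdVec {n : ℕ} (i : Fin n) : RSpace n := EuclideanSpace.basisFun (Fin n) ℝ i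

theorem laplacian_eq_sum_fderiv {f : RSpace n → ℝ} {x : RSpace n} (hf : ContDiffAt ℝ 2 f x) :
    Δ f x = ∑ i, fderiv ℝ (fun y => fderiv ℝ f y (stdVec i)) x (stdVec i) := by
  rw [InnerProductSpace.laplacian_eq_iteratedFDeriv_orthonormalBasis f
    (EuclideanSpace.basisFun (Fin n) ℝ)]
  simp only [iteratedFDeriv_two_apply]
  refine Finset.sum_congr rfl fun i _ => ?_
  have h : DifferentiableAt ℝ (fderiv ℝ f) x :=
    (hf.fderiv_right (m := 1) (by norm_num)).differentiableAt (by norm_num)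
  rw [fderiv_clm_apply h (differentiableAt_const _)]
  simp

theorem inner_eq_sum_stdVec (x y : RSpace n) :
    inner ℝ x y = ∑ i, inner ℝ x (stdVec i) * inner ℝ y (stdVec i) := by
  rw [← OrthonormalBasis.sum_inner_mul_inner (EuclideanSpace.basisFun (Fin n) ℝ) x y]
  exact Finset.sum_congr rfl fun i _ => by rw [real_inner_comm y]

theorem inner_gradient (f : RSpace n → ℝ) (x v : RSpace n) :
    inner ℝ (gradient f x) v = fderiv ℝ f x v := inner_gradient_left

theorem norm_gradient (f : RSpace n → ℝ) (x : RSpace n) : ‖gradient f x‖ = ‖fderiv ℝ f x‖ := by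
  rw [gradient, LinearIsometryEquiv.norm_map]

theorem continuous_gradient {f : RSpace n → ℝ} (hf : ContDiff ℝ 1 f) : Continuous (gradient f) :=
  (LinearIsometryEquiv.continuous _).comp (hf.continuous_fderiv (by norm_num))

variable {Ω : Opens (RSpace n)}

theorem TestFunction.contDiff_one (φ : 𝓓(Ω, ℝ)) : ContDiff ℝ 1 φ := φ.contDiff.of_le (by simp)

theorem TestFunction.contDiff_two (φ : 𝓓(Ω, ℝ)) : ContDiff ℝ 2 φ :=
  φ.contDiff.of_le (by norm_cast)

theorem TestFunction.differentiable (φ : 𝓓(Ω, ℝ)) : Differentiable ℝ φ :=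
  φ.contDiff_one.differentiable (by norm_num)

theorem TestFunction.eq_zero_of_notMem (φ : 𝓓(Ω, ℝ)) {x : RSpace n} (hx : x ∉ Ω) : φ x = 0 :=
  image_eq_zero_of_notMem_tsupport fun h => hx (φ.tsupport_subset h)

/-- The directional derivative of a test function. -/
def TestFunction.dderiv (φ : 𝓓(Ω, ℝ)) (v : RSpace n) : 𝓓(Ω, ℝ) where
  toFun x := fderiv ℝ φ x v
  contDiff' := (φ.contDiff.fderiv_right (m := ∞) (by simp)).clm_apply contDiff_const
  hasCompactSupport' := (φ.hasCompactSupport.fderiv_apply (𝕜 := ℝ) v)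
  tsupport_subset' := (tsupport_fderiv_apply_subset ℝ v).trans φ.tsupport_subset

@[simp] theorem TestFunction.dderiv_apply (φ : 𝓓(Ω, ℝ)) (v x : RSpace n) :
    φ.dderiv v x = fderiv ℝ φ x v := rfl

/-- Composition of a test function with a smooth function vanishing at the origin. -/
def TestFunction.smoothComp (φ : 𝓓(Ω, ℝ)) (S : ℝ → ℝ) (hS : ContDiff ℝ ∞ S) (h0 : S 0 = 0) :
    𝓓(Ω, ℝ) where
  toFun := S ∘ φ
  contDiff' := hS.comp φ.contDiff
  hasCompactSupport' := φ.hasCompactSupport.comp_left h0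
  tsupport_subset' := (tsupport_comp_subset h0 φ).trans φ.tsupport_subset

/-- Product of a test function with a smooth function. -/
def TestFunction.smoothMul (φ : 𝓓(Ω, ℝ)) (w : RSpace n → ℝ) (hw : ContDiff ℝ ∞ w) :
    𝓓(Ω, ℝ) where
  toFun x := w x * φ x
  contDiff' := hw.mul φ.contDiff
  hasCompactSupport' := φ.hasCompactSupport.mul_left
  tsupport_subset' := (tsupport_mul_subset_right).trans φ.tsupport_subset

@[simp] theorem TestFunction.smoothMul_apply (φ : 𝓓(Ω, ℝ)) (w : RSpace n → ℝ)
    (hw : ContDiff ℝ ∞ w) (x : RSpace n) : φ.smoothMul w hw x = w x * φ x := rfl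

theorem integrable_mul_of_locallyIntegrableOn {u ψ : RSpace n → ℝ}
    (hu : LocallyIntegrableOn u (Ω : Set (RSpace n))) (hψ : Continuous ψ)
    (hc : HasCompactSupport ψ) (hs : tsupport ψ ⊆ Ω) :
    Integrable (fun x => u x * ψ x) (volume.restrict (Ω : Set (RSpace n))) := by
  have hK : IsCompact (tsupport ψ) := hc
  have h1 : IntegrableOn u (tsupport ψ) := hu.integrableOn_compact_subset hs hK
  have h2 : IntegrableOn (fun x => u x * ψ x) (tsupport ψ) := h1.mul_continuousOn hψ.continuousOn hK
  have h3 : Integrable (fun x => u x * ψ x) := by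
    rw [← integrableOn_iff_integrable_of_support_subset (s := tsupport ψ)]
    · exact h2
    · intro x hx
      by_contra h
      exact hx (by simp [image_eq_zero_of_notMem_tsupport h])
  exact h3.integrableOn

theorem TestFunction.integrable_mul (φ : 𝓓(Ω, ℝ)) {u : RSpace n → ℝ}
    (hu : LocallyIntegrableOn u (Ω : Set (RSpace n))) :
    Integrable (fun x => u x * φ x) (volume.restrict (Ω : Set (RSpace n))) :=
  integrable_mul_of_locallyIntegrableOn hu φ.continuous φ.hasCompactSupport φ.tsupport_subset

theorem TestFunction.memLp (φ : 𝓓(Ω, ℝ)) (p : ℝ≥0∞) (μ : Measure (RSpace n))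
    [IsFiniteMeasureOnCompacts μ] : MemLp φ p μ :=
  φ.continuous.memLp_of_hasCompactSupport φ.hasCompactSupport

theorem TestFunction.hasCompactSupport_gradient (φ : 𝓓(Ω, ℝ)) :
    HasCompactSupport (gradient φ) :=
  (φ.hasCompactSupport.fderiv ℝ).comp_left (g := (InnerProductSpace.toDual ℝ _).symm) (by simp)

theorem TestFunction.continuous_gradient (φ : 𝓓(Ω, ℝ)) : Continuous (gradient φ) :=
  _root_.continuous_gradient φ.contDiff_one

theorem TestFunction.memLp_gradient (φ : 𝓓(Ω, ℝ)) (p : ℝ≥0∞) (μ : Measure (RSpace n))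
    [IsFiniteMeasureOnCompacts μ] : MemLp (gradient φ) p μ :=
  φ.continuous_gradient.memLp_of_hasCompactSupport φ.hasCompactSupport_gradient

theorem TestFunction.bounded_gradient (φ : 𝓓(Ω, ℝ)) : ∃ C, 0 ≤ C ∧ ∀ x, ‖gradient φ x‖ ≤ C := by
  obtain ⟨C, hC⟩ := φ.continuous_gradient.bounded_above_of_compact_support
    φ.hasCompactSupport_gradient
  exact ⟨C, (norm_nonneg _).trans (hC 0), hC⟩

theorem TestFunction.bounded (φ : 𝓓(Ω, ℝ)) : ∃ C, 0 ≤ C ∧ ∀ x, |φ x| ≤ C := by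
  obtain ⟨C, hC⟩ := φ.continuous.bounded_above_of_compact_support φ.hasCompactSupport
  exact ⟨C, (norm_nonneg _).trans (hC 0), hC⟩

/-- Integration of a function vanishing off `Ω`. -/
theorem setIntegral_opens_eq {F : Type*} [NormedAddCommGroup F] [NormedSpace ℝ F]
    {h : RSpace n → F} (hh : ∀ x, x ∉ Ω → h x = 0) :
    ∫ x in (Ω : Set (RSpace n)), h x = ∫ x, h x :=
  setIntegral_eq_integral_of_forall_compl_eq_zero hh

/-- A function differentiable on `Ω` with continuous derivative can be integrated by parts
against test functions. -/
theorem integral_mul_fderiv_of_contDiffOn {w : RSpace n → ℝ}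
    (hw : ContDiffOn ℝ 1 w (Ω : Set (RSpace n))) (φ : 𝓓(Ω, ℝ)) (v : RSpace n) :
    ∫ x in (Ω : Set (RSpace n)), w x * fderiv ℝ φ x v =
      -∫ x in (Ω : Set (RSpace n)), fderiv ℝ w x v * φ x := by
  have hO : IsOpen (Ω : Set (RSpace n)) := Ω.isOpen
  have hwc : LocallyIntegrableOn w (Ω : Set (RSpace n)) :=
    hw.continuousOn.locallyIntegrableOn hO.measurableSet
  have hdc : LocallyIntegrableOn (fun x => fderiv ℝ w x v) (Ω : Set (RSpace n)) :=
    ((hw.continuousOn_fderiv_of_isOpen hO le_rfl).clm_apply continuousOn_const).locallyIntegrableOn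
      hO.measurableSet
  have key : ∀ {u : RSpace n → ℝ} (ψ : 𝓓(Ω, ℝ)),
      LocallyIntegrableOn u (Ω : Set (RSpace n)) → Integrable (fun x => u x * ψ x) := by
    intro u ψ hu
    have := ψ.integrable_mul hu
    refine (integrableOn_iff_integrable_of_support_subset ?_).1 this
    intro x hx
    by_contra h
    exact hx (by simp [ψ.eq_zero_of_notMem h])
  rw [setIntegral_opens_eq (h := fun x => w x * fderiv ℝ φ x v)
      (fun x hx => by rw [← φ.dderiv_apply, (φ.dderiv v).eq_zero_of_notMem hx, mul_zero]),
    setIntegral_opens_eq (h := fun x => fderiv ℝ w x v * φ x)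
      (fun x hx => by rw [φ.eq_zero_of_notMem hx, mul_zero])]
  refine integral_mul_fderiv_eq_neg_fderiv_mul_of_integrable (key φ hdc) (key (φ.dderiv v) hwc)
    (key φ hwc) (fun x hx => ?_) (fun x _ => φ.differentiable x)
  exact (hw.contDiffAt (hO.mem_nhds (φ.tsupport_subset hx))).differentiableAt (by norm_num)

theorem TestFunction.laplacian_eq (φ : 𝓓(Ω, ℝ)) (x : RSpace n) :
    Δ (φ : RSpace n → ℝ) x = ∑ i, (φ.dderiv (stdVec i)).dderiv (stdVec i) x :=
  laplacian_eq_sum_fderiv φ.contDiff_two.contDiffAt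

/-- The Laplacian of a test function. -/
def TestFunction.lap (φ : 𝓓(Ω, ℝ)) : 𝓓(Ω, ℝ) := ∑ i, (φ.dderiv (stdVec i)).dderiv (stdVec i)

theorem TestFunction.lap_apply (φ : 𝓓(Ω, ℝ)) (x : RSpace n) :
    φ.lap x = Δ (φ : RSpace n → ℝ) x := by
  rw [φ.laplacian_eq, TestFunction.lap]
  have hsum : ∀ s : Finset (Fin n), (∑ i ∈ s, (φ.dderiv (stdVec i)).dderiv (stdVec i)) x =
      ∑ i ∈ s, (φ.dderiv (stdVec i)).dderiv (stdVec i) x := by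
    intro s
    induction s using Finset.cons_induction with
    | empty => rfl
    | cons a s ha ih => rw [Finset.sum_cons, Finset.sum_cons, ← ih]; rfl
  exact hsum _

theorem gradient_add {f g : RSpace n → ℝ} {x : RSpace n} (hf : DifferentiableAt ℝ f x)
    (hg : DifferentiableAt ℝ g x) : gradient (f + g) x = gradient f x + gradient g x := by
  simp [gradient, fderiv_add hf hg]

theorem gradient_sub {f g : RSpace n → ℝ} {x : RSpace n} (hf : DifferentiableAt ℝ f x)
    (hg : DifferentiableAt ℝ g x) : gradient (f - g) x = gradient f x - gradient g x := by
  simp [gradient, fderiv_sub hf hg]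

theorem gradient_const_smul {f : RSpace n → ℝ} {x : RSpace n} (c : ℝ)
    (hf : DifferentiableAt ℝ f x) : gradient (c • f) x = c • gradient f x := by
  simp [gradient, fderiv_const_smul hf]

theorem gradient_comp {S : ℝ → ℝ} {f : RSpace n → ℝ} {x : RSpace n}
    (hS : DifferentiableAt ℝ S (f x)) (hf : DifferentiableAt ℝ f x) :
    gradient (S ∘ f) x = deriv S (f x) • gradient f x := by
  refine ext_inner_right ℝ fun v => ?_
  rw [inner_smul_left, inner_gradient, inner_gradient, fderiv_comp x hS hf]
  simp [fderiv_eq_smul_deriv, mul_comm]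

theorem gradient_mul {f g : RSpace n → ℝ} {x : RSpace n}
    (hf : DifferentiableAt ℝ f x) (hg : DifferentiableAt ℝ g x) :
    gradient (fun y => f y * g y) x = f x • gradient g x + g x • gradient f x := by
  refine ext_inner_right ℝ fun v => ?_
  rw [inner_add_left, inner_smul_left, inner_smul_left, inner_gradient, inner_gradient,
    inner_gradient, fderiv_fun_mul hf hg]
  simp

end TestFunctions

/-! ### Weak gradients -/

section WeakGradient

variable {n : ℕ} {Ω : Opens (RSpace n)}

/-- The fundamental lemma of the calculus of variations for u - w. It turns distributional
identities into almost everywhere ones: uniqueness of weak gradients, the interior representation,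
and uniqueness for the Dirichlet problem. -/
theorem ae_eq_of_integral_testFunction {u w : RSpace n → ℝ}
    (hu : LocallyIntegrableOn u (Ω : Set (RSpace n)))
    (hw : LocallyIntegrableOn w (Ω : Set (RSpace n)))
    (h : ∀ φ : 𝓓(Ω, ℝ), ∫ x in (Ω : Set (RSpace n)), u x * φ x =
      ∫ x in (Ω : Set (RSpace n)), w x * φ x) :
    u =ᵐ[volume.restrict (Ω : Set (RSpace n))] w := by
  have hO : IsOpen (Ω : Set (RSpace n)) := Ω.isOpen
  have := hO.ae_eq_zero_of_integral_contDiff_smul_eq_zero (hu.sub hw) (fun ψ h1 h2 h3 => by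
    let φ : 𝓓(Ω, ℝ) := ⟨ψ, h1, h2, h3⟩
    have h4 := h φ
    have h5 : ∫ x in (Ω : Set (RSpace n)), (u x * φ x - w x * φ x) = 0 := by
      rw [integral_sub (φ.integrable_mul hu) (φ.integrable_mul hw), h4, sub_self]
    rw [setIntegral_opens_eq (fun x hx => by simp [φ.eq_zero_of_notMem hx])] at h5
    rw [← h5]
    refine integral_congr_ae (Eventually.of_forall fun x => ?_)
    change ψ x • (u x - w x) = u x * ψ x - w x * ψ x
    rw [smul_eq_mul]; ring)
  rw [EventuallyEq, ae_restrict_iff' hO.measurableSet]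
  filter_upwards [this] with x hx hxΩ
  exact sub_eq_zero.1 (hx hxΩ)

theorem LocallyIntegrableOn.inner_right {g : RSpace n → RSpace n} {s : Set (RSpace n)}
    (hg : LocallyIntegrableOn g s) (v : RSpace n) :
    LocallyIntegrableOn (fun x => inner ℝ (g x) v) s := by
  intro x hx
  obtain ⟨t, ht, h⟩ := hg x hx
  exact ⟨t, ht, h.inner_const v⟩

theorem ae_eq_of_forall_inner_stdVec {μ : Measure (RSpace n)} {g h : RSpace n → RSpace n}
    (H : ∀ i, (fun x => inner ℝ (g x) (stdVec i)) =ᵐ[μ] fun x => inner ℝ (h x) (stdVec i)) :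
    g =ᵐ[μ] h := by
  have : ∀ᵐ x ∂μ, ∀ i, inner ℝ (g x) (stdVec i) = inner ℝ (h x) (stdVec i) :=
    ae_all_iff.2 H
  filter_upwards [this] with x hx
  refine ext_inner_right ℝ fun v => ?_
  rw [inner_eq_sum_stdVec, inner_eq_sum_stdVec (h x)]
  simp only [hx]

theorem HasWeakGradient.ae_unique {u w : RSpace n → ℝ} {g h : RSpace n → RSpace n}
    (hg : HasWeakGradient Ω u g) (hh : HasWeakGradient Ω w h)
    (huw : u =ᵐ[volume.restrict (Ω : Set (RSpace n))] w) :
    g =ᵐ[volume.restrict (Ω : Set (RSpace n))] h := by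
  refine ae_eq_of_forall_inner_stdVec fun i => ?_
  refine ae_eq_of_integral_testFunction (LocallyIntegrableOn.inner_right hg.2.1 _)
    (LocallyIntegrableOn.inner_right hh.2.1 _) fun φ => ?_
  have h1 := hg.2.2 φ (stdVec i)
  have h2 := hh.2.2 φ (stdVec i)
  have : ∫ x in (Ω : Set (RSpace n)), u x * fderiv ℝ φ x (stdVec i) =
      ∫ x in (Ω : Set (RSpace n)), w x * fderiv ℝ φ x (stdVec i) := by
    refine integral_congr_ae ?_
    filter_upwards [huw] with x hx
    rw [hx]
  linarith

theorem hasWeakGradient_of_contDiffOn {w : RSpace n → ℝ}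
    (hw : ContDiffOn ℝ 1 w (Ω : Set (RSpace n))) : HasWeakGradient Ω w (gradient w) := by
  have hO : IsOpen (Ω : Set (RSpace n)) := Ω.isOpen
  refine ⟨hw.continuousOn.locallyIntegrableOn hO.measurableSet, ?_, fun φ v => ?_⟩
  · refine ContinuousOn.locallyIntegrableOn ?_ hO.measurableSet
    exact (LinearIsometryEquiv.continuous _).comp_continuousOn
      (hw.continuousOn_fderiv_of_isOpen hO le_rfl)
  · simpa only [inner_gradient] using integral_mul_fderiv_of_contDiffOn hw φ v

theorem TestFunction.hasWeakGradient (φ : 𝓓(Ω, ℝ)) : HasWeakGradient Ω φ (gradient φ) :=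
  hasWeakGradient_of_contDiffOn φ.contDiff_one.contDiffOn

theorem locallyIntegrableOn_congr_ae {F : Type*} [NormedAddCommGroup F] {u w : RSpace n → F}
    (hu : LocallyIntegrableOn u (Ω : Set (RSpace n)))
    (huw : u =ᵐ[volume.restrict (Ω : Set (RSpace n))] w) :
    LocallyIntegrableOn w (Ω : Set (RSpace n)) := by
  intro x hx
  obtain ⟨t, ht, h⟩ := hu x hx
  refine ⟨t ∩ Ω, inter_mem ht self_mem_nhdsWithin, ?_⟩
  exact (h.mono_set inter_subset_left).congr
    (ae_mono (Measure.restrict_mono inter_subset_right le_rfl) huw)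

theorem HasWeakGradient.congr {u w : RSpace n → ℝ} {g h : RSpace n → RSpace n}
    (hg : HasWeakGradient Ω u g) (huw : u =ᵐ[volume.restrict (Ω : Set (RSpace n))] w)
    (hgh : g =ᵐ[volume.restrict (Ω : Set (RSpace n))] h) : HasWeakGradient Ω w h := by
  obtain ⟨h1, h2, h3⟩ := hg
  refine ⟨locallyIntegrableOn_congr_ae h1 huw, locallyIntegrableOn_congr_ae h2 hgh,
    fun φ v => ?_⟩
  · rw [integral_congr_ae (g := fun x => u x * fderiv ℝ φ x v)
      (by filter_upwards [huw] with x hx; rw [hx]), h3 φ v]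
    congr 1
    refine integral_congr_ae ?_
    filter_upwards [hgh] with x hx
    rw [hx]

end WeakGradient

/-! ### Approximation by test functions -/

section Approximation

variable {n : ℕ} {Ω : Opens (RSpace n)}

/-- The common device for passing to the limit in weak formulations: the integrands b depend on h in
a Lipschitz way, so L¹ convergence of h is enough. -/
theorem tendsto_integral_of_norm_sub_le {α F : Type*} [MeasurableSpace α] {μ : Measure α}
    [NormedAddCommGroup F] {h : ℕ → α → F} {h₀ : α → F} {b : ℕ → α → ℝ} {b₀ : α → ℝ} {C : ℝ}
    (hlim : Tendsto (fun k => eLpNorm (h k - h₀) 1 μ) atTop (𝓝 0))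
    (hb : ∀ k, Integrable (b k) μ) (hb₀ : Integrable b₀ μ)
    (hle : ∀ k, ∀ᵐ x ∂μ, |b k x - b₀ x| ≤ C * ‖h k x - h₀ x‖) :
    Tendsto (fun k => ∫ x, b k x ∂μ) atTop (𝓝 (∫ x, b₀ x ∂μ)) := by
  refine tendsto_integral_of_L1' b₀ hb₀.aestronglyMeasurable (Eventually.of_forall hb) ?_
  have h1 : Tendsto (fun k => ENNReal.ofReal C * eLpNorm (h k - h₀) 1 μ) atTop (𝓝 0) := by
    have := ENNReal.Tendsto.const_mul (a := ENNReal.ofReal C) hlim (Or.inr ENNReal.ofReal_ne_top)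
    simpa using this
  refine tendsto_of_tendsto_of_tendsto_of_le_of_le tendsto_const_nhds h1 (fun _ => zero_le) ?_
  intro k
  exact eLpNorm_le_mul_eLpNorm_of_ae_le_mul (hle k) 1

theorem tendsto_eLpNorm_of_exponent_le {α F : Type*} [MeasurableSpace α] {μ : Measure α}
    [IsFiniteMeasure μ] [NormedAddCommGroup F] {p q : ℝ≥0∞} (hq : q ≠ 0) (hpq : q ≤ p)
    {h : ℕ → α → F}
    (hh : ∀ k, AEStronglyMeasurable (h k) μ)
    (hlim : Tendsto (fun k => eLpNorm (h k) p μ) atTop (𝓝 0)) :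
    Tendsto (fun k => eLpNorm (h k) q μ) atTop (𝓝 0) := by
  have hC : μ univ ^ (1 / q.toReal - 1 / p.toReal) ≠ ⊤ := by
    refine ENNReal.rpow_ne_top_of_nonneg ?_ (measure_ne_top _ _)
    rcases eq_or_ne p ⊤ with rfl | hp
    · simp
    · rw [sub_nonneg]
      exact one_div_le_one_div_of_le
        (ENNReal.toReal_pos hq (ne_top_of_le_ne_top hp hpq)) (ENNReal.toReal_mono hp hpq)
  have h1 := ENNReal.Tendsto.mul_const (b := μ univ ^ (1 / q.toReal - 1 / p.toReal)) hlim
    (Or.inr hC)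
  rw [zero_mul] at h1
  exact tendsto_of_tendsto_of_tendsto_of_le_of_le tendsto_const_nhds h1 (fun _ => zero_le)
    fun k => eLpNorm_le_eLpNorm_mul_rpow_measure_univ hpq (hh k)

/-- `u ∈ W^{1,p}_0(Ω)` with gradient `g`. -/
structure IsW10 (Ω : Opens (RSpace n)) (p : ℝ≥0∞) (u : RSpace n → ℝ)
    (g : RSpace n → RSpace n) : Prop where
  memLp : MemLp u p (volume.restrict (Ω : Set (RSpace n)))
  memLp_grad : MemLp g p (volume.restrict (Ω : Set (RSpace n)))
  exists_seq : ∃ φ : ℕ → 𝓓(Ω, ℝ),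
    Tendsto (fun k => eLpNorm (⇑(φ k) - u) p (volume.restrict (Ω : Set (RSpace n)))) atTop (𝓝 0) ∧
    Tendsto (fun k => eLpNorm (gradient (φ k) - g) p (volume.restrict (Ω : Set (RSpace n))))
      atTop (𝓝 0)

/-- The vector field `g` satisfies `-div g = F` weakly on `Ω`. -/
def IsWeakSol (Ω : Opens (RSpace n)) (g : RSpace n → RSpace n) (F : RSpace n → ℝ) : Prop :=
  ∀ φ : 𝓓(Ω, ℝ), ∫ x in (Ω : Set (RSpace n)), inner ℝ (g x) (gradient φ x) =
    ∫ x in (Ω : Set (RSpace n)), F x * φ x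

/-- `TendstoW1` only provides some weak gradients along the sequence. Uniqueness replaces them by
the classical gradients of the test functions and by one fixed g. -/
theorem MemW10.exists_isW10 {p : ℝ≥0∞} {u : RSpace n → ℝ} (hu : MemW10 Ω p u) :
    ∃ g, HasWeakGradient Ω u g ∧ IsW10 Ω p u g := by
  obtain ⟨⟨g, hg, hup, hgp⟩, φ, G, g', hG, hg', h1, h2⟩ := hu
  refine ⟨g, hg, hup, hgp, φ, h1, ?_⟩
  refine h2.congr fun k => eLpNorm_congr_ae ?_
  have e1 := (hG k).ae_unique (φ k).hasWeakGradient EventuallyEq.rfl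
  have e2 := hg'.ae_unique hg EventuallyEq.rfl
  filter_upwards [e1, e2] with x hx1 hx2
  simp [hx1, hx2]

theorem MemLp.locallyIntegrableOn_opens {F : Type*} [NormedAddCommGroup F] {p : ℝ≥0∞}
    (hp : 1 ≤ p) {u : RSpace n → F} (hu : MemLp u p (volume.restrict (Ω : Set (RSpace n)))) :
    LocallyIntegrableOn u (Ω : Set (RSpace n)) :=
  locallyIntegrableOn_of_locallyIntegrable_restrict (hu.locallyIntegrable hp)

theorem IsWeakSol.integrable_inner {g : RSpace n → RSpace n}
    (hg : LocallyIntegrableOn g (Ω : Set (RSpace n))) (φ : 𝓓(Ω, ℝ)) :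
    Integrable (fun x => inner ℝ (g x) (gradient φ x)) (volume.restrict (Ω : Set (RSpace n))) := by
  have : (fun x => inner ℝ (g x) (gradient φ x)) =
      fun x => ∑ i, inner ℝ (g x) (stdVec i) * φ.dderiv (stdVec i) x := by
    ext x
    rw [inner_eq_sum_stdVec]
    simp only [inner_gradient, TestFunction.dderiv_apply]
  rw [this]
  exact integrable_finsetSum _ fun i _ =>
    (φ.dderiv (stdVec i)).integrable_mul (LocallyIntegrableOn.inner_right hg _)

/-- Each component of g is paired with ∂ᵢφ, which is itself a test function, and the results are
summed. This is the bridge between `IsWeakSol` and the distributional Laplacian. -/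
theorem HasWeakGradient.integral_inner_gradient {u : RSpace n → ℝ} {g : RSpace n → RSpace n}
    (hg : HasWeakGradient Ω u g) (φ : 𝓓(Ω, ℝ)) :
    ∫ x in (Ω : Set (RSpace n)), inner ℝ (g x) (gradient φ x) =
      -∫ x in (Ω : Set (RSpace n)), u x * (Δ (φ : RSpace n → ℝ)) x := by
  have e1 : ∀ x, inner ℝ (g x) (gradient φ x) =
      ∑ i, inner ℝ (g x) (stdVec i) * φ.dderiv (stdVec i) x := fun x => by
    rw [inner_eq_sum_stdVec]
    simp only [inner_gradient, TestFunction.dderiv_apply]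
  have e2 : ∀ x, u x * (Δ (φ : RSpace n → ℝ)) x =
      ∑ i, u x * (φ.dderiv (stdVec i)).dderiv (stdVec i) x := fun x => by
    rw [φ.laplacian_eq, Finset.mul_sum]
  simp_rw [e1, e2]
  rw [integral_finsetSum _ fun i _ => (φ.dderiv (stdVec i)).integrable_mul
      (LocallyIntegrableOn.inner_right hg.2.1 _),
    integral_finsetSum _ fun i _ =>
      ((φ.dderiv (stdVec i)).dderiv (stdVec i)).integrable_mul hg.1, ← Finset.sum_neg_distrib]
  refine Finset.sum_congr rfl fun i _ => ?_
  have := hg.2.2 (φ.dderiv (stdVec i)) (stdVec i)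
  rw [eq_neg_iff_add_eq_zero, add_comm, ← eq_neg_iff_add_eq_zero]
  exact this

theorem HasWeakLaplacian.isWeakSol {u F : RSpace n → ℝ} {g : RSpace n → RSpace n}
    (hu : HasWeakLaplacian Ω u (fun x => -F x)) (hg : HasWeakGradient Ω u g) :
    IsWeakSol Ω g F := by
  intro φ
  rw [hg.integral_inner_gradient, hu.2.2 φ, ← integral_neg]
  simp

theorem IsWeakSol.hasWeakLaplacian {u F : RSpace n → ℝ} {g : RSpace n → RSpace n}
    (hF : LocallyIntegrableOn F (Ω : Set (RSpace n))) (hg : HasWeakGradient Ω u g)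
    (h : IsWeakSol Ω g F) : HasWeakLaplacian Ω u (fun x => -F x) := by
  refine ⟨hg.1, hF.neg, fun φ => ?_⟩
  have := hg.integral_inner_gradient φ
  rw [h φ] at this
  simp only [neg_mul, integral_neg]
  linarith

/-- Both sides of the defining identity are continuous under L¹ convergence, which L^p convergence
implies because Ω has finite measure. -/
theorem IsW10.hasWeakGradient [IsFiniteMeasure (volume.restrict (Ω : Set (RSpace n)))]
    {p : ℝ≥0∞} (hp : 1 ≤ p) {u : RSpace n → ℝ} {g : RSpace n → RSpace n} (h : IsW10 Ω p u g) :
    HasWeakGradient Ω u g := by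
  obtain ⟨hu, hg, φ, h1, h2⟩ := h
  have lu := MemLp.locallyIntegrableOn_opens hp hu
  have lg := MemLp.locallyIntegrableOn_opens hp hg
  refine ⟨lu, lg, fun ψ v => ?_⟩
  have h1' := tendsto_eLpNorm_of_exponent_le one_ne_zero hp (fun k =>
    (φ k).continuous.aestronglyMeasurable.sub hu.aestronglyMeasurable) h1
  have h2' := tendsto_eLpNorm_of_exponent_le one_ne_zero hp (fun k =>
    (φ k).continuous_gradient.aestronglyMeasurable.sub hg.aestronglyMeasurable) h2
  obtain ⟨C, -, hC⟩ := (ψ.dderiv v).bounded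
  obtain ⟨D, -, hD⟩ := ψ.bounded
  have t1 := tendsto_integral_of_norm_sub_le (C := C) h1'
    (b := fun k x => φ k x * fderiv ℝ ψ x v) (b₀ := fun x => u x * fderiv ℝ ψ x v)
    (fun k => (ψ.dderiv v).integrable_mul (φ k).hasWeakGradient.1)
    ((ψ.dderiv v).integrable_mul lu) (fun k => Eventually.of_forall fun x => by
      rw [← sub_mul, abs_mul, mul_comm, Real.norm_eq_abs]
      exact mul_le_mul_of_nonneg_right (hC x) (abs_nonneg _))
  have t2 := tendsto_integral_of_norm_sub_le (C := D * ‖v‖) h2'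
    (b := fun k x => inner ℝ (gradient (φ k) x) v * ψ x) (b₀ := fun x => inner ℝ (g x) v * ψ x)
    (fun k => ψ.integrable_mul (LocallyIntegrableOn.inner_right (φ k).hasWeakGradient.2.1 v))
    (ψ.integrable_mul (LocallyIntegrableOn.inner_right lg v))
    (fun k => Eventually.of_forall fun x => by
      rw [← sub_mul, ← inner_sub_left, abs_mul]
      calc _ ≤ (‖gradient (φ k) x - g x‖ * ‖v‖) * D :=
            mul_le_mul (abs_real_inner_le_norm _ _) (hD x) (abs_nonneg _) (by positivity)
        _ = _ := by ring)
  refine tendsto_nhds_unique t1 (t2.neg.congr fun k => ?_)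
  exact ((φ k).hasWeakGradient.2.2 ψ v).symm

theorem IsW10.memW10 [IsFiniteMeasure (volume.restrict (Ω : Set (RSpace n)))]
    {p : ℝ≥0∞} (hp : 1 ≤ p) {u : RSpace n → ℝ} {g : RSpace n → RSpace n} (h : IsW10 Ω p u g) :
    MemW10 Ω p u := by
  have hw := h.hasWeakGradient hp
  obtain ⟨hu, hg, φ, h1, h2⟩ := h
  exact ⟨⟨g, hw, hu, hg⟩, φ, fun k => gradient (φ k), g, fun k => (φ k).hasWeakGradient, hw,
    h1, h2⟩

theorem IsW10.of_exponent_le [IsFiniteMeasure (volume.restrict (Ω : Set (RSpace n)))]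
    {p q : ℝ≥0∞} (hq : q ≠ 0) (hqp : q ≤ p) {u : RSpace n → ℝ} {g : RSpace n → RSpace n}
    (h : IsW10 Ω p u g) : IsW10 Ω q u g := by
  obtain ⟨hu, hg, φ, h1, h2⟩ := h
  exact ⟨hu.mono_exponent hqp, hg.mono_exponent hqp, φ,
    tendsto_eLpNorm_of_exponent_le hq hqp (fun k =>
      (φ k).continuous.aestronglyMeasurable.sub hu.aestronglyMeasurable) h1,
    tendsto_eLpNorm_of_exponent_le hq hqp (fun k =>
      (φ k).continuous_gradient.aestronglyMeasurable.sub hg.aestronglyMeasurable) h2⟩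

theorem IsW10.exists_testFunction {p : ℝ≥0∞} {u : RSpace n → ℝ} {g : RSpace n → RSpace n}
    (h : IsW10 Ω p u g) {ε : ℝ≥0∞} (hε : ε ≠ 0) : ∃ φ : 𝓓(Ω, ℝ),
      eLpNorm (⇑φ - u) p (volume.restrict (Ω : Set (RSpace n))) ≤ ε ∧
      eLpNorm (gradient φ - g) p (volume.restrict (Ω : Set (RSpace n))) ≤ ε := by
  obtain ⟨hu, hg, φ, h1, h2⟩ := h
  have h0 : 0 < ε := pos_iff_ne_zero.2 hε
  obtain ⟨k, hk1, hk2⟩ := ((h1.eventually_le_const h0).and (h2.eventually_le_const h0)).exists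
  exact ⟨φ k, hk1, hk2⟩

theorem IsW10.sub {p : ℝ≥0∞} (hp : 1 ≤ p) {u w : RSpace n → ℝ} {g h : RSpace n → RSpace n}
    (hu : IsW10 Ω p u g) (hw : IsW10 Ω p w h) : IsW10 Ω p (u - w) (g - h) := by
  obtain ⟨hu, hg, φ, h1, h2⟩ := hu
  obtain ⟨hw, hh, ψ, h3, h4⟩ := hw
  refine ⟨hu.sub hw, hg.sub hh, fun k => φ k - ψ k, ?_, ?_⟩
  · have := h1.add h3
    rw [add_zero] at this
    refine tendsto_of_tendsto_of_tendsto_of_le_of_le tendsto_const_nhds this (fun _ => zero_le) ?_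
    intro k
    have e : ⇑(φ k - ψ k) - (u - w) = (⇑(φ k) - u) - (⇑(ψ k) - w) := by
      ext x; simp; ring
    simp only [e]
    exact eLpNorm_sub_le ((φ k).continuous.aestronglyMeasurable.sub hu.1)
      ((ψ k).continuous.aestronglyMeasurable.sub hw.1) hp
  · have := h2.add h4
    rw [add_zero] at this
    refine tendsto_of_tendsto_of_tendsto_of_le_of_le tendsto_const_nhds this (fun _ => zero_le) ?_
    intro k
    have e : gradient ⇑(φ k - ψ k) - (g - h) = (gradient (φ k) - g) - (gradient (ψ k) - h) := by
      ext1 x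
      have : ⇑(φ k - ψ k) = ⇑(φ k) - ⇑(ψ k) := by ext x; simp
      rw [this]
      simp only [Pi.sub_apply]
      rw [gradient_sub ((φ k).differentiable x) ((ψ k).differentiable x)]
      abel
    simp only [e]
    exact eLpNorm_sub_le ((φ k).continuous_gradient.aestronglyMeasurable.sub hg.1)
      ((ψ k).continuous_gradient.aestronglyMeasurable.sub hh.1) hp

theorem IsW10.const_smul {p : ℝ≥0∞} {u : RSpace n → ℝ} {g : RSpace n → RSpace n}
    (hu : IsW10 Ω p u g) (c : ℝ) : IsW10 Ω p (c • u) (c • g) := by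
  obtain ⟨hu, hg, φ, h1, h2⟩ := hu
  have hl : ∀ {l : ℕ → ℝ≥0∞}, Tendsto l atTop (𝓝 0) →
      Tendsto (fun k => ‖c‖ₑ * l k) atTop (𝓝 0) := fun h => by
    simpa using ENNReal.Tendsto.const_mul (a := ‖c‖ₑ) h (Or.inr enorm_ne_top)
  refine ⟨hu.const_smul c, hg.const_smul c, fun k => c • φ k, ?_, ?_⟩
  · refine (hl h1).congr fun k => ?_
    have e : ⇑(c • φ k) - c • u = c • (⇑(φ k) - u) := by
      ext x; simp; ring
    rw [e, eLpNorm_const_smul]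
  · refine (hl h2).congr fun k => ?_
    have e : gradient ⇑(c • φ k) - c • g = c • (gradient (φ k) - g) := by
      ext1 x
      have : ⇑(c • φ k) = c • ⇑(φ k) := by ext x; simp
      rw [this]
      simp only [Pi.sub_apply, Pi.smul_apply]
      rw [gradient_const_smul c ((φ k).differentiable x), smul_sub]
    rw [e, eLpNorm_const_smul]

theorem IsWeakSol.sub {g h : RSpace n → RSpace n} {F G : RSpace n → ℝ}
    (lg : LocallyIntegrableOn g (Ω : Set (RSpace n)))
    (lh : LocallyIntegrableOn h (Ω : Set (RSpace n)))
    (lF : LocallyIntegrableOn F (Ω : Set (RSpace n)))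
    (lG : LocallyIntegrableOn G (Ω : Set (RSpace n)))
    (hg : IsWeakSol Ω g F) (hh : IsWeakSol Ω h G) : IsWeakSol Ω (g - h) (F - G) := by
  intro φ
  simp only [Pi.sub_apply, inner_sub_left, sub_mul]
  rw [integral_sub (IsWeakSol.integrable_inner lg φ) (IsWeakSol.integrable_inner lh φ), hg φ, hh φ,
    integral_sub (φ.integrable_mul lF) (φ.integrable_mul lG)]

theorem IsWeakSol.const_smul {g : RSpace n → RSpace n} {F : RSpace n → ℝ}
    (hg : IsWeakSol Ω g F) (c : ℝ) : IsWeakSol Ω (c • g) (c • F) := by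
  intro φ
  simp only [Pi.smul_apply, inner_smul_left, smul_eq_mul, mul_assoc, RCLike.conj_to_real]
  rw [integral_const_mul, integral_const_mul, hg φ]

end Approximation

/-! ### Sobolev inequality for test functions -/

section Sobolev

variable {n : ℕ} {Ω : Opens (RSpace n)}

theorem TestFunction.support_subset (φ : 𝓓(Ω, ℝ)) : Function.support φ ⊆ Ω :=
  (subset_tsupport _).trans φ.tsupport_subset

theorem TestFunction.gradient_eq_zero (φ : 𝓓(Ω, ℝ)) {x : RSpace n} (hx : x ∉ Ω) :
    gradient φ x = 0 := by
  refine ext_inner_right ℝ fun v => ?_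
  rw [inner_gradient, ← φ.dderiv_apply, (φ.dderiv v).eq_zero_of_notMem hx, inner_zero_left]

/-- The Gagliardo–Nirenberg–Sobolev inequality; boundedness of Ω admits every exponent q up to the
critical one. -/
theorem TestFunction.eLpNorm_le_eLpNorm_gradient (hΩ : Bornology.IsBounded (Ω : Set (RSpace n)))
    {p q : ℝ} (hp : 1 ≤ p) (hpn : p < n) (hq : 0 < q) (hpq : p⁻¹ - (n : ℝ)⁻¹ ≤ q⁻¹) :
    ∃ C : NNReal, ∀ φ : 𝓓(Ω, ℝ),
      eLpNorm φ (ENNReal.ofReal q) (volume.restrict (Ω : Set (RSpace n))) ≤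
        C * eLpNorm (gradient φ) (ENNReal.ofReal p) (volume.restrict (Ω : Set (RSpace n))) := by
  have hp0 : 0 ≤ p := by linarith
  refine ⟨eLpNormLESNormFDerivOfLeConst ℝ (volume : Measure (RSpace n)) (Ω : Set (RSpace n))
    p.toNNReal q.toNNReal, fun φ => ?_⟩
  have key := eLpNorm_le_eLpNorm_fderiv_of_le (volume : Measure (RSpace n)) φ.contDiff_one
    φ.support_subset (p := p.toNNReal) (q := q.toNNReal)
    (by rw [← NNReal.coe_le_coe, Real.coe_toNNReal _ hp0]; simpa using hp)
    (by rw [← NNReal.coe_lt_coe, Real.coe_toNNReal _ hp0]; simpa using hpn)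
    (by simp only [Real.coe_toNNReal _ hp0, Real.coe_toNNReal _ hq.le, NNReal.coe_inv]
        simpa using hpq) hΩ
  rw [eLpNorm_restrict_eq_of_support_subset φ.support_subset,
    eLpNorm_restrict_eq_of_support_subset (fun x hx => by
      by_contra h; exact hx (φ.gradient_eq_zero h))]
  refine key.trans_eq ?_
  congr 1
  exact eLpNorm_congr_norm_ae (Eventually.of_forall fun x => (norm_gradient _ _).symm)

theorem isFiniteMeasure_restrict_of_isBounded (hΩ : Bornology.IsBounded (Ω : Set (RSpace n))) :
    IsFiniteMeasure (volume.restrict (Ω : Set (RSpace n))) :=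
  isFiniteMeasure_restrict.2 hΩ.measure_lt_top.ne

theorem TestFunction.poincare (hn : 2 ≤ n) (hΩ : Bornology.IsBounded (Ω : Set (RSpace n))) :
    ∃ C : NNReal, ∀ φ : 𝓓(Ω, ℝ),
      eLpNorm φ 2 (volume.restrict (Ω : Set (RSpace n))) ≤
        C * eLpNorm (gradient φ) 2 (volume.restrict (Ω : Set (RSpace n))) := by
  have hn' : (2 : ℝ) ≤ n := by exact_mod_cast hn
  have := isFiniteMeasure_restrict_of_isBounded hΩ
  -- The exponent whose Sobolev conjugate is exactly 2. It is at least 1 because n ≥ 2, and at most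
  -- 2, so Hölder on the bounded set Ω replaces the L^p norm of the gradient by its L² norm.
  set p : ℝ := 2 * n / (n + 2) with hp
  have hp1 : 1 ≤ p := by rw [hp, le_div_iff₀ (by positivity)]; linarith
  have hp2 : p ≤ 2 := by rw [hp, div_le_iff₀ (by positivity)]; linarith
  have hpn : p < n := by rw [hp, div_lt_iff₀ (by positivity)]; nlinarith
  obtain ⟨C, hC⟩ := TestFunction.eLpNorm_le_eLpNorm_gradient hΩ hp1 hpn (q := 2) (by norm_num)
    (by rw [hp]; field_simp; linarith)
  set K := (volume.restrict (Ω : Set (RSpace n))) univ ^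
      (1 / (ENNReal.ofReal p).toReal - 1 / (2 : ℝ≥0∞).toReal)
  have hK : K ≠ ⊤ := by
    refine ENNReal.rpow_ne_top_of_nonneg ?_ (measure_ne_top _ _)
    rw [ENNReal.toReal_ofReal (by linarith), sub_nonneg, ENNReal.toReal_ofNat]
    exact one_div_le_one_div_of_le (by linarith) hp2
  refine ⟨C * K.toNNReal, fun φ => ?_⟩
  have h1 := hC φ
  rw [ENNReal.ofReal_ofNat] at h1
  refine h1.trans ?_
  have h2 : eLpNorm (gradient φ) (ENNReal.ofReal p) (volume.restrict (Ω : Set (RSpace n))) ≤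
      eLpNorm (gradient φ) 2 (volume.restrict (Ω : Set (RSpace n))) * K :=
    eLpNorm_le_eLpNorm_mul_rpow_measure_univ (ENNReal.ofReal_le_of_le_toReal (by simpa using hp2))
      φ.continuous_gradient.aestronglyMeasurable
  rw [ENNReal.coe_mul, ENNReal.coe_toNNReal hK, mul_assoc, mul_comm K]
  gcongr

end Sobolev

/-! ### Gradient estimates with integrable data -/

section GradientEstimate

variable {n : ℕ} {Ω : Opens (RSpace n)}

theorem exists_smooth_primitive {h : ℝ → ℝ} (hh : ContDiff ℝ ∞ h) :
    ∃ S : ℝ → ℝ, ContDiff ℝ ∞ S ∧ S 0 = 0 ∧ (∀ t, HasDerivAt S (h t) t) ∧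
      ∀ t, S t = ∫ τ in (0 : ℝ)..t, h τ := by
  have hd : ∀ t, HasDerivAt (fun t => ∫ τ in (0 : ℝ)..t, h τ) (h t) t := fun t =>
    (hh.continuous.integral_hasStrictDerivAt 0 t).hasDerivAt
  refine ⟨fun t => ∫ τ in (0 : ℝ)..t, h τ, ?_, by simp, hd, fun _ => rfl⟩
  rw [contDiff_infty_iff_deriv]
  refine ⟨fun t => (hd t).differentiableAt, ?_⟩
  rwa [show deriv (fun t => ∫ τ in (0 : ℝ)..t, h τ) = h from funext fun t => (hd t).deriv]

theorem inner_le_half_sq {V : Type*} [NormedAddCommGroup V] [InnerProductSpace ℝ V] (a b : V) :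
    2 * inner ℝ a b ≤ ‖a‖ ^ 2 + ‖b‖ ^ 2 := by
  have := norm_sub_sq_real a b
  nlinarith [sq_nonneg ‖a - b‖]

theorem integrable_norm_sq_of_memLp {α V : Type*} [MeasurableSpace α] {μ : Measure α}
    [NormedAddCommGroup V] {f : α → V} (hf : MemLp f 2 μ) :
    Integrable (fun x => ‖f x‖ ^ 2) μ := hf.integrable_norm_pow two_ne_zero

theorem eLpNorm_two_eq {α V : Type*} [MeasurableSpace α] {μ : Measure α}
    [NormedAddCommGroup V] {f : α → V} (hf : MemLp f 2 μ) :
    eLpNorm f 2 μ = ENNReal.ofReal (Real.sqrt (∫ x, ‖f x‖ ^ 2 ∂μ)) := by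
  rw [hf.eLpNorm_eq_integral_rpow_norm two_ne_zero ENNReal.ofNat_ne_top]
  simp [Real.sqrt_eq_rpow]

theorem integral_norm_sq_le_of_eLpNorm_le {α V : Type*} [MeasurableSpace α] {μ : Measure α}
    [NormedAddCommGroup V] {f : α → V} (hf : MemLp f 2 μ) {c : ℝ} (hc : 0 ≤ c)
    (h : eLpNorm f 2 μ ≤ ENNReal.ofReal c) : ∫ x, ‖f x‖ ^ 2 ∂μ ≤ c ^ 2 := by
  rw [eLpNorm_two_eq hf, ENNReal.ofReal_le_ofReal_iff hc, Real.sqrt_le_left hc] at h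
  exact h

theorem eLpNorm_two_le_of_integral_le {α V : Type*} [MeasurableSpace α] {μ : Measure α}
    [NormedAddCommGroup V] {f : α → V} (hf : MemLp f 2 μ) {c : ℝ}
    (h : ∫ x, ‖f x‖ ^ 2 ∂μ ≤ c) : eLpNorm f 2 μ ≤ ENNReal.ofReal (Real.sqrt c) := by
  rw [eLpNorm_two_eq hf]
  exact ENNReal.ofReal_le_ofReal (Real.sqrt_le_sqrt h)

/-- Energy estimate for a truncated weak solution. -/
theorem IsWeakSol.integral_weighted_gradient_sq_le {g : RSpace n → RSpace n} {F : RSpace n → ℝ}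
    (hg : MemLp g 2 (volume.restrict (Ω : Set (RSpace n)))) (hsol : IsWeakSol Ω g F)
    (hF : IntegrableOn F (Ω : Set (RSpace n))) {h S : ℝ → ℝ} (hS : ContDiff ℝ ∞ S)
    (hS0 : S 0 = 0) (hSd : ∀ t, HasDerivAt S (h t) t) (hh : Continuous h) (h0 : ∀ t, 0 ≤ h t)
    (h1 : ∀ t, h t ≤ 1) {B : ℝ} (hB : ∀ t, |S t| ≤ B) (φ : 𝓓(Ω, ℝ)) :
    ∫ x in (Ω : Set (RSpace n)), h (φ x) * ‖gradient φ x‖ ^ 2 ≤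
      2 * (B * ∫ x in (Ω : Set (RSpace n)), |F x|) +
        ∫ x in (Ω : Set (RSpace n)), ‖gradient φ x - g x‖ ^ 2 := by
  -- The test function is built from the approximation φ and not from the solution, so it is smooth;
  -- the price is the term with ∇φ - g.
  set ψ := φ.smoothComp S hS hS0 with hψ
  have lg := MemLp.locallyIntegrableOn_opens one_le_two hg
  have hgrad : ∀ x, gradient ψ x = h (φ x) • gradient φ x := fun x => by
    have := gradient_comp (hSd (φ x)).differentiableAt (φ.differentiable x)
    rw [(hSd (φ x)).deriv] at this
    exact this
  have e1 := hsol ψ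
  have i1 := IsWeakSol.integrable_inner lg ψ
  have i2 : Integrable (fun x => ‖gradient φ x - g x‖ ^ 2)
      (volume.restrict (Ω : Set (RSpace n))) :=
    integrable_norm_sq_of_memLp ((φ.memLp_gradient 2 _).sub hg)
  have i3 : Integrable (fun x => F x * ψ x) (volume.restrict (Ω : Set (RSpace n))) :=
    ψ.integrable_mul hF.locallyIntegrableOn
  have hFle : ∫ x in (Ω : Set (RSpace n)), F x * ψ x ≤
      B * ∫ x in (Ω : Set (RSpace n)), |F x| := by
    rw [← integral_const_mul]
    refine integral_mono i3 (hF.abs.const_mul B) fun x => ?_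
    calc F x * ψ x ≤ |F x * ψ x| := le_abs_self _
      _ = |ψ x| * |F x| := by rw [abs_mul, mul_comm]
      _ ≤ B * |F x| := mul_le_mul_of_nonneg_right (hB _) (abs_nonneg _)
  -- Write |∇φ|² = ⟨g, ∇φ⟩ + ⟨∇φ - g, ∇φ⟩, apply Young's inequality to the last product, absorb half
  -- of |∇φ|² on the left and use h ≤ 1.
  have hpt : ∀ x, h (φ x) * ‖gradient φ x‖ ^ 2 ≤
      2 * inner ℝ (g x) (gradient ψ x) + ‖gradient φ x - g x‖ ^ 2 := fun x => by
    rw [hgrad, inner_smul_right]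
    have a1 := inner_le_half_sq (gradient φ x - g x) (gradient φ x)
    rw [inner_sub_left, real_inner_self_eq_norm_sq] at a1
    have a2 := mul_le_mul_of_nonneg_left a1 (h0 (φ x))
    have a3 := mul_le_mul_of_nonneg_right (h1 (φ x)) (sq_nonneg ‖gradient φ x - g x‖)
    nlinarith
  have hc : HasCompactSupport fun x => h (φ x) * ‖gradient φ x‖ ^ 2 :=
    (φ.hasCompactSupport_gradient.comp_left (g := fun v => ‖v‖ ^ 2) (by simp)).mul_left
  have i4 : Integrable (fun x => h (φ x) * ‖gradient φ x‖ ^ 2)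
      (volume.restrict (Ω : Set (RSpace n))) :=
    ((hh.comp φ.continuous).mul (φ.continuous_gradient.norm.pow 2)).integrable_of_hasCompactSupport
      hc
  calc _ ≤ ∫ x in (Ω : Set (RSpace n)), (2 * inner ℝ (g x) (gradient ψ x) +
        ‖gradient φ x - g x‖ ^ 2) := integral_mono i4 ((i1.const_mul 2).add i2) hpt
    _ = 2 * (∫ x in (Ω : Set (RSpace n)), F x * ψ x) +
        ∫ x in (Ω : Set (RSpace n)), ‖gradient φ x - g x‖ ^ 2 := by
      rw [integral_add (i1.const_mul 2) i2, integral_const_mul, e1]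
    _ ≤ _ := by linarith

/-- Since a < 1 the right side is sublinear in Y. When Y > 1, K is at most KY, so Y ≤ A(K+C)^a Y^a,
and finiteness of Y permits division by Y^a. -/
theorem exists_bound_of_le_mul_rpow {a : ℝ} (ha0 : 0 < a) (ha1 : a < 1) (A K C : NNReal) :
    ∃ D : NNReal, ∀ Y : ℝ≥0∞, Y ≠ ⊤ → Y ≤ A * (K + C * Y) ^ a → Y ≤ D := by
  have ha' : 0 < 1 - a := by linarith
  refine ⟨max 1 ((A * (K + C) ^ a) ^ (1 / (1 - a))), fun Y hY h => ?_⟩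
  lift Y to NNReal using hY
  have h' : Y ≤ A * (K + C * Y) ^ a := by
    have : ((A * (K + C * Y) ^ a : NNReal) : ℝ≥0∞) = A * (K + C * Y) ^ a := by
      rw [ENNReal.coe_mul, ENNReal.coe_rpow_of_nonneg _ ha0.le]
      simp
    rw [← this] at h
    exact_mod_cast h
  rw [ENNReal.coe_le_coe]
  rcases le_or_gt Y 1 with hY1 | hY1
  · exact hY1.trans (le_max_left _ _)
  refine le_trans ?_ (le_max_right _ _)
  have hY0 : Y ≠ 0 := (zero_lt_one.trans hY1).ne'
  have h2 : Y ≤ (A * (K + C) ^ a) * Y ^ a := by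
    refine h'.trans ?_
    rw [mul_assoc, ← NNReal.mul_rpow]
    gcongr
    rw [add_mul]
    gcongr
    exact le_mul_of_one_le_right zero_le hY1.le
  have h3 : Y ^ (1 - a) ≤ A * (K + C) ^ a := by
    rw [NNReal.rpow_sub hY0, NNReal.rpow_one]
    exact div_le_of_le_mul₀ zero_le zero_le h2
  calc Y = (Y ^ (1 - a)) ^ (1 / (1 - a)) := by
        rw [← NNReal.rpow_mul, mul_one_div_cancel ha'.ne', NNReal.rpow_one]
    _ ≤ _ := NNReal.rpow_le_rpow h3 (by positivity)

theorem rpow_weight_le {a : ℝ} (ha : 0 ≤ a) (t : ℝ) :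
    ((1 + |t|) ^ (-a)) ^ 2 ≤ (1 + t ^ 2) ^ (-a) := by
  have h1 : 0 < 1 + |t| := by positivity
  rw [← Real.rpow_natCast, ← Real.rpow_mul h1.le, mul_comm, Real.rpow_mul h1.le, Real.rpow_natCast]
  refine Real.rpow_le_rpow_of_nonpos (by positivity) ?_ (by linarith)
  nlinarith [abs_nonneg t, sq_abs t]

/-- The gradient of a test function with finite weighted energy is bounded in `L^q`. -/
theorem exists_eLpNorm_gradient_le_of_weighted (hn : 2 ≤ n)
    (hΩ : Bornology.IsBounded (Ω : Set (RSpace n))) {q : ℝ} (hq1 : 1 ≤ q)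
    (hq2 : q < 2) {a : ℝ} (ha0 : 1 / 2 < a) (ha1 : a < 1)
    (haq : 2 * a * (1 - q / n) ≤ 2 - q) (M : ℝ) :
    ∃ D : NNReal, ∀ φ : 𝓓(Ω, ℝ),
      ∫ x in (Ω : Set (RSpace n)), (1 + φ x ^ 2) ^ (-a) * ‖gradient φ x‖ ^ 2 ≤ M →
      eLpNorm (gradient φ) (ENNReal.ofReal q) (volume.restrict (Ω : Set (RSpace n))) ≤ D := by
  have hn' : (2 : ℝ) ≤ n := by exact_mod_cast hn
  have := isFiniteMeasure_restrict_of_isBounded hΩ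
  set μ := volume.restrict (Ω : Set (RSpace n)) with hμ
  -- The Hölder exponent with 1/q = 1/r + 1/2: the weight (1+|φ|)^a must be estimated in L^r, that
  -- is, φ in L^{ra}.
  set r : ℝ := 2 * q / (2 - q) with hr
  have hq0 : 0 < q := by linarith
  have h2q : 0 < 2 - q := by linarith
  have hr0 : 0 < r := by positivity
  have hs0 : 0 < r * a := by positivity
  have hs1 : 1 ≤ r * a := by
    rw [hr, div_mul_eq_mul_div, le_div_iff₀ h2q]
    nlinarith
  -- `haq` is the Sobolev condition 1/q - 1/n ≤ 1/(ra) cleared of denominators.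
  obtain ⟨C, hC⟩ := TestFunction.eLpNorm_le_eLpNorm_gradient hΩ hq1 (by linarith) hs0 (by
    rw [hr]
    have : (2 * q / (2 - q) * a)⁻¹ = (2 - q) / (2 * a) / q := by field_simp
    rw [this]
    have : q⁻¹ - (n : ℝ)⁻¹ = (1 - q / n) / q := by field_simp
    rw [this]
    gcongr
    rw [le_div_iff₀ (by linarith)]
    linarith)
  have hK : eLpNorm (fun _ : RSpace n => (1 : ℝ)) (ENNReal.ofReal (r * a)) μ ≠ ⊤ :=
    (memLp_const 1).eLpNorm_ne_top
  -- The inequality to be closed is Y ≤ √M (K + C Y)^a, where Y is the L^q norm of the gradient and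
  -- K the L^{ra} norm of 1.
  obtain ⟨D, hD⟩ := exists_bound_of_le_mul_rpow (by linarith) ha1 (Real.sqrt M).toNNReal
    (eLpNorm (fun _ : RSpace n => (1 : ℝ)) (ENNReal.ofReal (r * a)) μ).toNNReal C
  refine ⟨D, fun φ hφ => hD _ (φ.memLp_gradient _ _).eLpNorm_ne_top ?_⟩
  rw [ENNReal.coe_toNNReal hK]
  have hpos : ∀ x, 0 < 1 + |φ x| := fun x => by positivity
  have hcont : Continuous fun x => (1 + |φ x|) ^ (-a) :=
    (continuous_const.add φ.continuous.abs).rpow_const fun x => Or.inl (hpos x).ne'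
  have hcont' : Continuous fun x => (1 + |φ x|) ^ a :=
    (continuous_const.add φ.continuous.abs).rpow_const fun x => Or.inl (hpos x).ne'
  have hcont2 : Continuous fun x => (1 + φ x ^ 2) ^ (-a) :=
    (continuous_const.add (φ.continuous.pow 2)).rpow_const fun x =>
      Or.inl (show (1 + φ x ^ 2 : ℝ) ≠ 0 by positivity)
  let f : RSpace n → RSpace n := fun x => ((1 + |φ x|) ^ (-a)) • gradient φ x
  have hfL : MemLp f 2 μ :=
    (hcont.smul φ.continuous_gradient).memLp_of_hasCompactSupport
      φ.hasCompactSupport_gradient.smul_left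
  have hf2 : eLpNorm f 2 μ ≤ ENNReal.ofReal (Real.sqrt M) := by
    refine eLpNorm_two_le_of_integral_le hfL (le_trans ?_ hφ)
    have hc : HasCompactSupport fun x => (1 + φ x ^ 2) ^ (-a) * ‖gradient φ x‖ ^ 2 :=
      (φ.hasCompactSupport_gradient.comp_left (g := fun v => ‖v‖ ^ 2) (by simp)).mul_left
    have hi : Integrable (fun x => (1 + φ x ^ 2) ^ (-a) * ‖gradient φ x‖ ^ 2) μ :=
      (hcont2.mul (φ.continuous_gradient.norm.pow 2)).integrable_of_hasCompactSupport hc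
    refine integral_mono (integrable_norm_sq_of_memLp hfL) hi fun x => ?_
    have e : ‖f x‖ ^ 2 = ((1 + |φ x|) ^ (-a)) ^ 2 * ‖gradient φ x‖ ^ 2 := by
      simp only [f, norm_smul, mul_pow, Real.norm_eq_abs, sq_abs]
    change ‖f x‖ ^ 2 ≤ _
    rw [e]
    exact mul_le_mul_of_nonneg_right (rpow_weight_le (by linarith) _) (by positivity)
  have hHol : ENNReal.HolderTriple (ENNReal.ofReal r) 2 (ENNReal.ofReal q) := by
    constructor
    rw [← ENNReal.ofReal_inv_of_pos hr0, ← ENNReal.ofReal_inv_of_pos hq0,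
      show (2 : ℝ≥0∞)⁻¹ = ENNReal.ofReal 2⁻¹ by
        rw [ENNReal.ofReal_inv_of_pos two_pos]; simp,
      ← ENNReal.ofReal_add (by positivity) (by positivity)]
    congr 1
    rw [hr]; field_simp; ring
  have hfac : gradient φ = (fun x => (1 + |φ x|) ^ a) • f := by
    ext1 x
    simp only [f, Pi.smul_apply', smul_smul]
    rw [← Real.rpow_add (hpos x), add_neg_cancel, Real.rpow_zero, one_smul]
  have hw : eLpNorm (fun x => (1 + |φ x|) ^ a) (ENNReal.ofReal r) μ ≤
      (eLpNorm (fun _ : RSpace n => (1 : ℝ)) (ENNReal.ofReal (r * a)) μ +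
        C * eLpNorm (gradient φ) (ENNReal.ofReal q) μ) ^ a := by
    have e1 : (fun x => (1 + |φ x|) ^ a) = fun x => ‖1 + |φ x|‖ ^ a := by
      ext x; rw [Real.norm_of_nonneg (hpos x).le]
    rw [e1, eLpNorm_norm_rpow _ (by linarith), ← ENNReal.ofReal_mul hr0.le]
    refine ENNReal.rpow_le_rpow ?_ (by linarith)
    refine (eLpNorm_add_le (f := fun _ => (1 : ℝ)) (g := fun x => |φ x|)
      aestronglyMeasurable_const φ.continuous.abs.aestronglyMeasurable
      (ENNReal.one_le_ofReal.2 hs1)).trans ?_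
    gcongr
    have e2 : eLpNorm (fun x => |φ x|) (ENNReal.ofReal (r * a)) μ =
        eLpNorm φ (ENNReal.ofReal (r * a)) μ :=
      eLpNorm_congr_norm_ae (Eventually.of_forall fun x => by simp)
    rw [e2]
    exact hC φ
  have key := eLpNorm_smul_le_mul_eLpNorm (p := ENNReal.ofReal r) (q := 2) (r := ENNReal.ofReal q)
    (μ := μ) hfL.1 hcont'.aestronglyMeasurable
  rw [← hfac] at key
  refine key.trans ?_
  rw [mul_comm]
  exact mul_le_mul' hf2 hw

/-- `W^{1,q}` bound for variational solutions by the `L¹` norm of the data. -/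
theorem exists_eLpNorm_le_of_isWeakSol (hn : 2 ≤ n)
    (hΩ : Bornology.IsBounded (Ω : Set (RSpace n))) {q : ℝ} (hq1 : 1 ≤ q)
    (hq : q < (n : ℝ) / ((n : ℝ) - 1)) :
    ∃ C : NNReal, ∀ (u : RSpace n → ℝ) (g : RSpace n → RSpace n) (F : RSpace n → ℝ) (c : ℝ),
      IsW10 Ω 2 u g → IsWeakSol Ω g F → IntegrableOn F (Ω : Set (RSpace n)) → 0 < c →
      ∫ x in (Ω : Set (RSpace n)), |F x| ≤ c →
      eLpNorm u (ENNReal.ofReal q) (volume.restrict (Ω : Set (RSpace n))) ≤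
          C * ENNReal.ofReal c ∧
        eLpNorm g (ENNReal.ofReal q) (volume.restrict (Ω : Set (RSpace n))) ≤
          C * ENNReal.ofReal c := by
  have hn' : (2 : ℝ) ≤ n := by exact_mod_cast hn
  have := isFiniteMeasure_restrict_of_isBounded hΩ
  set μ := volume.restrict (Ω : Set (RSpace n)) with hμ
  have hqn : q * ((n : ℝ) - 1) < n := by rwa [lt_div_iff₀ (by linarith)] at hq
  have hq2 : q < 2 := by nlinarith
  have hd : 0 < 1 - q / n := by rw [sub_pos, div_lt_one (by linarith)]; linarith
  -- This is q < n/(n-1) rewritten. It says that (2-q)/(2(1-q/n)) exceeds 1/2, which leaves room for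
  -- the exponent a.
  have hd' : 1 - q / n < 2 - q := by
    have : q / n * n = q := by field_simp
    have : q - q / n < 1 := by
      have : (q - q / n) * n < 1 * n := by nlinarith
      exact lt_of_mul_lt_mul_right this (by linarith)
    linarith
  obtain ⟨a, ha0, ha1, haq⟩ : ∃ a : ℝ, 1 / 2 < a ∧ a < 1 ∧ 2 * a * (1 - q / n) ≤ 2 - q := by
    refine ⟨min (3 / 4) ((2 - q) / (2 * (1 - q / n))), ?_, ?_, ?_⟩
    · refine lt_min (by norm_num) ?_
      rw [lt_div_iff₀ (by positivity)]; linarith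
    · exact (min_le_left _ _).trans_lt (by norm_num)
    · have := min_le_right (3 / 4) ((2 - q) / (2 * (1 - q / n)))
      rw [le_div_iff₀ (by positivity)] at this
      linarith
  have hh : ContDiff ℝ ∞ fun t : ℝ => (1 + t ^ 2) ^ (-a) :=
    (contDiff_const.add (contDiff_id.pow 2)).rpow_const_of_ne fun t => by positivity
  obtain ⟨S, hS, hS0, hSd, hSint⟩ := exists_smooth_primitive hh
  -- The weight is integrable on the line because 2a > 1; its integral B bounds the primitive S.
  have hint : Integrable fun t : ℝ => (1 + t ^ 2) ^ (-a) := by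
    have := integrable_rpow_neg_one_add_norm_sq (E := ℝ) (μ := volume) (r := 2 * a)
      (by simp; linarith)
    refine this.congr (Eventually.of_forall fun t => ?_)
    simp only [Real.norm_eq_abs, sq_abs]
    congr 1; ring
  have hh0 : ∀ t : ℝ, 0 ≤ (1 + t ^ 2) ^ (-a) := fun t => by positivity
  have hh1 : ∀ t : ℝ, (1 + t ^ 2) ^ (-a) ≤ 1 := fun t =>
    Real.rpow_le_one_of_one_le_of_nonpos (by nlinarith) (by linarith)
  set B := ∫ t : ℝ, (1 + t ^ 2) ^ (-a)
  have hB0 : 0 ≤ B := integral_nonneg hh0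
  have hB : ∀ t, |S t| ≤ B := fun t => by
    rw [hSint]
    have h1 := intervalIntegral.norm_integral_le_integral_norm_uIoc (a := 0) (b := t)
      (f := fun τ : ℝ => (1 + τ ^ 2) ^ (-a)) (μ := volume)
    simp only [Real.norm_of_nonneg (hh0 _), Real.norm_eq_abs] at h1
    refine h1.trans ?_
    exact setIntegral_le_integral hint (Eventually.of_forall hh0)
  -- The level 2B + 1 is 2B‖F‖₁ with ‖F‖₁ ≤ 1, plus the squared L² error of the gradient of the
  -- approximating test function, which is chosen at most 1.
  obtain ⟨D, hD⟩ := exists_eLpNorm_gradient_le_of_weighted hn hΩ hq1 hq2 ha0 ha1 haq (2 * B + 1)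
  obtain ⟨P, hP⟩ := TestFunction.eLpNorm_le_eLpNorm_gradient hΩ hq1 (by linarith)
    (by linarith : 0 < q) (by
      have : 0 ≤ (n : ℝ)⁻¹ := by positivity
      linarith)
  have hq1' : 1 ≤ ENNReal.ofReal q := ENNReal.one_le_ofReal.2 hq1
  have hqle : ENNReal.ofReal q ≤ 2 := ENNReal.ofReal_le_of_le_toReal (by simpa using hq2.le)
  -- normalized data
  have norm : ∀ (u : RSpace n → ℝ) (g : RSpace n → RSpace n) (F : RSpace n → ℝ),
      IsW10 Ω 2 u g → IsWeakSol Ω g F → IntegrableOn F (Ω : Set (RSpace n)) →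
      ∫ x in (Ω : Set (RSpace n)), |F x| ≤ 1 →
      eLpNorm u (ENNReal.ofReal q) μ ≤ (P * D + D + 1 : NNReal) ∧
        eLpNorm g (ENNReal.ofReal q) μ ≤ (P * D + D + 1 : NNReal) := by
    intro u g F hu hsol hF hF1
    have hu2 := hu
    obtain ⟨hu', hg', φ, h1, h2⟩ := hu
    have h1q := tendsto_eLpNorm_of_exponent_le (zero_lt_one.trans_le hq1').ne' hqle (fun k =>
      (φ k).continuous.aestronglyMeasurable.sub hu'.aestronglyMeasurable) h1
    have h2q := tendsto_eLpNorm_of_exponent_le (zero_lt_one.trans_le hq1').ne' hqle (fun k =>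
      (φ k).continuous_gradient.aestronglyMeasurable.sub hg'.aestronglyMeasurable) h2
    obtain ⟨k, hk2, hk1q, hk2q⟩ := ((h2.eventually_le_const zero_lt_one).and
      ((h1q.eventually_le_const zero_lt_one).and (h2q.eventually_le_const zero_lt_one))).exists
    have hE := hsol.integral_weighted_gradient_sq_le hg' hF hS hS0 hSd hh.continuous hh0 hh1 hB
      (φ k)
    have hsq := integral_norm_sq_le_of_eLpNorm_le (((φ k).memLp_gradient 2 μ).sub hg')
      zero_le_one (by simpa using hk2)
    have hDk := hD (φ k) (hE.trans (by
      have := mul_le_mul_of_nonneg_left hF1 hB0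
      simp only [Pi.sub_apply] at hsq
      linarith))
    have hPk := hP (φ k)
    constructor
    · have e : u = ⇑(φ k) - (⇑(φ k) - u) := by ext x; simp
      rw [e]
      refine (eLpNorm_sub_le (φ k).continuous.aestronglyMeasurable
        ((φ k).continuous.aestronglyMeasurable.sub hu'.1) hq1').trans ?_
      have : eLpNorm (φ k) (ENNReal.ofReal q) μ ≤ P * D := hPk.trans (by gcongr)
      calc _ ≤ (P * D : ℝ≥0∞) + 1 := add_le_add this hk1q
        _ ≤ _ := by push_cast; gcongr; exact le_self_add
    · have e : g = gradient (φ k) - (gradient (φ k) - g) := by ext1 x; simp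
      rw [e]
      refine (eLpNorm_sub_le (φ k).continuous_gradient.aestronglyMeasurable
        ((φ k).continuous_gradient.aestronglyMeasurable.sub hg'.1) hq1').trans ?_
      calc _ ≤ (D : ℝ≥0∞) + 1 := add_le_add hDk hk2q
        _ ≤ _ := by push_cast; gcongr; exact le_add_self
  refine ⟨P * D + D + 1, fun u g F c hu hsol hF hc hFc => ?_⟩
  -- The problem is linear, so dividing by c reduces to data of norm at most 1.
  have hs := norm _ _ _ (hu.const_smul c⁻¹) (hsol.const_smul c⁻¹) (hF.smul c⁻¹) (by
    simp only [Pi.smul_apply, smul_eq_mul, abs_mul, abs_inv, abs_of_pos hc]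
    rw [integral_const_mul, inv_mul_le_iff₀ hc, mul_one]
    exact hFc)
  have hcc : ENNReal.ofReal c = ‖c‖ₑ := by rw [Real.enorm_eq_ofReal hc.le]
  constructor
  · have e : u = c • (c⁻¹ • u) := by rw [smul_smul, mul_inv_cancel₀ hc.ne', one_smul]
    rw [e, eLpNorm_const_smul, hcc, mul_comm]
    gcongr
    exact hs.1
  · have e : g = c • (c⁻¹ • g) := by rw [smul_smul, mul_inv_cancel₀ hc.ne', one_smul]
    rw [e, eLpNorm_const_smul, hcc, mul_comm]
    gcongr
    exact hs.2

end GradientEstimate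

/-! ### Existence of variational solutions -/

section Existence

variable {n : ℕ} {Ω : Opens (RSpace n)}

/-- The gradient as a linear map from test functions to `L²`. -/
def gradientL2 (Ω : Opens (RSpace n)) :
    𝓓(Ω, ℝ) →ₗ[ℝ] Lp (RSpace n) 2 (volume.restrict (Ω : Set (RSpace n))) where
  toFun φ := (φ.memLp_gradient 2 _).toLp (gradient φ)
  map_add' φ ψ := by
    rw [← MemLp.toLp_add]
    refine MemLp.toLp_congr _ _ (Eventually.of_forall fun x => ?_)
    exact gradient_add (φ.differentiable x) (ψ.differentiable x)
  map_smul' c φ := by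
    rw [RingHom.id_apply, ← MemLp.toLp_const_smul]
    refine MemLp.toLp_congr _ _ (Eventually.of_forall fun x => ?_)
    exact gradient_const_smul c (φ.differentiable x)

/-- Integration against `F` as a linear functional on test functions. -/
def pairing {F : RSpace n → ℝ} (hF : LocallyIntegrableOn F (Ω : Set (RSpace n))) :
    𝓓(Ω, ℝ) →ₗ[ℝ] ℝ where
  toFun φ := ∫ x in (Ω : Set (RSpace n)), F x * φ x
  map_add' φ ψ := by
    rw [← integral_add (φ.integrable_mul hF) (ψ.integrable_mul hF)]
    refine integral_congr_ae (Eventually.of_forall fun x => ?_)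
    exact mul_add _ _ _
  map_smul' c φ := by
    rw [RingHom.id_apply, smul_eq_mul, ← integral_const_mul]
    refine integral_congr_ae (Eventually.of_forall fun x => ?_)
    exact mul_left_comm _ _ _

theorem enorm_integral_mul_le_eLpNorm {μ : Measure (RSpace n)} {f g : RSpace n → ℝ}
    (hf : MemLp f 2 μ) (hg : MemLp g 2 μ) :
    ‖∫ x, f x * g x ∂μ‖ₑ ≤ eLpNorm f 2 μ * eLpNorm g 2 μ := by
  calc _ ≤ eLpNorm (f • g) 1 μ := by
        rw [eLpNorm_one_eq_lintegral_enorm]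
        exact enorm_integral_le_lintegral_enorm _
    _ ≤ _ := eLpNorm_smul_le_mul_eLpNorm hg.1 hf.1

/-- The Dirichlet principle carried out among L² vector fields. By Poincaré, φ ↦ ∫Fφ depends only on
∇φ and is bounded in its L² norm; the field in the closure of the gradients that represents this
functional is the gradient of the solution. -/
theorem exists_isW10_isWeakSol (hn : 2 ≤ n) (hΩ : Bornology.IsBounded (Ω : Set (RSpace n)))
    (F : 𝓓(Ω, ℝ)) : ∃ u g, IsW10 Ω 2 u g ∧ IsWeakSol Ω g F := by
  have := isFiniteMeasure_restrict_of_isBounded hΩ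
  set μ := volume.restrict (Ω : Set (RSpace n)) with hμ
  obtain ⟨P, hP⟩ := TestFunction.poincare hn hΩ
  have hnorm : ∀ φ : 𝓓(Ω, ℝ), ‖gradientL2 Ω φ‖ₑ = eLpNorm (gradient φ) 2 μ := fun φ => by
    rw [Lp.enorm_def]
    exact eLpNorm_congr_ae (φ.memLp_gradient 2 _).coeFn_toLp
  have lF : LocallyIntegrableOn F (Ω : Set (RSpace n)) :=
    MemLp.locallyIntegrableOn_opens le_rfl (F.memLp 1 _)
  set L := pairing lF with hL
  have hLb : ∀ φ : 𝓓(Ω, ℝ), ‖L φ‖ₑ ≤ (eLpNorm F 2 μ * P) * ‖gradientL2 Ω φ‖ₑ := fun φ => by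
    refine (enorm_integral_mul_le_eLpNorm (F.memLp 2 _) (φ.memLp 2 _)).trans ?_
    rw [mul_assoc, hnorm]
    gcongr
    exact hP φ
  obtain ⟨ℓ, hℓ⟩ : ∃ ℓ, (gradientL2 Ω).dualMap ℓ = L := by
    have : L ∈ (gradientL2 Ω).dualMap.range := by
      rw [LinearMap.range_dualMap_eq_dualAnnihilator_ker, Submodule.mem_dualAnnihilator]
      intro φ hφ
      have := hLb φ
      rw [LinearMap.mem_ker.1 hφ, enorm_zero, mul_zero] at this
      simpa using this
    exact this
  have hℓ' : ∀ φ, ℓ (gradientL2 Ω φ) = L φ := fun φ => by rw [← hℓ]; rfl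
  set R := (gradientL2 Ω).range with hR
  have hKtop : eLpNorm F 2 μ * P ≠ ⊤ :=
    ENNReal.mul_ne_top (F.memLp 2 _).eLpNorm_ne_top ENNReal.coe_ne_top
  let ℓR : StrongDual ℝ R := (ℓ.comp R.subtype).mkContinuous (eLpNorm F 2 μ * P).toReal (by
    rintro ⟨x, φ, rfl⟩
    have := ENNReal.toReal_mono (ENNReal.mul_ne_top hKtop enorm_ne_top) (hLb φ)
    rw [ENNReal.toReal_mul, toReal_enorm, toReal_enorm] at this
    change ‖ℓ (gradientL2 Ω φ)‖ ≤ _ * ‖gradientL2 Ω φ‖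
    rwa [hℓ'])
  -- Hahn–Banach and Riesz give a field with the right pairings against gradients. Projecting it to
  -- the closure K preserves these pairings and makes it a limit of gradients of test functions.
  obtain ⟨T, hT, -⟩ := exists_extension_norm_eq R ℓR
  set G₀ := (InnerProductSpace.toDual ℝ _).symm T with hG₀
  set K := R.topologicalClosure with hK
  have : CompleteSpace K := R.isClosed_topologicalClosure.completeSpace_coe
  set G : Lp (RSpace n) 2 μ := K.starProjection G₀ with hG
  have hGφ : ∀ φ, inner ℝ G (gradientL2 Ω φ) = L φ := fun φ => by
    have hmem : gradientL2 Ω φ ∈ K := R.le_topologicalClosure ⟨φ, rfl⟩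
    have h1 : inner ℝ (G₀ - G) (gradientL2 Ω φ) = 0 :=
      Submodule.starProjection_inner_eq_zero G₀ _ hmem
    rw [inner_sub_left, sub_eq_zero] at h1
    rw [← h1, hG₀, InnerProductSpace.toDual_symm_apply, ← hℓ']
    exact hT ⟨_, φ, rfl⟩
  have hGK : G ∈ closure (R : Set (Lp (RSpace n) 2 μ)) := by
    have : G ∈ K := Submodule.starProjection_apply_mem K G₀
    rwa [hK, ← SetLike.mem_coe, Submodule.topologicalClosure_coe] at this
  obtain ⟨s, hs, hlim⟩ := mem_closure_iff_seq_limit.1 hGK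
  choose φ hφ using hs
  let e : ℕ → Lp ℝ 2 μ := fun k => ((φ k).memLp 2 μ).toLp _
  -- Poincaré transfers the Cauchy property from the gradients to the functions; P + 1 avoids
  -- dividing by zero.
  have hcau : CauchySeq e := by
    have hc : CauchySeq s := hlim.cauchySeq
    rw [EMetric.cauchySeq_iff] at hc ⊢
    intro ε hε
    obtain ⟨N, hN⟩ := hc (ε / (P + 1)) (ENNReal.div_pos hε.ne' (by simp))
    refine ⟨N, fun k hk l hl => ?_⟩
    have h1 := hN k hk l hl
    rw [← hφ, ← hφ, edist_eq_enorm_sub, ← map_sub, hnorm] at h1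
    rw [Lp.edist_toLp_toLp]
    have h2 := hP (φ k - φ l)
    have h3 : ⇑(φ k - φ l) = ⇑(φ k) - ⇑(φ l) := by ext x; simp
    rw [h3] at h1 h2
    calc _ ≤ _ := h2
      _ ≤ (P + 1) * eLpNorm (gradient (⇑(φ k) - ⇑(φ l))) 2 μ := by gcongr; exact le_self_add
      _ < ε := by
        rw [mul_comm]
        exact (ENNReal.lt_div_iff_mul_lt (by simp) (by simp)).1 h1
  obtain ⟨u, hu⟩ := cauchySeq_tendsto_of_complete hcau
  refine ⟨u, G, ⟨Lp.memLp u, Lp.memLp G, φ, ?_, ?_⟩, fun ψ => ?_⟩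
  · have h1 := (tendsto_iff_edist_tendsto_0.1 hu)
    refine h1.congr fun k => ?_
    rw [Lp.edist_def]
    refine eLpNorm_congr_ae ?_
    filter_upwards [((φ k).memLp 2 μ).coeFn_toLp] with x hx
    simp [e, hx]
  · have h1 := (tendsto_iff_edist_tendsto_0.1 hlim)
    refine h1.congr fun k => ?_
    rw [Lp.edist_def]
    refine eLpNorm_congr_ae ?_
    filter_upwards [((φ k).memLp_gradient 2 μ).coeFn_toLp] with x hx
    rw [← hφ]
    simp only [Pi.sub_apply, gradientL2]
    rw [← hx]; rfl
  · have h1 := hGφ ψ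
    rw [L2.inner_def] at h1
    have h2 : L ψ = ∫ x in (Ω : Set (RSpace n)), F x * ψ x := rfl
    rw [← h2, ← h1]
    refine integral_congr_ae ?_
    filter_upwards [(ψ.memLp_gradient 2 μ).coeFn_toLp] with x hx
    rw [← hx]; rfl

end Existence

/-! ### Density of test functions in `L¹` -/

section Density

variable {n : ℕ} {Ω : Opens (RSpace n)}

theorem exists_testFunction_eq_one {K : Set (RSpace n)} (hK : IsCompact K)
    (hKΩ : K ⊆ (Ω : Set (RSpace n))) :
    ∃ χ : 𝓓(Ω, ℝ), (∀ x ∈ K, χ x = 1) ∧ ∀ x, χ x ∈ Icc (0 : ℝ) 1 := by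
  obtain ⟨K', hK', hKK', hK'Ω⟩ := exists_compact_between hK Ω.isOpen hKΩ
  obtain ⟨f, h0, h1, hI⟩ := exists_contMDiffMap_zero_one_nhds_of_isClosed (n := ⊤)
    (modelWithCornersSelf ℝ (RSpace n)) (s := (interior K')ᶜ) (t := K)
    isOpen_interior.isClosed_compl hK.isClosed
    (disjoint_left.2 fun x hx hx' => hx (hKK' hx'))
  have hsup : Function.support f ⊆ K' := fun x hx => by
    by_contra h
    exact hx (h0.self_of_nhdsSet x fun h' => h (interior_subset h'))
  have hts : tsupport f ⊆ K' := closure_minimal hsup hK'.isClosed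
  exact ⟨⟨f, f.contMDiff.contDiff, hK'.of_isClosed_subset (isClosed_tsupport f) hts,
    hts.trans hK'Ω⟩, fun x hx => h1.self_of_nhdsSet x hx, hI⟩

/-- Density in L¹ gives a bounded smooth g not supported in Ω. Multiplying it by a cutoff equal to 1
on a compact K ⊆ Ω costs at most sup|g| times the measure of Ω \ K, and K is chosen to make this
small. -/
theorem exists_testFunction_eLpNorm_sub_le (hΩ : Bornology.IsBounded (Ω : Set (RSpace n)))
    {f : RSpace n → ℝ} (hf : IntegrableOn f (Ω : Set (RSpace n))) {ε : ℝ} (hε : 0 < ε) :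
    ∃ F : 𝓓(Ω, ℝ), eLpNorm (⇑F - f) 1 (volume.restrict (Ω : Set (RSpace n))) ≤
      ENNReal.ofReal ε := by
  have := isFiniteMeasure_restrict_of_isBounded hΩ
  set μ := volume.restrict (Ω : Set (RSpace n)) with hμ
  obtain ⟨g, hgc, hg, hfg⟩ := (memLp_one_iff_integrable.2 hf).exist_eLpNorm_sub_le
    ENNReal.one_ne_top le_rfl (half_pos hε)
  obtain ⟨B, hB⟩ := hg.continuous.bounded_above_of_compact_support hgc
  have hB0 : 0 ≤ B := (norm_nonneg _).trans (hB 0)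
  obtain ⟨K, hKΩ, hK, hKlt⟩ := Ω.isOpen.measurableSet.exists_isCompact_sdiff_lt
    (μ := volume) hΩ.measure_lt_top.ne
    (ε := ENNReal.ofReal (ε / 2 / (B + 1))) (by simp; positivity)
  obtain ⟨χ, hχ1, hχI⟩ := exists_testFunction_eq_one hK hKΩ
  refine ⟨χ.smoothMul g hg, ?_⟩
  have e : ⇑(χ.smoothMul g hg) - f = (⇑(χ.smoothMul g hg) - g) - (f - g) := by ext x; simp
  rw [e]
  refine (eLpNorm_sub_le ((χ.smoothMul g hg).continuous.aestronglyMeasurable.sub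
    hg.continuous.aestronglyMeasurable) (hf.aestronglyMeasurable.sub
    hg.continuous.aestronglyMeasurable) le_rfl).trans ?_
  have h1 : eLpNorm (⇑(χ.smoothMul g hg) - g) 1 μ ≤ ENNReal.ofReal (ε / 2) := by
    have h2 : ∀ x, ‖(⇑(χ.smoothMul g hg) - g) x‖ ≤ ‖(Kᶜ).indicator (fun _ => B) x‖ := fun x => by
      by_cases hx : x ∈ K
      · simp [hχ1 x hx]
      · rw [indicator_of_mem (by exact hx), Real.norm_of_nonneg hB0, Pi.sub_apply,
          TestFunction.smoothMul_apply]
        have : g x * χ x - g x = -((1 - χ x) * g x) := by ring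
        rw [this, norm_neg, norm_mul, Real.norm_of_nonneg (by linarith [(hχI x).2])]
        calc _ ≤ 1 * B := mul_le_mul (by linarith [(hχI x).1]) (hB x) (norm_nonneg _) zero_le_one
          _ = B := one_mul B
    refine (eLpNorm_mono h2).trans ?_
    rw [eLpNorm_indicator_const hK.measurableSet.compl one_ne_zero ENNReal.one_ne_top]
    simp only [ENNReal.toReal_one, div_one, ENNReal.rpow_one]
    rw [hμ, Measure.restrict_apply hK.measurableSet.compl, inter_comm, ← sdiff_eq,
      Real.enorm_eq_ofReal hB0]
    calc _ ≤ ENNReal.ofReal B * ENNReal.ofReal (ε / 2 / (B + 1)) := by gcongr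
      _ = ENNReal.ofReal (B * (ε / 2 / (B + 1))) := (ENNReal.ofReal_mul hB0).symm
      _ ≤ _ := by
        refine ENNReal.ofReal_le_ofReal ?_
        rw [mul_div_assoc', div_le_iff₀ (by positivity)]
        nlinarith
  calc _ ≤ ENNReal.ofReal (ε / 2) + ENNReal.ofReal (ε / 2) := add_le_add h1 hfg
    _ = _ := by rw [← ENNReal.ofReal_add (by positivity) (by positivity), add_halves]

theorem eLpNorm_one_eq_ofReal {α : Type*} [MeasurableSpace α] {μ : Measure α} {f : α → ℝ}
    (hf : Integrable f μ) : eLpNorm f 1 μ = ENNReal.ofReal (∫ x, |f x| ∂μ) := by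
  rw [eLpNorm_one_eq_lintegral_enorm, ← ofReal_integral_norm_eq_lintegral_enorm hf]
  rfl

theorem exists_testFunction_integral_abs_sub_le (hΩ : Bornology.IsBounded (Ω : Set (RSpace n)))
    {f : RSpace n → ℝ} (hf : IntegrableOn f (Ω : Set (RSpace n))) {ε : ℝ} (hε : 0 < ε) :
    ∃ F : 𝓓(Ω, ℝ), ∫ x in (Ω : Set (RSpace n)), |F x - f x| ≤ ε := by
  obtain ⟨F, hF⟩ := exists_testFunction_eLpNorm_sub_le hΩ hf hε
  refine ⟨F, ?_⟩
  rw [eLpNorm_one_eq_ofReal ((memLp_one_iff_integrable.1 (F.memLp 1 _)).sub hf),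
    ENNReal.ofReal_le_ofReal_iff hε.le] at hF
  exact hF

end Density

/-! ### The limit solution -/

section LimitSolution

variable {n : ℕ} {Ω : Opens (RSpace n)}

/-- `(u₀, g₀)` is the limit in `W^{1,q}`, `q < n/(n-1)`, of the variational solutions with data
approximating `f` in `L¹`. -/
structure IsLimitSol (Ω : Opens (RSpace n)) (f u₀ : RSpace n → ℝ) (g₀ : RSpace n → RSpace n) :
    Prop where
  aesm : AEStronglyMeasurable u₀ (volume.restrict (Ω : Set (RSpace n)))
  aesm_grad : AEStronglyMeasurable g₀ (volume.restrict (Ω : Set (RSpace n)))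
  bound : ∀ q : ℝ, 1 ≤ q → q < (n : ℝ) / ((n : ℝ) - 1) → ∃ C : NNReal,
    ∀ (F : 𝓓(Ω, ℝ)) (U : RSpace n → ℝ) (G : RSpace n → RSpace n) (c : ℝ),
      IsW10 Ω 2 U G → IsWeakSol Ω G F → 0 < c →
      ∫ x in (Ω : Set (RSpace n)), |F x - f x| < c →
      eLpNorm (U - u₀) (ENNReal.ofReal q) (volume.restrict (Ω : Set (RSpace n))) ≤
          C * ENNReal.ofReal c ∧
        eLpNorm (G - g₀) (ENNReal.ofReal q) (volume.restrict (Ω : Set (RSpace n))) ≤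
          C * ENNReal.ofReal c

theorem integral_abs_sub_le {α : Type*} [MeasurableSpace α] {μ : Measure α} {f g h : α → ℝ}
    (hf : Integrable f μ) (hg : Integrable g μ) (hh : Integrable h μ) :
    ∫ x, |f x - g x| ∂μ ≤ (∫ x, |f x - h x| ∂μ) + ∫ x, |g x - h x| ∂μ := by
  have i1 : Integrable (fun x => |f x - h x|) μ := (hf.sub hh).abs
  have i2 : Integrable (fun x => |g x - h x|) μ := (hg.sub hh).abs
  rw [← integral_add i1 i2]
  refine integral_mono (hf.sub hg).abs (i1.add i2) fun x => ?_
  change |f x - g x| ≤ |f x - h x| + |g x - h x|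
  rw [abs_sub_comm (g x)]
  exact abs_sub_le _ _ _

/-- The a priori bound for differences makes the solutions Cauchy. The limit is constructed in L¹
only; the L^q bounds for all admissible q follow by lower semicontinuity of the norm along one
almost everywhere convergent subsequence, so u₀ and g₀ do not depend on q. -/
theorem exists_isLimitSol (hn : 2 ≤ n) (hΩ : Bornology.IsBounded (Ω : Set (RSpace n)))
    {f : RSpace n → ℝ} (hf : IntegrableOn f (Ω : Set (RSpace n))) :
    ∃ u₀ g₀, IsLimitSol Ω f u₀ g₀ := by
  have hn' : (2 : ℝ) ≤ n := by exact_mod_cast hn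
  have := isFiniteMeasure_restrict_of_isBounded hΩ
  set μ := volume.restrict (Ω : Set (RSpace n)) with hμ
  have iT : ∀ F : 𝓓(Ω, ℝ), Integrable F μ := fun F => memLp_one_iff_integrable.1 (F.memLp 1 _)
  choose F hF using fun j : ℕ => exists_testFunction_integral_abs_sub_le hΩ hf
    (ε := (1 / 2) ^ j) (by positivity)
  choose U G hUG hsol using fun j => exists_isW10_isWeakSol hn hΩ (F j)
  -- differences of variational solutions
  have hdiff : ∀ q : ℝ, 1 ≤ q → q < (n : ℝ) / ((n : ℝ) - 1) → ∃ C : NNReal,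
      ∀ (F₁ F₂ : 𝓓(Ω, ℝ)) (U₁ U₂ : RSpace n → ℝ) (G₁ G₂ : RSpace n → RSpace n) (c : ℝ),
      IsW10 Ω 2 U₁ G₁ → IsW10 Ω 2 U₂ G₂ → IsWeakSol Ω G₁ F₁ → IsWeakSol Ω G₂ F₂ → 0 < c →
      (∫ x, |F₁ x - f x| ∂μ) + (∫ x, |F₂ x - f x| ∂μ) ≤ c →
      eLpNorm (U₁ - U₂) (ENNReal.ofReal q) μ ≤ C * ENNReal.ofReal c ∧
        eLpNorm (G₁ - G₂) (ENNReal.ofReal q) μ ≤ C * ENNReal.ofReal c := by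
    intro q hq1 hq
    obtain ⟨C, hC⟩ := exists_eLpNorm_le_of_isWeakSol hn hΩ hq1 hq
    refine ⟨C, fun F₁ F₂ U₁ U₂ G₁ G₂ c h1 h2 s1 s2 hc hle => ?_⟩
    refine hC _ _ (⇑F₁ - ⇑F₂) c (h1.sub one_le_two h2) ?_ ((iT F₁).sub (iT F₂)) hc ?_
    · exact s1.sub (MemLp.locallyIntegrableOn_opens one_le_two h1.memLp_grad)
        (MemLp.locallyIntegrableOn_opens one_le_two h2.memLp_grad)
        (MemLp.locallyIntegrableOn_opens le_rfl (F₁.memLp 1 _))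
        (MemLp.locallyIntegrableOn_opens le_rfl (F₂.memLp 1 _)) s2
    · exact (integral_abs_sub_le (iT F₁) (iT F₂) hf).trans hle
  obtain ⟨C₁, hC₁⟩ := hdiff 1 le_rfl (by rw [lt_div_iff₀ (by linarith)]; linarith)
  rw [ENNReal.ofReal_one] at hC₁
  -- A summable rate. C₁ + 1 in place of C₁ produces the strict inequality required by the
  -- completeness theorem.
  set B : ℕ → ℝ≥0∞ := fun N => ((C₁ + 1) * 2 : NNReal) * (2⁻¹ : ℝ≥0∞) ^ N with hBdef
  have hB : ∑' N, B N ≠ ⊤ := by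
    rw [ENNReal.tsum_mul_left, ENNReal.tsum_geometric]
    refine ENNReal.mul_ne_top ENNReal.coe_ne_top ?_
    rw [ENNReal.one_sub_inv_two, inv_inv]
    exact ENNReal.ofNat_ne_top
  have hlt : ∀ N k l : ℕ, N ≤ k → N ≤ l →
      eLpNorm (U k - U l) 1 μ < B N ∧ eLpNorm (G k - G l) 1 μ < B N := by
    intro N k l hk hl
    have hp : ∀ m, N ≤ m → ∫ x, |F m x - f x| ∂μ ≤ (1 / 2) ^ N := fun m hm =>
      (hF m).trans (pow_le_pow_of_le_one (by norm_num) (by norm_num) hm)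
    have h1 := hC₁ (F k) (F l) _ _ _ _ (2 * (1 / 2) ^ N) (hUG k) (hUG l) (hsol k) (hsol l)
      (by positivity) (by linarith [hp k hk, hp l hl])
    have h2 : C₁ * ENNReal.ofReal (2 * (1 / 2) ^ N) < B N := by
      have e : ENNReal.ofReal (2 * (1 / 2) ^ N) = 2 * (2⁻¹ : ℝ≥0∞) ^ N := by
        rw [ENNReal.ofReal_mul two_pos.le, ENNReal.ofReal_pow (by norm_num), one_div,
          ENNReal.ofReal_inv_of_pos two_pos, ENNReal.ofReal_ofNat]
      rw [e, hBdef]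
      simp only
      rw [ENNReal.coe_mul, ENNReal.coe_ofNat, mul_assoc]
      refine ENNReal.mul_lt_mul_left (by simp) (by finiteness) ?_
      exact_mod_cast lt_add_one C₁
    exact ⟨h1.1.trans_lt h2, h1.2.trans_lt h2⟩
  obtain ⟨u₀, hu₀, hlu⟩ := Lp.cauchy_complete_eLpNorm le_rfl
    (fun j => (hUG j).memLp.mono_exponent one_le_two) hB (fun N k l hk hl => (hlt N k l hk hl).1)
  obtain ⟨g₀, hg₀, hlg⟩ := Lp.cauchy_complete_eLpNorm le_rfl
    (fun j => (hUG j).memLp_grad.mono_exponent one_le_two) hB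
    (fun N k l hk hl => (hlt N k l hk hl).2)
  -- A subsequence along which the functions converge almost everywhere, then a further one for the
  -- gradients.
  obtain ⟨s, hs, hsa⟩ := (tendstoInMeasure_of_tendsto_eLpNorm one_ne_zero
    (fun j => (hUG j).memLp.1) hu₀.1 hlu).exists_seq_tendsto_ae
  obtain ⟨t, ht, hta⟩ := (tendstoInMeasure_of_tendsto_eLpNorm one_ne_zero
    (fun j => (hUG (s j)).memLp_grad.1) hg₀.1 (hlg.comp hs.tendsto_atTop)).exists_seq_tendsto_ae
  refine ⟨u₀, g₀, hu₀.1, hg₀.1, fun q hq1 hq => ?_⟩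
  obtain ⟨C, hC⟩ := hdiff q hq1 hq
  refine ⟨C, fun F' U' G' c hU' hs' hc hlt' => ?_⟩
  have hst : Tendsto (fun j => s (t j)) atTop atTop := hs.tendsto_atTop.comp ht.tendsto_atTop
  -- The strict inequality ∫|F' - f| < c leaves room for the error of the approximating datum, so
  -- that `hdiff` eventually applies with the same c.
  have hev : ∀ᶠ j in atTop, ∫ x, |F (s (t j)) x - f x| ∂μ ≤ c - ∫ x, |F' x - f x| ∂μ := by
    have h1 : Tendsto (fun j => ((1 : ℝ) / 2) ^ (s (t j))) atTop (𝓝 0) :=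
      (tendsto_pow_atTop_nhds_zero_of_lt_one (by norm_num) (by norm_num)).comp hst
    filter_upwards [h1.eventually_le_const (sub_pos.2 hlt')] with j hj
    exact (hF _).trans hj
  have hbd : ∀ᶠ j in atTop,
      eLpNorm (U' - U (s (t j))) (ENNReal.ofReal q) μ ≤ C * ENNReal.ofReal c ∧
        eLpNorm (G' - G (s (t j))) (ENNReal.ofReal q) μ ≤ C * ENNReal.ofReal c := by
    filter_upwards [hev] with j hj
    exact hC _ _ _ _ _ _ c hU' (hUG _) hs' (hsol _) hc (by linarith)
  constructor
  · refine (Lp.eLpNorm_lim_le_liminf_eLpNorm (f := fun j => U' - U (s (t j)))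
      (fun j => hU'.memLp.1.sub (hUG _).memLp.1) _ ?_).trans ?_
    · filter_upwards [hsa] with x hx
      exact tendsto_const_nhds.sub (hx.comp ht.tendsto_atTop)
    · exact liminf_le_of_le (by isBoundedDefault) fun b hb => by
        obtain ⟨j, h1, h2⟩ := (hb.and hbd).exists
        exact h1.trans h2.1
  · refine (Lp.eLpNorm_lim_le_liminf_eLpNorm (f := fun j => G' - G (s (t j)))
      (fun j => hU'.memLp_grad.1.sub (hUG _).memLp_grad.1) _ ?_).trans ?_
    · filter_upwards [hta] with x hx
      exact tendsto_const_nhds.sub hx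
    · exact liminf_le_of_le (by isBoundedDefault) fun b hb => by
        obtain ⟨j, h1, h2⟩ := (hb.and hbd).exists
        exact h1.trans h2.2

/-- A diagonal choice: a variational solution close to u₀, then a test function close to that
solution in W^{1,q}, which is possible because q ≤ 2 and Ω is bounded. -/
theorem IsLimitSol.isW10 (hn : 2 ≤ n) (hΩ : Bornology.IsBounded (Ω : Set (RSpace n)))
    {f u₀ : RSpace n → ℝ} {g₀ : RSpace n → RSpace n} (hf : IntegrableOn f (Ω : Set (RSpace n)))
    (h : IsLimitSol Ω f u₀ g₀) {q : ℝ} (hq1 : 1 ≤ q) (hq : q < (n : ℝ) / ((n : ℝ) - 1)) :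
    IsW10 Ω (ENNReal.ofReal q) u₀ g₀ := by
  have hn' : (2 : ℝ) ≤ n := by exact_mod_cast hn
  have := isFiniteMeasure_restrict_of_isBounded hΩ
  set μ := volume.restrict (Ω : Set (RSpace n)) with hμ
  obtain ⟨C, hC⟩ := h.bound q hq1 hq
  have hq2 : q ≤ 2 := by
    have : q * ((n : ℝ) - 1) < n := by rwa [lt_div_iff₀ (by linarith)] at hq
    nlinarith
  have hq1' : 1 ≤ ENNReal.ofReal q := ENNReal.one_le_ofReal.2 hq1
  have hqle : ENNReal.ofReal q ≤ 2 := ENNReal.ofReal_le_of_le_toReal (by simpa using hq2)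
  have step : ∀ c : ℝ, 0 < c → ∃ (U : RSpace n → ℝ) (G : RSpace n → RSpace n) (φ : 𝓓(Ω, ℝ)),
      IsW10 Ω (ENNReal.ofReal q) U G ∧
      eLpNorm (U - u₀) (ENNReal.ofReal q) μ ≤ C * ENNReal.ofReal c ∧
      eLpNorm (G - g₀) (ENNReal.ofReal q) μ ≤ C * ENNReal.ofReal c ∧
      eLpNorm (⇑φ - U) (ENNReal.ofReal q) μ ≤ ENNReal.ofReal c ∧
      eLpNorm (gradient φ - G) (ENNReal.ofReal q) μ ≤ ENNReal.ofReal c := by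
    intro c hc
    obtain ⟨F, hF⟩ := exists_testFunction_integral_abs_sub_le hΩ hf (half_pos hc)
    obtain ⟨U, G, hUG, hsol⟩ := exists_isW10_isWeakSol hn hΩ F
    have h1 := hC F U G c hUG hsol hc (by linarith)
    have h2 := hUG.of_exponent_le (zero_lt_one.trans_le hq1').ne' hqle
    obtain ⟨φ, h3, h4⟩ := h2.exists_testFunction (ε := ENNReal.ofReal c) (by simpa using hc)
    exact ⟨U, G, φ, h2, h1.1, h1.2, h3, h4⟩
  obtain ⟨U, G, -, hUG, hU, hG, -, -⟩ := step 1 one_pos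
  have fin : (C : ℝ≥0∞) * ENNReal.ofReal 1 < ⊤ :=
    ENNReal.mul_lt_top ENNReal.coe_lt_top ENNReal.ofReal_lt_top
  have mU : MemLp (U - u₀) (ENNReal.ofReal q) μ := ⟨hUG.memLp.1.sub h.aesm, hU.trans_lt fin⟩
  have mG : MemLp (G - g₀) (ENNReal.ofReal q) μ :=
    ⟨hUG.memLp_grad.1.sub h.aesm_grad, hG.trans_lt fin⟩
  refine ⟨?_, ?_, ?_⟩
  · have := hUG.memLp.sub mU
    rwa [sub_sub_cancel] at this
  · have := hUG.memLp_grad.sub mG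
    rwa [sub_sub_cancel] at this
  choose U G φ hUG hU hG hφ hφg using fun k : ℕ => step (1 / 2 ^ k) (by positivity)
  have hl : Tendsto (fun k : ℕ => ENNReal.ofReal (1 / 2 ^ k) + C * ENNReal.ofReal (1 / 2 ^ k))
      atTop (𝓝 0) := by
    have h1 : Tendsto (fun k : ℕ => ENNReal.ofReal (1 / 2 ^ k)) atTop (𝓝 0) := by
      have : Tendsto (fun k : ℕ => (1 : ℝ) / 2 ^ k) atTop (𝓝 0) := by
        simpa using tendsto_pow_atTop_nhds_zero_of_lt_one (r := (1 / 2 : ℝ)) (by norm_num)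
          (by norm_num)
      simpa using ENNReal.tendsto_ofReal this
    have h2 := ENNReal.Tendsto.const_mul (a := (C : ℝ≥0∞)) h1 (Or.inr ENNReal.coe_ne_top)
    simpa using h1.add h2
  refine ⟨φ, ?_, ?_⟩
  · refine tendsto_of_tendsto_of_tendsto_of_le_of_le tendsto_const_nhds hl (fun _ => zero_le) ?_
    intro k
    have e : ⇑(φ k) - u₀ = (⇑(φ k) - U k) + (U k - u₀) := by abel
    simp only [e]
    exact (eLpNorm_add_le ((φ k).continuous.aestronglyMeasurable.sub (hUG k).memLp.1)
      ((hUG k).memLp.1.sub h.aesm) hq1').trans (add_le_add (hφ k) (hU k))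
  · refine tendsto_of_tendsto_of_tendsto_of_le_of_le tendsto_const_nhds hl (fun _ => zero_le) ?_
    intro k
    have e : gradient (φ k) - g₀ = (gradient (φ k) - G k) + (G k - g₀) := by abel
    simp only [e]
    exact (eLpNorm_add_le ((φ k).continuous_gradient.aestronglyMeasurable.sub
      (hUG k).memLp_grad.1) ((hUG k).memLp_grad.1.sub h.aesm_grad) hq1').trans
      (add_le_add (hφg k) (hG k))

/-- Convergence in L¹ of the gradients and of the data is enough, since a test function and its
gradient are bounded. -/
theorem IsLimitSol.isWeakSol (hn : 2 ≤ n) (hΩ : Bornology.IsBounded (Ω : Set (RSpace n)))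
    {f u₀ : RSpace n → ℝ} {g₀ : RSpace n → RSpace n} (hf : IntegrableOn f (Ω : Set (RSpace n)))
    (h : IsLimitSol Ω f u₀ g₀) : IsWeakSol Ω g₀ f := by
  have hn' : (2 : ℝ) ≤ n := by exact_mod_cast hn
  have := isFiniteMeasure_restrict_of_isBounded hΩ
  set μ := volume.restrict (Ω : Set (RSpace n)) with hμ
  have hq : (1 : ℝ) < (n : ℝ) / ((n : ℝ) - 1) := by rw [lt_div_iff₀ (by linarith)]; linarith
  obtain ⟨C, hC⟩ := h.bound 1 le_rfl hq
  have hW := h.isW10 hn hΩ hf le_rfl hq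
  rw [ENNReal.ofReal_one] at hC hW
  choose F hF using fun j : ℕ => exists_testFunction_integral_abs_sub_le hΩ hf
    (ε := 1 / 2 ^ j) (by positivity)
  choose U G hUG hsol using fun j => exists_isW10_isWeakSol hn hΩ (F j)
  have h0 : Tendsto (fun k : ℕ => ENNReal.ofReal (1 / 2 ^ k)) atTop (𝓝 0) := by
    have : Tendsto (fun k : ℕ => (1 : ℝ) / 2 ^ k) atTop (𝓝 0) := by
      simpa using tendsto_pow_atTop_nhds_zero_of_lt_one (r := (1 / 2 : ℝ)) (by norm_num)
        (by norm_num)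
    simpa using ENNReal.tendsto_ofReal this
  have iT : ∀ F : 𝓓(Ω, ℝ), Integrable F μ := fun F => memLp_one_iff_integrable.1 (F.memLp 1 _)
  have hlG : Tendsto (fun k => eLpNorm (G k - g₀) 1 μ) atTop (𝓝 0) := by
    have h2 := ENNReal.Tendsto.const_mul (a := ((C * 2 : NNReal) : ℝ≥0∞)) h0
      (Or.inr ENNReal.coe_ne_top)
    rw [mul_zero] at h2
    refine tendsto_of_tendsto_of_tendsto_of_le_of_le tendsto_const_nhds h2 (fun _ => zero_le) ?_
    intro k
    have hk : (0 : ℝ) < 1 / 2 ^ k := by positivity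
    refine ((hC (F k) (U k) (G k) (2 * (1 / 2 ^ k)) (hUG k) (hsol k) (by positivity)
      ((hF k).trans_lt (by linarith))).2).trans ?_
    rw [ENNReal.ofReal_mul two_pos.le, ENNReal.coe_mul, ← mul_assoc]
    simp
  have hlF : Tendsto (fun k => eLpNorm (⇑(F k) - f) 1 μ) atTop (𝓝 0) := by
    refine tendsto_of_tendsto_of_tendsto_of_le_of_le tendsto_const_nhds h0 (fun _ => zero_le) ?_
    intro k
    simp only
    rw [eLpNorm_one_eq_ofReal ((iT _).sub hf)]
    exact ENNReal.ofReal_le_ofReal (hF k)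
  intro φ
  obtain ⟨A, -, hA⟩ := φ.bounded_gradient
  obtain ⟨D, -, hD⟩ := φ.bounded
  have t1 := tendsto_integral_of_norm_sub_le (C := A) hlG
    (b := fun k x => inner ℝ (G k x) (gradient φ x)) (b₀ := fun x => inner ℝ (g₀ x) (gradient φ x))
    (fun k => IsWeakSol.integrable_inner
      (MemLp.locallyIntegrableOn_opens one_le_two (hUG k).memLp_grad) φ)
    (IsWeakSol.integrable_inner (MemLp.locallyIntegrableOn_opens le_rfl hW.memLp_grad) φ)
    (fun k => Eventually.of_forall fun x => by
      rw [← inner_sub_left, mul_comm]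
      exact (abs_real_inner_le_norm _ _).trans
        (mul_le_mul_of_nonneg_left (hA x) (norm_nonneg _)))
  have t2 := tendsto_integral_of_norm_sub_le (C := D) hlF
    (b := fun k x => F k x * φ x) (b₀ := fun x => f x * φ x)
    (fun k => φ.integrable_mul (MemLp.locallyIntegrableOn_opens le_rfl ((F k).memLp 1 _)))
    (φ.integrable_mul hf.locallyIntegrableOn)
    (fun k => Eventually.of_forall fun x => by
      rw [← sub_mul, abs_mul, mul_comm, Real.norm_eq_abs]
      exact mul_le_mul_of_nonneg_right (hD x) (abs_nonneg _))
  exact tendsto_nhds_unique t1 (t2.congr fun k => (hsol k φ).symm)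

end LimitSolution

/-! ### A smooth averaging kernel and its potential -/

section MollifierPair

variable {n : ℕ}

/-- `ρ` is a smooth probability density on the unit ball, and `ψ` a potential with
`∇ψ(x) = -ρ(x) x`. -/
structure IsMollifierPair (ρ ψ : RSpace n → ℝ) : Prop where
  contDiff : ContDiff ℝ ∞ ρ
  contDiff_pot : ContDiff ℝ ∞ ψ
  eq_zero : ∀ x, 1 ≤ ‖x‖ → ρ x = 0
  pot_eq_zero : ∀ x, 1 ≤ ‖x‖ → ψ x = 0
  nonneg : ∀ x, 0 ≤ ρ x
  pot_nonneg : ∀ x, 0 ≤ ψ x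
  integral_eq_one : ∫ x, ρ x = 1
  even : ∀ x, ρ (-x) = ρ x
  fderiv_pot : ∀ x v, fderiv ℝ ψ x v = -(ρ x * inner ℝ x v)

theorem hasCompactSupport_of_eq_zero {F : Type*} [Zero F] {ρ : RSpace n → F} {r : ℝ}
    (h : ∀ x, r ≤ ‖x‖ → ρ x = 0) : HasCompactSupport ρ :=
  HasCompactSupport.of_support_subset_isCompact (isCompact_closedBall 0 r) fun x hx => by
    rw [mem_closedBall_zero_iff]
    by_contra h'
    exact hx (h x (not_le.1 h').le)

/-- Both functions are profiles of s = |x|². With ρ = χ(s)/I, the profile Θ(s) = (2I)⁻¹ ∫ₛ¹ χ has Θ'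
= -χ/(2I), and the factor 2x from the chain rule gives ∇Θ(|x|²) = -ρ(x)x. Since χ vanishes for s ≥
1, so does Θ. -/
theorem exists_isMollifierPair (n : ℕ) : ∃ ρ ψ : RSpace n → ℝ, IsMollifierPair ρ ψ := by
  let χ : ℝ → ℝ := fun s => Real.smoothTransition (1 - s)
  have hχ : ContDiff ℝ ∞ χ := Real.smoothTransition.contDiff.comp (contDiff_const.sub contDiff_id)
  have hχ0 : ∀ s, 1 ≤ s → χ s = 0 := fun s hs =>
    Real.smoothTransition.zero_of_nonpos (by linarith)
  have hχnn : ∀ s, 0 ≤ χ s := fun s => Real.smoothTransition.nonneg _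
  have hsq : ContDiff ℝ ∞ fun x : RSpace n => ‖x‖ ^ 2 := contDiff_norm_sq ℝ
  let ρ₀ : RSpace n → ℝ := fun x => χ (‖x‖ ^ 2)
  have hρ₀ : ContDiff ℝ ∞ ρ₀ := hχ.comp hsq
  have hz : ∀ x : RSpace n, 1 ≤ ‖x‖ → 1 ≤ ‖x‖ ^ 2 := fun x hx => by nlinarith
  have hρ₀z : ∀ x, 1 ≤ ‖x‖ → ρ₀ x = 0 := fun x hx => hχ0 _ (hz x hx)
  have hI : 0 < ∫ x, ρ₀ x :=
    hρ₀.continuous.integral_pos_of_hasCompactSupport_nonneg_nonzero (x := 0)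
      (hasCompactSupport_of_eq_zero hρ₀z) (fun x => hχnn _) (by
        simp [ρ₀, χ, Real.smoothTransition.one])
  set I := ∫ x, ρ₀ x
  obtain ⟨S, hS, -, hSd, hSi⟩ := exists_smooth_primitive hχ
  let Θ : ℝ → ℝ := fun s => (S 1 - S s) / (2 * I)
  have hΘ : ContDiff ℝ ∞ Θ := (contDiff_const.sub hS).div_const _
  have hΘd : ∀ s, HasDerivAt Θ (-χ s / (2 * I)) s := fun s => by
    have := ((hasDerivAt_const s (S 1)).sub (hSd s)).div_const (2 * I)
    simpa using this
  have hSdiff : ∀ s, S 1 - S s = ∫ τ in s..1, χ τ := fun s => by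
    rw [hSi, hSi, intervalIntegral.integral_interval_sub_left] <;>
      exact hχ.continuous.intervalIntegrable _ _
  have hΘz : ∀ s, 1 ≤ s → Θ s = 0 := fun s hs => by
    simp only [Θ]
    rw [hSdiff, intervalIntegral.integral_symm, intervalIntegral.integral_zero_ae, neg_zero,
      zero_div]
    refine Eventually.of_forall fun τ hτ => hχ0 τ ?_
    rw [uIoc_of_le hs] at hτ
    exact hτ.1.le
  have hΘnn : ∀ s, 0 ≤ Θ s := fun s => by
    rcases le_total s 1 with h | h
    · refine div_nonneg ?_ (by positivity)
      rw [hSdiff]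
      exact intervalIntegral.integral_nonneg h fun τ _ => hχnn τ
    · rw [hΘz s h]
  refine ⟨fun x => ρ₀ x / I, fun x => Θ (‖x‖ ^ 2), hρ₀.div_const _, hΘ.comp hsq,
    fun x hx => by rw [hρ₀z x hx, zero_div], fun x hx => hΘz _ (hz x hx),
    fun x => div_nonneg (hχnn _) hI.le, fun x => hΘnn _, ?_, fun x => by simp [ρ₀],
    fun x v => ?_⟩
  · rw [integral_div, div_self hI.ne']
  · have h1 := (hΘd (‖x‖ ^ 2)).comp_hasFDerivAt x (hasStrictFDerivAt_norm_sq x).hasFDerivAt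
    have h2 : fderiv ℝ (fun x : RSpace n => Θ (‖x‖ ^ 2)) x = _ := h1.fderiv
    rw [h2]
    simp [ρ₀]
    field_simp

end MollifierPair

/-! ### Averages of translates -/

section Averages

variable {n : ℕ} {Ω : Opens (RSpace n)}

/-- The average of the translates of `φ` with respect to a measure. -/
def avg (κ : Measure (RSpace n)) (φ : RSpace n → ℝ) (x : RSpace n) : ℝ := ∫ z, φ (x - z) ∂κ

theorem avg_contDiff (κ : Measure (RSpace n)) [IsFiniteMeasure κ] {φ : RSpace n → ℝ}
    (hφ : ContDiff ℝ ∞ φ) (hc : HasCompactSupport φ) : ContDiff ℝ ∞ (avg κ φ) := by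
  -- The average is the convolution, with respect to κ, of the constant 1 with φ.
  have h := hc.contDiff_convolution_right (ContinuousLinearMap.lsmul ℝ ℝ) (μ := κ)
    (f := fun _ => (1 : ℝ)) (locallyIntegrable_const 1) (n := ⊤) hφ
  convert h using 1
  ext x
  simp [avg, convolution_def]

theorem integrable_translate (κ : Measure (RSpace n)) [IsFiniteMeasure κ] {F : Type*}
    [NormedAddCommGroup F] {φ : RSpace n → F}
    (hφ : Continuous φ) (hc : HasCompactSupport φ) (x : RSpace n) :
    Integrable (fun z => φ (x - z)) κ := by
  obtain ⟨C, hC⟩ := hφ.bounded_above_of_compact_support hc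
  exact Integrable.of_bound
    (hφ.comp (continuous_const.sub continuous_id)).aestronglyMeasurable C
    (Eventually.of_forall fun z => hC _)

theorem fderiv_avg (κ : Measure (RSpace n)) [IsFiniteMeasure κ] {φ : RSpace n → ℝ}
    (hφ : ContDiff ℝ 1 φ) (hc : HasCompactSupport φ) (x v : RSpace n) :
    fderiv ℝ (avg κ φ) x v = avg κ (fun y => fderiv ℝ φ y v) x := by
  obtain ⟨C, hC⟩ := (hφ.continuous_fderiv (by norm_num)).bounded_above_of_compact_support
    (hc.fderiv ℝ)
  have hd : HasFDerivAt (avg κ φ) (∫ z, fderiv ℝ φ (x - z) ∂κ) x := by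
    refine hasFDerivAt_integral_of_dominated_of_fderiv_le (F := fun x z => φ (x - z))
      (F' := fun x z => fderiv ℝ φ (x - z)) (bound := fun _ => C) (s := univ) univ_mem
      (Eventually.of_forall fun y => (integrable_translate κ hφ.continuous hc y).1)
      (integrable_translate κ hφ.continuous hc x)
      (integrable_translate κ (hφ.continuous_fderiv (by norm_num)) (hc.fderiv ℝ) x).1
      (Eventually.of_forall fun z y _ => hC _) (integrable_const _)
      (Eventually.of_forall fun z y _ => ?_)
    have h1 : HasFDerivAt φ (fderiv ℝ φ (y - z)) (y - z) :=
      ((hφ.differentiable (by norm_num)) (y - z)).hasFDerivAt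
    simpa [Function.comp_def] using h1.comp y ((hasFDerivAt_id y).sub_const z)
  rw [hd.fderiv, ContinuousLinearMap.integral_apply
    (integrable_translate κ (hφ.continuous_fderiv (by norm_num)) (hc.fderiv ℝ) x)]
  rfl

theorem avg_eq_zero {κ : Measure (RSpace n)} {r : ℝ} (hκ : ∀ᵐ z ∂κ, ‖z‖ ≤ r)
    {φ : RSpace n → ℝ} {x : RSpace n} (hx : x ∉ Metric.cthickening r (tsupport φ)) :
    avg κ φ x = 0 := by
  refine integral_eq_zero_of_ae ?_
  filter_upwards [hκ] with z hz
  by_contra h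
  refine hx (Metric.mem_cthickening_of_dist_le x (x - z) r _
    (subset_tsupport _ (Function.mem_support.2 h)) ?_)
  simpa [dist_eq_norm] using hz

theorem avg_tsupport {κ : Measure (RSpace n)} {r : ℝ} (hκ : ∀ᵐ z ∂κ, ‖z‖ ≤ r)
    (φ : RSpace n → ℝ) : tsupport (avg κ φ) ⊆ Metric.cthickening r (tsupport φ) := by
  refine closure_minimal (fun x hx => ?_) Metric.isClosed_cthickening
  by_contra h
  exact hx (avg_eq_zero hκ h)

theorem avg_hasCompactSupport {κ : Measure (RSpace n)} {r : ℝ} (hκ : ∀ᵐ z ∂κ, ‖z‖ ≤ r)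
    {φ : RSpace n → ℝ} (hc : HasCompactSupport φ) : HasCompactSupport (avg κ φ) :=
  (IsCompact.cthickening hc).of_isClosed_subset (isClosed_tsupport _) (avg_tsupport hκ φ)

/-- The average of a test function whose support stays at distance `r` from the complement. -/
def TestFunction.avg (φ : 𝓓(Ω, ℝ)) (κ : Measure (RSpace n)) [IsFiniteMeasure κ] {r : ℝ}
    (hκ : ∀ᵐ z ∂κ, ‖z‖ ≤ r) (hφ : Metric.cthickening r (tsupport φ) ⊆ Ω) : 𝓓(Ω, ℝ) where
  toFun := _root_.avg κ φ
  contDiff' := avg_contDiff κ φ.contDiff φ.hasCompactSupport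
  hasCompactSupport' := avg_hasCompactSupport hκ φ.hasCompactSupport
  tsupport_subset' := (avg_tsupport hκ φ).trans hφ

theorem laplacian_avg (κ : Measure (RSpace n)) [IsFiniteMeasure κ] (φ : 𝓓(Ω, ℝ)) (x : RSpace n) :
    Δ (avg κ φ) x = avg κ (Δ (φ : RSpace n → ℝ)) x := by
  have hs : ContDiff ℝ 2 (avg κ φ) :=
    (avg_contDiff κ φ.contDiff φ.hasCompactSupport).of_le (by norm_cast)
  rw [laplacian_eq_sum_fderiv hs.contDiffAt]
  have e1 : ∀ i, fderiv ℝ (fun y => fderiv ℝ (avg κ φ) y (stdVec i)) x (stdVec i) =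
      avg κ ((φ.dderiv (stdVec i)).dderiv (stdVec i)) x := fun i => by
    have : (fun y => fderiv ℝ (avg κ φ) y (stdVec i)) = avg κ (φ.dderiv (stdVec i)) := by
      ext y
      rw [fderiv_avg κ φ.contDiff_one φ.hasCompactSupport]
      rfl
    rw [this, fderiv_avg κ (φ.dderiv _).contDiff_one (φ.dderiv _).hasCompactSupport]
    rfl
  simp only [e1, avg]
  rw [← integral_finsetSum _ fun i _ => integrable_translate κ
    ((φ.dderiv (stdVec i)).dderiv (stdVec i)).continuous
    ((φ.dderiv (stdVec i)).dderiv (stdVec i)).hasCompactSupport x]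
  refine integral_congr_ae (Eventually.of_forall fun z => ?_)
  exact (φ.laplacian_eq (x - z)).symm

/-- Fubini and a translation: the adjoint of averaging over κ is averaging over the image of κ under
negation. -/
theorem integral_mul_avg (κ : Measure (RSpace n)) [IsFiniteMeasure κ] {F φ : RSpace n → ℝ}
    (hF : Continuous F) (hFc : HasCompactSupport F) (hφ : Continuous φ)
    (hφc : HasCompactSupport φ) :
    ∫ x, F x * avg κ φ x = ∫ x, avg (κ.map Neg.neg) F x * φ x := by
  obtain ⟨C, hC⟩ := hφ.bounded_above_of_compact_support hφc
  have hi : Integrable (Function.uncurry fun x z => F x * φ (x - z)) (volume.prod κ) := by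
    have h1 : Integrable (fun p : RSpace n × RSpace n => F p.1) (volume.prod κ) :=
      (hF.integrable_of_hasCompactSupport hFc).comp_fst κ
    refine h1.mul_bdd (c := C) (g := fun p : RSpace n × RSpace n => φ (p.1 - p.2)) ?_ ?_
    · exact (hφ.comp (continuous_fst.sub continuous_snd)).aestronglyMeasurable
    · exact Eventually.of_forall fun p => hC _
  calc ∫ x, F x * avg κ φ x = ∫ x, ∫ z, F x * φ (x - z) ∂κ := by
        simp only [avg, integral_const_mul]
    _ = ∫ z, (∫ x, F x * φ (x - z)) ∂κ := integral_integral_swap hi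
    _ = ∫ z, (∫ x, F (x + z) * φ x) ∂κ := by
        congr 1; ext z
        rw [← integral_add_right_eq_self (fun x => F x * φ (x - z)) z]
        simp
    _ = ∫ x, (∫ z, F (x + z) * φ x ∂κ) := by
        refine integral_integral_swap ?_
        obtain ⟨D, hD⟩ := hF.bounded_above_of_compact_support hFc
        have h1 : Integrable (fun p : RSpace n × RSpace n => φ p.2) (κ.prod volume) :=
          (hφ.integrable_of_hasCompactSupport hφc).comp_snd κ
        refine h1.bdd_mul (c := D) (f := fun p : RSpace n × RSpace n => F (p.2 + p.1)) ?_ ?_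
        · exact (hF.comp (continuous_snd.add continuous_fst)).aestronglyMeasurable
        · exact Eventually.of_forall fun p => hD _
    _ = _ := by
        congr 1; ext x
        have hm : AEStronglyMeasurable (fun z => F (x - z)) (κ.map Neg.neg) :=
          (hF.comp (continuous_const.sub continuous_id)).aestronglyMeasurable
        rw [integral_mul_const, avg, integral_map measurable_neg.aemeasurable hm]
        simp

theorem abs_avg_sub_le (κ : Measure (RSpace n)) [IsFiniteMeasure κ] {F : RSpace n → ℝ}
    (hF : Continuous F) (hFc : HasCompactSupport F) {L : ℝ} (hL : ∀ x y, |F x - F y| ≤ L * ‖x - y‖)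
    (x y : RSpace n) : |avg κ F x - avg κ F y| ≤ κ.real univ * L * ‖x - y‖ := by
  rw [avg, avg, ← integral_sub (integrable_translate κ hF hFc x) (integrable_translate κ hF hFc y)]
  have h1 := norm_integral_le_of_norm_le_const (μ := κ) (C := L * ‖x - y‖)
    (f := fun z => F (x - z) - F (y - z))
    (Eventually.of_forall fun z => by simpa using hL (x - z) (y - z))
  rw [Real.norm_eq_abs] at h1
  linarith

end Averages

/-! ### Mollification -/

section Mollify

variable {n : ℕ} {Ω : Opens (RSpace n)}

/-- Mollification at scale `r` with kernel `ρ`. -/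
def mollify (ρ : RSpace n → ℝ) (r : ℝ) (v : RSpace n → ℝ) (x : RSpace n) : ℝ :=
  ∫ z, (r ^ n)⁻¹ * ρ (r⁻¹ • (x - z)) * v z

variable {ρ ψ : RSpace n → ℝ}

theorem IsMollifierPair.hasCompactSupport (h : IsMollifierPair ρ ψ) : HasCompactSupport ρ :=
  hasCompactSupport_of_eq_zero h.eq_zero

theorem IsMollifierPair.hasCompactSupport_pot (h : IsMollifierPair ρ ψ) : HasCompactSupport ψ :=
  hasCompactSupport_of_eq_zero h.pot_eq_zero

theorem IsMollifierPair.eq_zero_scaled (h : IsMollifierPair ρ ψ) {r : ℝ} (hr : 0 < r)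
    {x : RSpace n} (hx : r ≤ ‖x‖) : ρ (r⁻¹ • x) = 0 := by
  refine h.eq_zero _ ?_
  rw [norm_smul, norm_inv, Real.norm_of_nonneg hr.le, ← div_eq_inv_mul, one_le_div hr]
  exact hx

theorem IsMollifierPair.contDiff_mollify (h : IsMollifierPair ρ ψ) {r : ℝ} (hr : 0 < r)
    {v : RSpace n → ℝ} (hv : LocallyIntegrable v) : ContDiff ℝ ∞ (mollify ρ r v) := by
  have hk : ContDiff ℝ ∞ fun x : RSpace n => (r ^ n)⁻¹ * ρ (r⁻¹ • x) :=
    contDiff_const.mul (h.contDiff.comp (contDiff_const_smul _))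
  have hkc : HasCompactSupport fun x : RSpace n => (r ^ n)⁻¹ * ρ (r⁻¹ • x) :=
    hasCompactSupport_of_eq_zero (r := r) fun x hx => by rw [h.eq_zero_scaled hr hx, mul_zero]
  have := hkc.contDiff_convolution_right (ContinuousLinearMap.lsmul ℝ ℝ).flip (n := ⊤) hv hk
  convert this using 1
  ext x
  simp [mollify, convolution_def]

theorem mollify_eq_integral (ρ : RSpace n → ℝ) {r : ℝ} (hr : 0 < r)
    (v : RSpace n → ℝ) (x : RSpace n) : mollify ρ r v x = ∫ y, ρ y * v (x - r • y) := by
  have e1 := Measure.integral_comp_smul (volume : Measure (RSpace n))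
    (fun z => (r ^ n)⁻¹ * ρ (r⁻¹ • z) * v (x - z)) r
  have e2 : mollify ρ r v x = ∫ z, (r ^ n)⁻¹ * ρ (r⁻¹ • z) * v (x - z) := by
    rw [mollify, ← integral_sub_left_eq_self (fun z => (r ^ n)⁻¹ * ρ (r⁻¹ • (x - z)) * v z) volume x]
    simp
  have hp : 0 < r ^ n := pow_pos hr n
  rw [finrank_euclideanSpace_fin, abs_of_pos (inv_pos.2 hp), ← e2, smul_eq_mul] at e1
  have e3 : mollify ρ r v x = r ^ n * ∫ y, (r ^ n)⁻¹ * ρ (r⁻¹ • r • y) * v (x - r • y) := by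
    rw [e1]; field_simp
  rw [e3, ← integral_const_mul]
  congr 1; ext y
  rw [smul_smul, inv_mul_cancel₀ hr.ne', one_smul]
  field_simp

/-- Evenness of ρ makes the mollification kernel symmetric; the rest is Fubini. -/
theorem IsMollifierPair.integral_mollify_mul (h : IsMollifierPair ρ ψ) {r : ℝ}
    {v φ : RSpace n → ℝ} (hv : Integrable v) (hφ : Integrable φ) :
    ∫ x, v x * mollify ρ r φ x = ∫ x, mollify ρ r v x * φ x := by
  obtain ⟨C, hC⟩ := h.contDiff.continuous.bounded_above_of_compact_support h.hasCompactSupport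
  have hi : Integrable (Function.uncurry fun x z =>
      ((r ^ n)⁻¹ * ρ (r⁻¹ • (x - z))) * (v x * φ z)) (volume.prod volume) := by
    refine (hv.mul_prod hφ).bdd_mul (c := |(r ^ n)⁻¹| * C)
      (f := fun p : RSpace n × RSpace n => (r ^ n)⁻¹ * ρ (r⁻¹ • (p.1 - p.2))) ?_ ?_
    · have := h.contDiff.continuous
      exact Continuous.aestronglyMeasurable (by fun_prop)
    · refine Eventually.of_forall fun p => ?_
      rw [norm_mul, Real.norm_eq_abs]
      exact mul_le_mul_of_nonneg_left (hC _) (abs_nonneg _)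
  calc ∫ x, v x * mollify ρ r φ x
      = ∫ x, ∫ z, ((r ^ n)⁻¹ * ρ (r⁻¹ • (x - z))) * (v x * φ z) := by
        congr 1; ext x
        rw [mollify, ← integral_const_mul]
        congr 1; ext z; ring
    _ = ∫ z, ∫ x, ((r ^ n)⁻¹ * ρ (r⁻¹ • (x - z))) * (v x * φ z) := integral_integral_swap hi
    _ = _ := by
        congr 1; ext z
        rw [mollify, ← integral_mul_const]
        congr 1; ext x
        rw [← h.even (r⁻¹ • (x - z)), ← smul_neg, neg_sub]
        ring

/-- Lipschitz estimate for mollifications of functions bounded near the points considered. -/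
theorem IsMollifierPair.exists_abs_mollify_sub_le (h : IsMollifierPair ρ ψ) :
    ∃ C, 0 ≤ C ∧ ∀ (r S : ℝ) (v : RSpace n → ℝ) (x y : RSpace n), 0 < r → 0 ≤ S →
      LocallyIntegrable v → ‖x - y‖ ≤ r → (∀ z, ‖x - z‖ ≤ 2 * r → |v z| ≤ S) →
      |mollify ρ r v x - mollify ρ r v y| ≤ C * S / r * ‖x - y‖ := by
  obtain ⟨L, hL⟩ := (h.contDiff.of_le (m := 1) (by norm_cast)).lipschitzWith_of_hasCompactSupport
    h.hasCompactSupport (by norm_num)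
  set V := volume.real (Metric.closedBall (0 : RSpace n) 1) with hV
  refine ⟨L * 2 ^ n * V, by positivity, fun r S v x y hr hS hv hxy hb => ?_⟩
  have hp : 0 < r ^ n := pow_pos hr n
  have hi : ∀ x, Integrable fun z => (r ^ n)⁻¹ * ρ (r⁻¹ • (x - z)) * v z := fun x => by
    have hc : Continuous fun z => (r ^ n)⁻¹ * ρ (r⁻¹ • (x - z)) := by
      have := h.contDiff.continuous
      fun_prop
    refine hv.integrable_smul_left_of_hasCompactSupport hc ?_
    refine HasCompactSupport.of_support_subset_isCompact (isCompact_closedBall x r) fun z hz => ?_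
    rw [Metric.mem_closedBall, dist_comm, dist_eq_norm]
    by_contra h'
    exact hz (by simp only; rw [h.eq_zero_scaled hr (not_le.1 h').le, mul_zero])
  -- Both kernels vanish outside the ball of radius 2r about x, because |x - y| ≤ r; only the values
  -- of v in that ball matter.
  have hsub : mollify ρ r v x - mollify ρ r v y =
      ∫ z in Metric.closedBall x (2 * r), (r ^ n)⁻¹ * (ρ (r⁻¹ • (x - z)) - ρ (r⁻¹ • (y - z))) * v z := by
    rw [mollify, mollify, ← integral_sub (hi x) (hi y), setIntegral_eq_integral_of_forall_compl_eq_zero]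
    · congr 1; ext z; ring
    · intro z hz
      rw [Metric.mem_closedBall, dist_comm, dist_eq_norm, not_le] at hz
      have h1 : r ≤ ‖y - z‖ := by
        have : x - z = (x - y) + (y - z) := by abel
        have := norm_add_le (x - y) (y - z)
        rw [sub_add_sub_cancel] at this
        linarith
      rw [h.eq_zero_scaled hr (by linarith : r ≤ ‖x - z‖), h.eq_zero_scaled hr h1]
      ring
  have hvol : volume.real (Metric.closedBall x (2 * r)) = (2 * r) ^ n * V := by
    rw [hV, measureReal_def, measureReal_def, Measure.addHaar_closedBall' _ _ (by positivity),
      ENNReal.toReal_mul, finrank_euclideanSpace_fin, ENNReal.toReal_ofReal (by positivity)]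
  rw [hsub, ← Real.norm_eq_abs]
  -- The difference of the kernels is at most r⁻ⁿ L |x - y|/r on a set of volume (2r)ⁿV, so the
  -- powers of r cancel down to 1/r.
  refine (norm_setIntegral_le_of_norm_le_const (C := (r ^ n)⁻¹ * (L * (r⁻¹ * ‖x - y‖)) * S)
    measure_closedBall_lt_top fun z hz => ?_).trans_eq ?_
  · rw [Metric.mem_closedBall, dist_comm, dist_eq_norm] at hz
    rw [norm_mul, norm_mul, Real.norm_of_nonneg (inv_nonneg.2 hp.le)]
    have h1 := hL.dist_le_mul (r⁻¹ • (x - z)) (r⁻¹ • (y - z))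
    rw [dist_eq_norm, dist_eq_norm, ← smul_sub, sub_sub_sub_cancel_right, norm_smul, norm_inv,
      Real.norm_of_nonneg hr.le] at h1
    gcongr
    exact hb z hz
  · rw [hvol, mul_pow]
    field_simp

end Mollify

/-! ### Interior regularity -/

section Weyl

variable {n : ℕ} {Ω : Opens (RSpace n)} {ρ ψ : RSpace n → ℝ}

/-- The measure with density `t ψ(y)` on `(0, r) × ℝⁿ`, transported by `(t, y) ↦ t y`. -/
def potMeasure (ψ : RSpace n → ℝ) (r : ℝ) : Measure (RSpace n) :=
  (((volume.restrict (Ioc 0 r)).withDensity fun t => ENNReal.ofReal t).prod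
    (volume.withDensity fun y => ENNReal.ofReal (ψ y))).map fun p : ℝ × RSpace n => p.1 • p.2

theorem isFiniteMeasure_timeWeight (r : ℝ) :
    IsFiniteMeasure ((volume.restrict (Ioc (0 : ℝ) r)).withDensity fun t => ENNReal.ofReal t) := by
  refine isFiniteMeasure_withDensity_ofReal ?_
  exact (continuous_id.integrableOn_Icc.mono_set Ioc_subset_Icc_self).2

theorem IsMollifierPair.isFiniteMeasure_pot (h : IsMollifierPair ρ ψ) :
    IsFiniteMeasure ((volume : Measure (RSpace n)).withDensity fun y => ENNReal.ofReal (ψ y)) :=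
  isFiniteMeasure_withDensity_ofReal
    (h.contDiff_pot.continuous.integrable_of_hasCompactSupport h.hasCompactSupport_pot).2

theorem IsMollifierPair.isFiniteMeasure_potMeasure (h : IsMollifierPair ρ ψ) (r : ℝ) :
    IsFiniteMeasure (potMeasure ψ r) := by
  have := isFiniteMeasure_timeWeight r
  have := h.isFiniteMeasure_pot
  unfold potMeasure
  infer_instance

theorem measurable_smul_prod : Measurable fun p : ℝ × RSpace n => p.1 • p.2 :=
  (continuous_fst.smul continuous_snd).measurable

/-- Fubini for the push-forward. Interval integrability is recorded for the fundamental theorem of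
calculus in `IsMollifierPair.avg_laplacian`. -/
theorem IsMollifierPair.integral_potMeasure (h : IsMollifierPair ρ ψ) {r : ℝ} (hr : 0 ≤ r)
    {f : RSpace n → ℝ} (hf : Continuous f) {C : ℝ} (hC : ∀ x, ‖f x‖ ≤ C) :
    IntervalIntegrable (fun t => t * ∫ y, ψ y * f (t • y)) volume 0 r ∧
    ∫ z, f z ∂(potMeasure ψ r) = ∫ t in (0 : ℝ)..r, t * ∫ y, ψ y * f (t • y) := by
  have f1 := isFiniteMeasure_timeWeight r
  have f2 := h.isFiniteMeasure_pot
  have hm : Measurable fun y : RSpace n => ENNReal.ofReal (ψ y) :=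
    ENNReal.measurable_ofReal.comp h.contDiff_pot.continuous.measurable
  have hi : Integrable (fun p : ℝ × RSpace n => f (p.1 • p.2))
      (((volume.restrict (Ioc 0 r)).withDensity fun t => ENNReal.ofReal t).prod
        (volume.withDensity fun y => ENNReal.ofReal (ψ y))) :=
    Integrable.of_bound
      (hf.comp (continuous_fst.smul continuous_snd)).aestronglyMeasurable C
      (Eventually.of_forall fun p => hC _)
  have hinner : ∀ t : ℝ, ∫ y, f (t • y) ∂(volume.withDensity fun y => ENNReal.ofReal (ψ y)) =
      ∫ y, ψ y * f (t • y) := fun t => by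
    rw [integral_withDensity_eq_integral_toReal_smul hm
      (Eventually.of_forall fun _ => ENNReal.ofReal_lt_top)]
    congr 1; ext y
    rw [ENNReal.toReal_ofReal (h.pot_nonneg y), smul_eq_mul]
  have hi2 := hi.integral_prod_left
  simp only [hinner] at hi2
  constructor
  · rw [intervalIntegrable_iff_integrableOn_Ioc_of_le hr]
    rw [integrable_withDensity_iff_integrable_smul' ENNReal.measurable_ofReal
      (Eventually.of_forall fun _ => ENNReal.ofReal_lt_top)] at hi2
    refine hi2.congr ?_
    filter_upwards [ae_restrict_mem measurableSet_Ioc] with t ht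
    rw [ENNReal.toReal_ofReal ht.1.le, smul_eq_mul]
  · rw [potMeasure, integral_map measurable_smul_prod.aemeasurable hf.aestronglyMeasurable,
      integral_prod _ hi]
    simp only [hinner]
    rw [integral_withDensity_eq_integral_toReal_smul ENNReal.measurable_ofReal
      (Eventually.of_forall fun _ => ENNReal.ofReal_lt_top),
      intervalIntegral.integral_of_le hr]
    refine setIntegral_congr_fun measurableSet_Ioc fun t ht => ?_
    rw [ENNReal.toReal_ofReal ht.1.le, smul_eq_mul]

/-- Here t ≤ r, and ψ vanishes for |y| ≥ 1. This confines the support of averages of test functions.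
-/
theorem IsMollifierPair.potMeasure_ae_norm_le (h : IsMollifierPair ρ ψ) (r : ℝ) :
    ∀ᵐ z ∂(potMeasure ψ r), ‖z‖ ≤ r := by
  have f1 := isFiniteMeasure_timeWeight r
  have f2 := h.isFiniteMeasure_pot
  have hs : MeasurableSet {z : RSpace n | ‖z‖ ≤ r} := measurableSet_le measurable_norm measurable_const
  rw [potMeasure, ae_map_iff measurable_smul_prod.aemeasurable hs]
  refine Measure.ae_prod_mem_iff_ae_ae_mem (measurable_smul_prod hs) |>.2 ?_
  have h1 : ∀ᵐ t ∂((volume.restrict (Ioc (0 : ℝ) r)).withDensity fun t => ENNReal.ofReal t),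
      t ∈ Ioc (0 : ℝ) r :=
    (withDensity_absolutelyContinuous _ _).ae_le (ae_restrict_mem measurableSet_Ioc)
  have h2 : ∀ᵐ y ∂((volume : Measure (RSpace n)).withDensity fun y => ENNReal.ofReal (ψ y)),
      ‖y‖ ≤ 1 := by
    have hm : Measurable fun y : RSpace n => ENNReal.ofReal (ψ y) :=
      ENNReal.measurable_ofReal.comp h.contDiff_pot.continuous.measurable
    rw [ae_withDensity_iff hm]
    refine Eventually.of_forall fun y hy => ?_
    by_contra h'
    exact hy (by simp [h.pot_eq_zero y (not_le.1 h').le])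
  filter_upwards [h1] with t ht
  filter_upwards [h2] with y hy
  simp only [mem_preimage, mem_ofPred_eq]
  rw [norm_smul, Real.norm_of_nonneg ht.1.le]
  nlinarith [ht.1, ht.2, norm_nonneg y]

/-- Bounds the masses at all scales by the mass at one large scale; the gradient estimate needs this
because its scale shrinks towards the boundary. -/
theorem potMeasure_mono (ψ : RSpace n → ℝ) {r R : ℝ} (hrR : r ≤ R) :
    potMeasure ψ r univ ≤ potMeasure ψ R univ := by
  rw [potMeasure, potMeasure, Measure.map_apply measurable_smul_prod MeasurableSet.univ,
    Measure.map_apply measurable_smul_prod MeasurableSet.univ, preimage_univ, ← univ_prod_univ,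
    Measure.prod_prod, Measure.prod_prod]
  refine mul_le_mul' ?_ le_rfl
  rw [withDensity_apply _ MeasurableSet.univ, withDensity_apply _ MeasurableSet.univ,
    Measure.restrict_univ, Measure.restrict_univ]
  exact lintegral_mono_set (Ioc_subset_Ioc_right hrR)

/-- Differentiation produces -ρ(y) y·∇φ(x - ty), which is ∇ψ(y)·∇φ(x - ty). Integrating by parts in
y moves the derivative off ψ, and the inner derivative of x - ty supplies the factor t. -/
theorem IsMollifierPair.hasDerivAt_mean (h : IsMollifierPair ρ ψ) (φ : 𝓓(Ω, ℝ)) (x : RSpace n)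
    (t : ℝ) : HasDerivAt (fun s : ℝ => ∫ y, ρ y * φ (x - s • y))
      (t * ∫ y, ψ y * (Δ (φ : RSpace n → ℝ)) (x - t • y)) t := by
  have hρc := h.contDiff.continuous
  have hφc := φ.continuous
  have hDc : Continuous (fderiv ℝ φ) := φ.contDiff_one.continuous_fderiv (by norm_num)
  obtain ⟨C, hC⟩ := hDc.bounded_above_of_compact_support (φ.hasCompactSupport.fderiv ℝ)
  have hd := hasDerivAt_integral_of_dominated_loc_of_deriv_le (μ := (volume : Measure (RSpace n)))
    (F := fun s y => ρ y * φ (x - s • y))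
    (F' := fun s y => ρ y * fderiv ℝ φ (x - s • y) (-y)) (x₀ := t) (s := univ)
    (bound := fun y => ρ y * (C * ‖y‖)) univ_mem
    (Eventually.of_forall fun s => Continuous.aestronglyMeasurable (by fun_prop))
    ((Continuous.integrable_of_hasCompactSupport (by fun_prop) h.hasCompactSupport.mul_right))
    (Continuous.aestronglyMeasurable (by fun_prop))
    (Eventually.of_forall fun y s _ => by
      rw [norm_mul, Real.norm_of_nonneg (h.nonneg y)]
      refine mul_le_mul_of_nonneg_left ?_ (h.nonneg y)
      refine (ContinuousLinearMap.le_opNorm _ _).trans ?_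
      rw [norm_neg]
      exact mul_le_mul_of_nonneg_right (hC _) (norm_nonneg _))
    (Continuous.integrable_of_hasCompactSupport (by fun_prop) h.hasCompactSupport.mul_right)
    (Eventually.of_forall fun y s _ => by
      have h1 : HasDerivAt (fun s : ℝ => x - s • y) (-y) s := by
        simpa using ((hasDerivAt_id s).smul_const y).const_sub x
      exact ((φ.differentiable _).hasFDerivAt.comp_hasDerivAt s h1).const_mul _)
  refine hd.2.congr_deriv ?_
  -- integrate by parts in each coordinate
  have hpoint : ∀ y, ρ y * fderiv ℝ φ (x - t • y) (-y) =
      ∑ i, φ.dderiv (stdVec i) (x - t • y) * fderiv ℝ ψ y (stdVec i) := fun y => by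
    rw [map_neg, ← inner_gradient, inner_eq_sum_stdVec]
    simp only [inner_gradient, h.fderiv_pot, TestFunction.dderiv_apply]
    rw [← Finset.sum_neg_distrib, Finset.mul_sum]
    exact Finset.sum_congr rfl fun i _ => by ring
  have hψd : Differentiable ℝ ψ := h.contDiff_pot.differentiable (by simp)
  have hψc := h.contDiff_pot.continuous
  have hψDc : Continuous (fderiv ℝ ψ) := h.contDiff_pot.continuous_fderiv (by simp)
  have hsub : ∀ i y, fderiv ℝ (fun y => φ.dderiv (stdVec i) (x - t • y)) y (stdVec i) =
      -t * (φ.dderiv (stdVec i)).dderiv (stdVec i) (x - t • y) := fun i y => by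
    have h1 : HasFDerivAt (fun y : RSpace n => x - t • y)
        (-(t • ContinuousLinearMap.id ℝ (RSpace n))) y :=
      ((hasFDerivAt_id y).const_smul t).const_sub x
    have h2 := ((φ.dderiv (stdVec i)).differentiable (x - t • y)).hasFDerivAt.comp y h1
    have h3 : fderiv ℝ (fun y => φ.dderiv (stdVec i) (x - t • y)) y = _ := h2.fderiv
    rw [h3]
    simp
  have hdif : ∀ i, Differentiable ℝ (fun y => φ.dderiv (stdVec i) (x - t • y)) := fun i =>
    (φ.dderiv (stdVec i)).differentiable.comp
      ((differentiable_const x).sub (differentiable_id.const_smul t))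
  have hii : ∀ i, Integrable fun y => φ.dderiv (stdVec i) (x - t • y) * fderiv ℝ ψ y (stdVec i) :=
    fun i => by
      have := (φ.dderiv (stdVec i)).continuous
      exact Continuous.integrable_of_hasCompactSupport (by fun_prop)
        (h.hasCompactSupport_pot.fderiv_apply (𝕜 := ℝ) (stdVec i)).mul_left
  have hij : ∀ i, Integrable fun y =>
      ψ y * (φ.dderiv (stdVec i)).dderiv (stdVec i) (x - t • y) := fun i => by
    have := ((φ.dderiv (stdVec i)).dderiv (stdVec i)).continuous
    exact Continuous.integrable_of_hasCompactSupport (by fun_prop)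
        h.hasCompactSupport_pot.mul_right
  have hibp : ∀ i, ∫ y, φ.dderiv (stdVec i) (x - t • y) * fderiv ℝ ψ y (stdVec i) =
      t * ∫ y, ψ y * (φ.dderiv (stdVec i)).dderiv (stdVec i) (x - t • y) := fun i => by
    have hc1 := (φ.dderiv (stdVec i)).continuous
    rw [integral_mul_fderiv_eq_neg_fderiv_mul_of_integrable ?_ (hii i) ?_
      (fun y _ => hdif i y) (fun y _ => hψd y)]
    · simp only [hsub]
      rw [← integral_const_mul, ← integral_neg]
      congr 1; ext y; ring
    · simp only [hsub]
      refine ((hij i).const_mul (-t)).congr (Eventually.of_forall fun y => ?_)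
      ring
    · exact Continuous.integrable_of_hasCompactSupport (by fun_prop)
        h.hasCompactSupport_pot.mul_left
  simp only [hpoint]
  rw [integral_finsetSum _ fun i _ => hii i]
  simp only [hibp]
  rw [← Finset.mul_sum, ← integral_finsetSum _ fun i _ => hij i]
  congr 2; ext y
  rw [φ.laplacian_eq, Finset.mul_sum]

/-- The potential of a test function inverts the Laplacian up to a mollification. -/
theorem IsMollifierPair.avg_laplacian (h : IsMollifierPair ρ ψ) {r : ℝ} (hr : 0 < r)
    (φ : 𝓓(Ω, ℝ)) (x : RSpace n) :
    avg (potMeasure ψ r) (Δ (φ : RSpace n → ℝ)) x = mollify ρ r φ x - φ x := by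
  have hL : (Δ (φ : RSpace n → ℝ)) = φ.lap := funext fun x => (φ.lap_apply x).symm
  obtain ⟨C, hC⟩ := φ.lap.continuous.bounded_above_of_compact_support φ.lap.hasCompactSupport
  have hc := φ.lap.continuous
  have key := h.integral_potMeasure hr.le (f := fun z => φ.lap (x - z)) (by fun_prop)
    (fun z => hC _)
  -- The mean equals φ(x) at t = 0 and the mollification at t = r.
  have hftc := intervalIntegral.integral_eq_sub_of_hasDerivAt
    (fun t _ => h.hasDerivAt_mean φ x t) (a := 0) (b := r) (by rw [hL]; exact key.1)
  rw [hL] at hftc ⊢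
  rw [avg, key.2, hftc, mollify_eq_integral ρ hr]
  congr 1
  simp only [zero_smul, sub_zero]
  rw [integral_mul_const, h.integral_eq_one, one_mul]

/-- The open set of points at distance more than `r` from the complement of `Ω`. -/
def shrink (Ω : Opens (RSpace n)) (r : ℝ) : Opens (RSpace n) :=
  ⟨(Metric.cthickening r (Ω : Set (RSpace n))ᶜ)ᶜ, Metric.isClosed_cthickening.isOpen_compl⟩

theorem mem_shrink {r : ℝ} {x : RSpace n} :
    x ∈ shrink Ω r ↔ x ∉ Metric.cthickening r (Ω : Set (RSpace n))ᶜ := Iff.rfl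

theorem shrink_le (r : ℝ) : shrink Ω r ≤ Ω := fun x hx => by
  by_contra h
  exact hx (Metric.self_subset_cthickening _ h)

/-- By compactness the distance from z to K is attained, at a point which would lie within r of the
complement if z were outside Ω. -/
theorem cthickening_subset_of_subset_shrink {r : ℝ} {K : Set (RSpace n)} (hK : IsCompact K)
    (hKs : K ⊆ shrink Ω r) : Metric.cthickening r K ⊆ Ω := by
  intro z hz
  by_contra hzΩ
  rcases K.eq_empty_or_nonempty with rfl | hne
  · simp at hz
  obtain ⟨y, hy, hyz⟩ := hK.exists_infEDist_eq_edist hne z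
  rw [Metric.mem_cthickening_iff, hyz] at hz
  refine hKs hy (Metric.mem_cthickening_iff.2 ((Metric.infEDist_le_edist_of_mem (y := z) hzΩ).trans ?_))
  rwa [edist_comm]

theorem iUnion_shrink {x : RSpace n} (hx : x ∈ Ω) : ∃ k : ℕ, x ∈ shrink Ω (1 / (k + 1 : ℝ)) := by
  have hx' : x ∉ (Ω : Set (RSpace n))ᶜ := fun h => h hx
  have hcl : IsClosed (Ω : Set (RSpace n))ᶜ := Ω.isOpen.isClosed_compl
  have h0 : 0 < Metric.infEDist x (Ω : Set (RSpace n))ᶜ := by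
    rw [pos_iff_ne_zero]
    intro h
    exact hx' (hcl.closure_eq ▸ Metric.mem_closure_iff_infEDist_zero.2 h)
  have hlim : Tendsto (fun k : ℕ => ENNReal.ofReal (1 / (k + 1 : ℝ))) atTop (𝓝 0) := by
    simpa using ENNReal.tendsto_ofReal tendsto_one_div_add_atTop_nhds_zero_nat
  obtain ⟨k, hk⟩ := (hlim.eventually_lt_const h0).exists
  exact ⟨k, fun h => absurd (Metric.mem_cthickening_iff.1 h) (not_le.2 hk)⟩

theorem integral_indicator_mul (u φ : RSpace n → ℝ) :
    ∫ x, (Ω : Set (RSpace n)).indicator u x * φ x = ∫ x in (Ω : Set (RSpace n)), u x * φ x := by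
  rw [← integral_indicator Ω.isOpen.measurableSet]
  congr 1; ext x
  by_cases hx : x ∈ (Ω : Set (RSpace n)) <;> simp [hx]

/-- Representation of a solution of `Δ u = -F` in the interior. -/
theorem HasWeakLaplacian.ae_eq_mollify_add_avg (h : IsMollifierPair ρ ψ) {r : ℝ} (hr : 0 < r)
    {u : RSpace n → ℝ} (hu : IntegrableOn u (Ω : Set (RSpace n))) {F : 𝓓(Ω, ℝ)}
    (hL : HasWeakLaplacian Ω u (fun x => -F x)) :
    u =ᵐ[volume.restrict (shrink Ω r : Set (RSpace n))]
      fun x => mollify ρ r ((Ω : Set (RSpace n)).indicator u) x +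
        avg ((potMeasure ψ r).map Neg.neg) F x := by
  have f1 := h.isFiniteMeasure_potMeasure r
  have hui : Integrable ((Ω : Set (RSpace n)).indicator u) :=
    hu.integrable_indicator Ω.isOpen.measurableSet
  have hm : ContDiff ℝ ∞ (mollify ρ r ((Ω : Set (RSpace n)).indicator u)) :=
    h.contDiff_mollify hr hui.locallyIntegrable
  have ha : ContDiff ℝ ∞ (avg ((potMeasure ψ r).map Neg.neg) F) :=
    avg_contDiff _ F.contDiff F.hasCompactSupport
  have hsub : (shrink Ω r : Set (RSpace n)) ⊆ Ω := shrink_le r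
  have lloc : ∀ w : RSpace n → ℝ, Continuous w →
      LocallyIntegrableOn w (shrink Ω r : Set (RSpace n)) := fun w hw =>
    hw.continuousOn.locallyIntegrableOn (shrink Ω r).isOpen.measurableSet
  refine ae_eq_of_integral_testFunction (hL.1.mono_set hsub)
    (lloc _ (hm.continuous.add ha.continuous)) fun φ => ?_
  have hct : Metric.cthickening r (tsupport φ) ⊆ Ω :=
    cthickening_subset_of_subset_shrink φ.hasCompactSupport φ.tsupport_subset
  let φ' : 𝓓(Ω, ℝ) := ⟨φ, φ.contDiff, φ.hasCompactSupport, φ.tsupport_subset.trans hsub⟩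
  have hφ' : ∀ x, φ' x = φ x := fun x => rfl
  -- The equation is tested with the potential of φ. As ΔB is the mollification of φ minus φ, this
  -- expresses ∫uφ through ∫u·(mollified φ) and ∫FB; the two operators are then moved off φ by
  -- duality.
  let B : 𝓓(Ω, ℝ) := φ'.avg (potMeasure ψ r) (h.potMeasure_ae_norm_le r) hct
  have hB := hL.2.2 B
  have hlapB : ∀ x, (Δ (B : RSpace n → ℝ)) x = mollify ρ r φ x - φ x := fun x => by
    have e1 : (Δ (B : RSpace n → ℝ)) x = Δ (avg (potMeasure ψ r) φ') x := rfl
    rw [e1, laplacian_avg, h.avg_laplacian hr φ']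
    rfl
  have hφi : Integrable φ := φ.continuous.integrable_of_hasCompactSupport φ.hasCompactSupport
  have hmφ : ContDiff ℝ ∞ (mollify ρ r φ) := h.contDiff_mollify hr hφi.locallyIntegrable
  have i1 : Integrable (fun x => u x * φ x) (volume.restrict (Ω : Set (RSpace n))) :=
    φ'.integrable_mul hL.1
  have i2 : Integrable (fun x => u x * B.lap x) (volume.restrict (Ω : Set (RSpace n))) :=
    B.lap.integrable_mul hL.1
  have i3 : Integrable (fun x => u x * mollify ρ r φ x)
      (volume.restrict (Ω : Set (RSpace n))) := by
    refine (i2.add i1).congr (Eventually.of_forall fun x => ?_)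
    simp only [Pi.add_apply, B.lap_apply, hlapB]
    ring
  have e1 : ∫ x in (Ω : Set (RSpace n)), u x * φ x =
      (∫ x in (Ω : Set (RSpace n)), u x * mollify ρ r φ x) +
        ∫ x in (Ω : Set (RSpace n)), F x * B x := by
    simp only [hlapB, neg_mul, mul_sub] at hB
    rw [integral_sub i3 i1, integral_neg] at hB
    linarith
  have e2 : ∫ x in (Ω : Set (RSpace n)), u x * φ x =
      ∫ x in (shrink Ω r : Set (RSpace n)), u x * φ x := by
    rw [setIntegral_opens_eq fun x hx => by rw [← hφ', φ'.eq_zero_of_notMem hx, mul_zero],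
      setIntegral_opens_eq fun x hx => by rw [φ.eq_zero_of_notMem hx, mul_zero]]
  have e3 : ∫ x in (Ω : Set (RSpace n)), u x * mollify ρ r φ x =
      ∫ x, mollify ρ r ((Ω : Set (RSpace n)).indicator u) x * φ x := by
    rw [← h.integral_mollify_mul hui hφi, integral_indicator_mul]
  have e4 : ∫ x in (Ω : Set (RSpace n)), F x * B x =
      ∫ x, avg ((potMeasure ψ r).map Neg.neg) F x * φ x := by
    rw [setIntegral_opens_eq fun x hx => by rw [F.eq_zero_of_notMem hx, zero_mul]]
    exact integral_mul_avg (potMeasure ψ r) F.continuous F.hasCompactSupport φ.continuous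
      φ.hasCompactSupport
  have j1 : Integrable fun x => mollify ρ r ((Ω : Set (RSpace n)).indicator u) x * φ x :=
    (hm.continuous.mul φ.continuous).integrable_of_hasCompactSupport φ.hasCompactSupport.mul_left
  have j2 : Integrable fun x => avg ((potMeasure ψ r).map Neg.neg) F x * φ x :=
    (ha.continuous.mul φ.continuous).integrable_of_hasCompactSupport φ.hasCompactSupport.mul_left
  rw [← e2, e1, e3, e4, setIntegral_opens_eq fun x hx => by rw [φ.eq_zero_of_notMem hx, mul_zero],
    ← integral_add j1 j2]
  simp only [add_mul]

theorem eqOn_of_ae_eq_of_continuousOn {u w : RSpace n → ℝ}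
    (hu : ContinuousOn u (Ω : Set (RSpace n))) (hw : ContinuousOn w (Ω : Set (RSpace n)))
    (h : u =ᵐ[volume.restrict (Ω : Set (RSpace n))] w) : EqOn u w (Ω : Set (RSpace n)) :=
  Measure.eqOn_open_of_ae_eq h Ω.isOpen hu hw

/-- A function that agrees almost everywhere with smooth functions on the members of an open cover
agrees almost everywhere with one smooth function. -/
theorem exists_contDiffOn_ae_eq_of_cover {u : RSpace n → ℝ} (V : ℕ → Opens (RSpace n))
    (w : ℕ → RSpace n → ℝ) (hcov : ∀ x ∈ Ω, ∃ k, x ∈ V k)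
    (hw : ∀ k, ContDiffOn ℝ ∞ (w k) (V k : Set (RSpace n)))
    (huw : ∀ k, u =ᵐ[volume.restrict (V k : Set (RSpace n))] w k) :
    ∃ v : RSpace n → ℝ, ContDiffOn ℝ ∞ v (Ω : Set (RSpace n)) ∧
      u =ᵐ[volume.restrict (Ω : Set (RSpace n))] v ∧
      ∀ k, EqOn v (w k) (V k : Set (RSpace n)) := by
  classical
  have hcomp : ∀ k l, EqOn (w k) (w l) ((V k ⊓ V l : Opens (RSpace n)) : Set (RSpace n)) := by
    intro k l
    have m1 : ((V k ⊓ V l : Opens (RSpace n)) : Set (RSpace n)) ⊆ V k := fun x hx => hx.1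
    have m2 : ((V k ⊓ V l : Opens (RSpace n)) : Set (RSpace n)) ⊆ V l := fun x hx => hx.2
    refine eqOn_of_ae_eq_of_continuousOn ((hw k).continuousOn.mono m1)
      ((hw l).continuousOn.mono m2) ?_
    have h1 : u =ᵐ[volume.restrict ((V k ⊓ V l : Opens (RSpace n)) : Set (RSpace n))] w k :=
      ae_mono (Measure.restrict_mono m1 (le_refl volume)) (huw k)
    have h2 : u =ᵐ[volume.restrict ((V k ⊓ V l : Opens (RSpace n)) : Set (RSpace n))] w l :=
      ae_mono (Measure.restrict_mono m2 (le_refl volume)) (huw l)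
    exact h1.symm.trans h2
  -- The choice of index is immaterial by `hcomp`.
  let v : RSpace n → ℝ := fun x => if h : ∃ k, x ∈ V k then w (Nat.find h) x else 0
  have hv : ∀ k, EqOn v (w k) (V k : Set (RSpace n)) := fun k x hx => by
    have h : ∃ k, x ∈ V k := ⟨k, hx⟩
    simp only [v, dif_pos h]
    exact hcomp _ k ⟨Nat.find_spec h, hx⟩
  refine ⟨v, ?_, ?_, hv⟩
  · intro x hx
    obtain ⟨k, hk⟩ := hcov x hx
    have h1 : ContDiffAt ℝ ∞ (w k) x := (hw k).contDiffAt ((V k).isOpen.mem_nhds hk)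
    refine (h1.congr_of_eventuallyEq ?_).contDiffWithinAt
    filter_upwards [(V k).isOpen.mem_nhds hk] with y hy using hv k hy
  · have hsub : (Ω : Set (RSpace n)) ⊆ ⋃ k, (V k : Set (RSpace n)) := fun x hx =>
      mem_iUnion.2 (hcov x hx)
    have hU : ∀ᵐ x ∂(volume.restrict (⋃ k, (V k : Set (RSpace n)))), u x = v x := by
      rw [ae_restrict_iUnion_iff]
      intro k
      filter_upwards [huw k, ae_restrict_mem (V k).isOpen.measurableSet] with x hx hxk
      rw [hx, hv k hxk]
    exact ae_mono (Measure.restrict_mono hsub (le_refl volume)) hU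

/-- Weyl's lemma. -/
theorem HasWeakLaplacian.exists_contDiffOn {u : RSpace n → ℝ}
    (hu : IntegrableOn u (Ω : Set (RSpace n))) {F : 𝓓(Ω, ℝ)}
    (hL : HasWeakLaplacian Ω u (fun x => -F x)) :
    ∃ v : RSpace n → ℝ, ContDiffOn ℝ ∞ v (Ω : Set (RSpace n)) ∧
      u =ᵐ[volume.restrict (Ω : Set (RSpace n))] v := by
  obtain ⟨ρ, ψ, h⟩ := exists_isMollifierPair n
  have hui : Integrable ((Ω : Set (RSpace n)).indicator u) :=
    hu.integrable_indicator Ω.isOpen.measurableSet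
  -- At each scale both terms of the representation are smooth, and the shrunken sets cover Ω.
  obtain ⟨v, hv, huv, -⟩ := exists_contDiffOn_ae_eq_of_cover (Ω := Ω) (u := u)
    (fun k : ℕ => shrink Ω (1 / (k + 1 : ℝ)))
    (fun k x => mollify ρ (1 / (k + 1 : ℝ)) ((Ω : Set (RSpace n)).indicator u) x +
        avg ((potMeasure ψ (1 / (k + 1 : ℝ))).map Neg.neg) F x)
    (fun x hx => iUnion_shrink hx)
    (fun k => by
      have := h.isFiniteMeasure_potMeasure (1 / (k + 1 : ℝ))
      exact ((h.contDiff_mollify (by positivity) hui.locallyIntegrable).add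
        (avg_contDiff _ F.contDiff F.hasCompactSupport)).contDiffOn)
    (fun k => hL.ae_eq_mollify_add_avg h (by positivity) hu)
  exact ⟨v, hv, huv⟩

end Weyl

/-! ### The weak maximum principle -/

section MaximumPrinciple

variable {n : ℕ} {Ω : Opens (RSpace n)}

theorem integral_inner_gradient_of_contDiff {w : RSpace n → ℝ} (hw : ContDiff ℝ ∞ w)
    (φ : 𝓓(Ω, ℝ)) :
    ∫ x in (Ω : Set (RSpace n)), inner ℝ (gradient w x) (gradient φ x) =
      ∫ x in (Ω : Set (RSpace n)), -Δ w x * φ x := by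
  have hd : ∀ i, ContDiff ℝ ∞ fun x => fderiv ℝ w x (stdVec i) := fun i =>
    (hw.fderiv_right (m := ∞) (by simp)).clm_apply contDiff_const
  have e1 : ∀ x, inner ℝ (gradient w x) (gradient φ x) =
      ∑ i, fderiv ℝ w x (stdVec i) * fderiv ℝ φ x (stdVec i) := fun x => by
    rw [inner_eq_sum_stdVec]
    simp only [inner_gradient]
  have e2 : ∀ x, -Δ w x * φ x =
      ∑ i, -(fderiv ℝ (fun y => fderiv ℝ w y (stdVec i)) x (stdVec i) * φ x) := fun x => by
    rw [laplacian_eq_sum_fderiv (hw.of_le (by norm_cast)).contDiffAt, Finset.sum_neg_distrib,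
      neg_mul, Finset.sum_mul]
  have loc : ∀ {f : RSpace n → ℝ}, Continuous f →
      LocallyIntegrableOn f (Ω : Set (RSpace n)) := fun hf =>
    hf.continuousOn.locallyIntegrableOn Ω.isOpen.measurableSet
  simp_rw [e1, e2]
  rw [integral_finsetSum, integral_finsetSum]
  · refine Finset.sum_congr rfl fun i _ => ?_
    rw [integral_mul_fderiv_of_contDiffOn ((hd i).of_le (by simp)).contDiffOn, integral_neg]
  · intro i _
    refine (φ.integrable_mul (loc ?_)).neg
    exact (((hd i).fderiv_right (m := ∞) (by simp)).clm_apply contDiff_const).continuous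
  · intro i _
    exact (φ.dderiv (stdVec i)).integrable_mul (loc (hd i).continuous)

/-- The truncation `T (φ - w)`, for `w ≥ 0` on `Ω` and `T` vanishing on the negative reals. -/
def TestFunction.trunc (φ : 𝓓(Ω, ℝ)) {w : RSpace n → ℝ} (hw : ContDiff ℝ ∞ w)
    (hw0 : ∀ x ∈ Ω, 0 ≤ w x) {T : ℝ → ℝ} (hT : ContDiff ℝ ∞ T) (hT0 : ∀ t ≤ 0, T t = 0) :
    𝓓(Ω, ℝ) where
  toFun := (Ω : Set (RSpace n)).indicator fun x => T (φ x - w x)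
  contDiff' := by
    -- Near the support of φ, which lies in Ω, the indicator is inactive; elsewhere φ = 0 and w ≥ 0
    -- on Ω make the truncation vanish.
    rw [contDiff_iff_contDiffAt]
    intro x
    by_cases hx : x ∈ tsupport φ
    · have hc : ContDiff ℝ ∞ fun x => T (φ x - w x) := hT.comp (φ.contDiff.sub hw)
      refine hc.contDiffAt.congr_of_eventuallyEq ?_
      filter_upwards [Ω.isOpen.mem_nhds (φ.tsupport_subset hx)] with y hy
      exact indicator_of_mem hy _
    · refine (contDiffAt_const (c := (0 : ℝ))).congr_of_eventuallyEq ?_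
      filter_upwards [(isClosed_tsupport φ).isOpen_compl.mem_nhds hx] with y hy
      by_cases hyΩ : y ∈ Ω
      · rw [indicator_of_mem hyΩ, image_eq_zero_of_notMem_tsupport hy]
        exact hT0 _ (by linarith [hw0 y hyΩ])
      · exact indicator_of_notMem hyΩ _
  hasCompactSupport' := by
    refine φ.hasCompactSupport.mono fun x hx => ?_
    by_contra h
    have h0 : φ x = 0 := by simpa using h
    refine hx (indicator_apply_eq_zero.2 fun hxΩ => ?_)
    rw [h0]
    exact hT0 _ (by linarith [hw0 x hxΩ])
  tsupport_subset' := by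
    refine (closure_mono fun x hx => ?_).trans φ.tsupport_subset
    by_contra h
    have h0 : φ x = 0 := by simpa using h
    refine hx (indicator_apply_eq_zero.2 fun hxΩ => ?_)
    rw [h0]
    exact hT0 _ (by linarith [hw0 x hxΩ])

theorem TestFunction.trunc_apply (φ : 𝓓(Ω, ℝ)) {w : RSpace n → ℝ} (hw : ContDiff ℝ ∞ w)
    (hw0 : ∀ x ∈ Ω, 0 ≤ w x) {T : ℝ → ℝ} (hT : ContDiff ℝ ∞ T) (hT0 : ∀ t ≤ 0, T t = 0)
    {x : RSpace n} (hx : x ∈ Ω) : φ.trunc hw hw0 hT hT0 x = T (φ x - w x) :=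
  indicator_of_mem (s := (Ω : Set (RSpace n))) hx fun x => T (φ x - w x)

theorem TestFunction.gradient_trunc (φ : 𝓓(Ω, ℝ)) {w : RSpace n → ℝ} (hw : ContDiff ℝ ∞ w)
    (hw0 : ∀ x ∈ Ω, 0 ≤ w x) {T : ℝ → ℝ} (hT : ContDiff ℝ ∞ T) (hT0 : ∀ t ≤ 0, T t = 0)
    {x : RSpace n} (hx : x ∈ Ω) :
    gradient (φ.trunc hw hw0 hT hT0) x =
      deriv T (φ x - w x) • (gradient φ x - gradient w x) := by
  have hwd : Differentiable ℝ w := hw.differentiable (by simp)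
  have e : (φ.trunc hw hw0 hT hT0 : RSpace n → ℝ) =ᶠ[𝓝 x] T ∘ (⇑φ - w) := by
    filter_upwards [Ω.isOpen.mem_nhds hx] with y hy using φ.trunc_apply hw hw0 hT hT0 hy
  rw [gradient, e.fderiv_eq, ← gradient, gradient_comp (hT.differentiable (by simp) _)
    ((φ.differentiable x).sub (hwd x)), gradient_sub (φ.differentiable x) (hwd x)]
  rfl

/-- Weak maximum principle: a smooth nonnegative supersolution dominates the variational
solution. -/
theorem IsW10.ae_le_of_supersolution (hn : 2 ≤ n) (hΩ : Bornology.IsBounded (Ω : Set (RSpace n)))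
    {u : RSpace n → ℝ} {g : RSpace n → RSpace n} (hu : IsW10 Ω 2 u g) {F : RSpace n → ℝ}
    (hF : LocallyIntegrableOn F (Ω : Set (RSpace n))) (hsol : IsWeakSol Ω g F)
    {w : RSpace n → ℝ} (hw : ContDiff ℝ ∞ w) (hw0 : ∀ x ∈ Ω, 0 ≤ w x)
    (hsup : ∀ x ∈ Ω, F x ≤ -Δ w x) :
    ∀ᵐ x ∂(volume.restrict (Ω : Set (RSpace n))), u x ≤ w x := by
  have hσ : ContDiff ℝ ∞ Real.smoothTransition := Real.smoothTransition.contDiff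
  have hσ0 : ∀ t, 0 ≤ Real.smoothTransition t := Real.smoothTransition.nonneg
  have hσ1 : ∀ t, Real.smoothTransition t ≤ 1 := Real.smoothTransition.le_one
  -- With σ the smooth transition function, T' = σ² and S' = σ, so ⟨∇T(v), ∇v⟩ = |∇S(v)|²: testing
  -- with T controls the energy of S. Both vanish on the negative axis.
  obtain ⟨T, hT, -, hTd, hTi⟩ := exists_smooth_primitive (hσ.pow 2)
  obtain ⟨S, hS, -, hSd, hSi⟩ := exists_smooth_primitive hσ
  have hT0 : ∀ t ≤ 0, T t = 0 := fun t ht => by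
    rw [hTi, intervalIntegral.integral_symm, neg_eq_zero,
      intervalIntegral.integral_congr (g := fun _ => 0) (fun s hs => ?_)]
    · simp
    · rw [uIcc_of_le ht] at hs
      simp [Real.smoothTransition.zero_of_nonpos hs.2]
  have hS0 : ∀ t ≤ 0, S t = 0 := fun t ht => by
    rw [hSi, intervalIntegral.integral_symm, neg_eq_zero,
      intervalIntegral.integral_congr (g := fun _ => 0) (fun s hs => ?_)]
    · simp
    · rw [uIcc_of_le ht] at hs
      simp [Real.smoothTransition.zero_of_nonpos hs.2]
  have hTnn : ∀ t, 0 ≤ T t := fun t => by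
    rcases le_total t 0 with ht | ht
    · rw [hT0 t ht]
    · rw [hTi]
      exact intervalIntegral.integral_nonneg ht fun s _ => sq_nonneg _
  have hSpos : ∀ t, 0 < t → 0 < S t := fun t ht => by
    rw [hSi]
    exact intervalIntegral.intervalIntegral_pos_of_pos_on
      (hσ.continuous.intervalIntegrable _ _) (fun s hs => Real.smoothTransition.pos_of_pos hs.1) ht
  have hSL : LipschitzWith 1 S := by
    refine lipschitzWith_of_nnnorm_deriv_le (hS.differentiable (by simp)) fun t => ?_
    rw [(hSd t).deriv, ← NNReal.coe_le_coe, coe_nnnorm, Real.norm_of_nonneg (hσ0 t)]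
    exact hσ1 t
  have lg := MemLp.locallyIntegrableOn_opens one_le_two hu.memLp_grad
  have hwd : ContDiff ℝ 1 w := hw.of_le (by simp)
  have lw : LocallyIntegrableOn (gradient w) (Ω : Set (RSpace n)) :=
    (continuous_gradient hwd).continuousOn.locallyIntegrableOn Ω.isOpen.measurableSet
  have lΔ : LocallyIntegrableOn (fun x => -Δ w x) (Ω : Set (RSpace n)) := by
    refine ContinuousOn.locallyIntegrableOn (Continuous.continuousOn ?_) Ω.isOpen.measurableSet
    have : Δ w = fun x => ∑ i, fderiv ℝ (fun y => fderiv ℝ w y (stdVec i)) x (stdVec i) :=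
      funext fun x => laplacian_eq_sum_fderiv (hw.of_le (by norm_cast)).contDiffAt
    rw [this]
    refine (continuous_finsetSum _ fun i _ => ?_).neg
    have hd : ContDiff ℝ ∞ fun x => fderiv ℝ w x (stdVec i) :=
      (hw.fderiv_right (m := ∞) (by simp)).clm_apply contDiff_const
    exact ((hd.fderiv_right (m := ∞) (by simp)).clm_apply contDiff_const).continuous
  -- the energy of the truncation
  have henergy : ∀ φ : 𝓓(Ω, ℝ),
      eLpNorm (gradient (φ.trunc hw hw0 hS hS0)) 2 (volume.restrict (Ω : Set (RSpace n))) ≤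
        eLpNorm (gradient φ - g) 2 (volume.restrict (Ω : Set (RSpace n))) := fun φ => by
    set τ := φ.trunc hw hw0 hT hT0
    set χ := φ.trunc hw hw0 hS hS0
    have hb : MemLp (gradient φ - g) 2 (volume.restrict (Ω : Set (RSpace n))) :=
      (φ.memLp_gradient 2 _).sub hu.memLp_grad
    have i1 := IsWeakSol.integrable_inner lg τ
    have i2 := IsWeakSol.integrable_inner lw τ
    have i3 := τ.integrable_mul hF
    have i4 := τ.integrable_mul lΔ
    rw [eLpNorm_two_eq (χ.memLp_gradient 2 _), eLpNorm_two_eq hb]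
    refine ENNReal.ofReal_le_ofReal (Real.sqrt_le_sqrt ?_)
    -- Subtracting the identities for g and ∇w leaves ∫(F + Δw)τ with τ ≥ 0, which is nonpositive by
    -- the supersolution property.
    have hneg : ∫ x in (Ω : Set (RSpace n)),
        (inner ℝ (g x) (gradient τ x) - inner ℝ (gradient w x) (gradient τ x)) ≤ 0 := by
      rw [integral_sub i1 i2, hsol τ, integral_inner_gradient_of_contDiff hw, sub_nonpos]
      refine setIntegral_mono_on i3 i4 Ω.isOpen.measurableSet fun x hx => ?_
      refine mul_le_mul_of_nonneg_right (hsup x hx) ?_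
      rw [φ.trunc_apply hw hw0 hT hT0 hx]
      exact hTnn _
    calc ∫ x in (Ω : Set (RSpace n)), ‖gradient χ x‖ ^ 2
        ≤ ∫ x in (Ω : Set (RSpace n)), (2 * (inner ℝ (g x) (gradient τ x) -
          inner ℝ (gradient w x) (gradient τ x)) + ‖(gradient φ - g) x‖ ^ 2) := by
          refine setIntegral_mono_on (integrable_norm_sq_of_memLp (χ.memLp_gradient 2 _))
            (((i1.sub i2).const_mul 2).add (integrable_norm_sq_of_memLp hb))
            Ω.isOpen.measurableSet fun x hx => ?_
          rw [φ.gradient_trunc hw hw0 hT hT0 hx, φ.gradient_trunc hw hw0 hS hS0 hx, (hTd _).deriv,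
            (hSd _).deriv, ← inner_sub_left, inner_smul_right, norm_smul, mul_pow,
            Real.norm_of_nonneg (hσ0 _)]
          -- Young's inequality and absorption, with weight s² ≤ 1: s²|a|² ≤ 2s²⟨g - ∇w, a⟩ + |∇φ -
          -- g|².
          set s := Real.smoothTransition (φ x - w x)
          set a := gradient φ x - gradient w x with ha
          have e : g x - gradient w x = a - (gradient φ - g) x := by simp [ha]
          rw [e, inner_sub_left, real_inner_self_eq_norm_sq]
          have a1 := inner_le_half_sq ((gradient φ - g) x) a
          have a2 : s ^ 2 ≤ 1 := pow_le_one₀ (hσ0 _) (hσ1 _)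
          have a3 := mul_le_mul_of_nonneg_left a1 (sq_nonneg s)
          have a4 := mul_le_mul_of_nonneg_right a2 (sq_nonneg ‖(gradient φ - g) x‖)
          nlinarith
      _ = 2 * (∫ x in (Ω : Set (RSpace n)), (inner ℝ (g x) (gradient τ x) -
          inner ℝ (gradient w x) (gradient τ x))) +
          ∫ x in (Ω : Set (RSpace n)), ‖(gradient φ - g) x‖ ^ 2 := by
          rw [← integral_const_mul]
          exact integral_add ((i1.sub i2).const_mul 2) (integrable_norm_sq_of_memLp hb)
      _ ≤ _ := by linarith
  obtain ⟨C, hC⟩ := TestFunction.poincare hn hΩ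
  obtain ⟨φ, h1, h2⟩ := hu.exists_seq
  -- Poincaré bounds the truncation S(φ k - w) in L² by the gradient error of φ k, and S is
  -- 1-Lipschitz, so the norm of S(u - w) is below a sequence tending to 0. Positivity of S on the
  -- positive axis then forces u ≤ w.
  have hzero : eLpNorm (fun x => S (u x - w x)) 2 (volume.restrict (Ω : Set (RSpace n))) = 0 := by
    have hlim : Tendsto (fun k =>
        C * eLpNorm (gradient (φ k) - g) 2 (volume.restrict (Ω : Set (RSpace n))) +
          eLpNorm (⇑(φ k) - u) 2 (volume.restrict (Ω : Set (RSpace n)))) atTop (𝓝 0) := by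
      have := (ENNReal.Tendsto.const_mul (a := (C : ℝ≥0∞)) h2 (Or.inr ENNReal.coe_ne_top)).add h1
      simpa using this
    refine le_antisymm (ge_of_tendsto hlim (Eventually.of_forall fun k => ?_)) zero_le
    set χ := (φ k).trunc hw hw0 hS hS0 with hχ
    have hum := hu.memLp.aestronglyMeasurable
    have hm : AEStronglyMeasurable (fun x => S (u x - w x))
        (volume.restrict (Ω : Set (RSpace n))) :=
      hS.continuous.comp_aestronglyMeasurable (hum.sub hw.continuous.aestronglyMeasurable)
    have e : (fun x => S (u x - w x)) = ⇑χ + ((fun x => S (u x - w x)) - ⇑χ) := by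
      ext x; simp
    rw [e]
    refine (eLpNorm_add_le χ.continuous.aestronglyMeasurable
      (hm.sub χ.continuous.aestronglyMeasurable) one_le_two).trans ?_
    refine add_le_add ((hC χ).trans ?_) ?_
    · gcongr
      exact henergy _
    · refine eLpNorm_mono_ae ?_
      filter_upwards [ae_restrict_mem Ω.isOpen.measurableSet] with x hx
      rw [Pi.sub_apply, hχ, (φ k).trunc_apply hw hw0 hS hS0 hx]
      refine (hSL.norm_sub_le _ _).trans_eq ?_
      rw [NNReal.coe_one, one_mul, Pi.sub_apply, ← norm_neg]
      congr 1; ring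
  have hm : AEStronglyMeasurable (fun x => S (u x - w x))
      (volume.restrict (Ω : Set (RSpace n))) :=
    hS.continuous.comp_aestronglyMeasurable
      (hu.memLp.aestronglyMeasurable.sub hw.continuous.aestronglyMeasurable)
  rw [eLpNorm_eq_zero_iff hm two_ne_zero] at hzero
  filter_upwards [hzero] with x hx
  by_contra h
  have := hSpos (u x - w x) (by linarith [not_le.1 h])
  exact this.ne' hx

end MaximumPrinciple

/-! ### Exterior balls and barriers -/

section Barrier

variable {n : ℕ} {Ω : Opens (RSpace n)}

/-- The centre is y + R'ν with ν = ∇ρ/|∇ρ|. For x in Ω inside the ball, h = x - y would satisfy |h|²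
< 2R'⟨h, ν⟩, while ρ(x) < 0 ≤ ρ(y) and the Lipschitz bound on the derivative give |∇ρ|⟨h, ν⟩ ≤
M|h|²; for small R' these conflict. All radii up to R are allowed so that local radii can be
patched. -/
theorem HasC2Boundary.exists_local_exteriorBall (hC : HasC2Boundary Ω) {x₀ : RSpace n}
    (hx₀ : x₀ ∈ frontier (Ω : Set (RSpace n))) :
    ∃ r > 0, ∃ R > 0, ∀ y ∈ frontier (Ω : Set (RSpace n)) ∩ Metric.ball x₀ r,
      ∀ R' : ℝ, 0 < R' → R' ≤ R → ∃ z, ‖y - z‖ = R' ∧ ∀ x ∈ Ω, R' ≤ ‖x - z‖ := by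
  obtain ⟨V, ρ, hV, hxV, hρ, hne, hΩV⟩ := hC x₀ hx₀
  have hat : ContDiffAt ℝ 2 ρ x₀ := hρ.contDiffAt (hV.mem_nhds hxV)
  obtain ⟨M, t, ht, hLip⟩ :=
    (hat.fderiv_right (m := 1) (by norm_num)).exists_lipschitzOnWith
  have hcont : ContinuousAt (fderiv ℝ ρ) x₀ :=
    (hat.fderiv_right (m := 1) (by norm_num)).continuousAt
  set m : ℝ := ‖fderiv ℝ ρ x₀‖ / 2 with hm
  have hm0 : 0 < m := by have := norm_pos_iff.2 hne; positivity
  have hnear : ∀ᶠ y in 𝓝 x₀, m < ‖fderiv ℝ ρ y‖ :=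
    hcont.norm.eventually_const_lt (by linarith)
  obtain ⟨r, hr, hball⟩ := Metric.mem_nhds_iff.1
    (inter_mem (inter_mem ht (hV.mem_nhds hxV)) hnear)
  -- The bound r/4 keeps x in the ball where ρ is controlled, since |x - y| < 2R' ≤ r/2. The other
  -- one makes 2R'(M+1) at most m, a lower bound for |∇ρ| near x₀.
  refine ⟨r / 2, by positivity, min (r / 4) (m / (2 * (M + 1))), by positivity, ?_⟩
  rintro y ⟨hyf, hyb⟩ R' hR' hR'le
  have hyb' : y ∈ Metric.ball x₀ r := Metric.ball_subset_ball (by linarith) hyb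
  have hy0 : 0 ≤ ρ y := by
    by_contra h
    have : y ∈ (Ω : Set (RSpace n)) ∩ V := hΩV ▸ ⟨(hball hyb').1.2, not_le.1 h⟩
    rw [Ω.isOpen.frontier_eq] at hyf
    exact hyf.2 this.1
  have hgy : m < ‖gradient ρ y‖ := by rw [norm_gradient]; exact (hball hyb').2
  have hg0 : 0 < ‖gradient ρ y‖ := hm0.trans hgy
  set ν := ‖gradient ρ y‖⁻¹ • gradient ρ y with hν
  have hν1 : ‖ν‖ = 1 := by rw [hν, norm_smul, norm_inv, norm_norm, inv_mul_cancel₀ hg0.ne']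
  refine ⟨y + R' • ν, by simp [norm_smul, hν1, abs_of_pos hR'], fun x hx => ?_⟩
  by_contra! hlt
  set h := x - y with hh
  have hh1 : ‖h - R' • ν‖ < R' := by
    have e : h - R' • ν = x - (y + R' • ν) := by rw [hh]; abel
    rwa [e]
  have hh2 : ‖h‖ < 2 * R' := by
    calc ‖h‖ = ‖(h - R' • ν) + R' • ν‖ := by rw [sub_add_cancel]
      _ ≤ ‖h - R' • ν‖ + ‖R' • ν‖ := norm_add_le _ _
      _ < 2 * R' := by rw [norm_smul, hν1, Real.norm_of_nonneg hR'.le]; linarith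
  have hR4 : R' ≤ r / 4 := hR'le.trans (min_le_left _ _)
  have hxb : x ∈ Metric.ball x₀ r := by
    rw [Metric.mem_ball] at hyb ⊢
    have : dist x y = ‖h‖ := dist_eq_norm _ _
    linarith [dist_triangle x y x₀]
  have hineq : ‖h‖ ^ 2 < 2 * R' * inner ℝ h ν := by
    have e := norm_sub_sq_real h (R' • ν)
    rw [inner_smul_right, norm_smul, hν1, Real.norm_of_nonneg hR'.le] at e
    nlinarith [norm_nonneg (h - R' • ν)]
  have htaylor : ‖ρ x - ρ y - fderiv ℝ ρ y (x - y)‖ ≤ M * ‖h‖ * ‖x - y‖ := by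
    have hs : segment ℝ y x ⊆ Metric.ball x₀ r := (convex_ball x₀ r).segment_subset hyb' hxb
    refine (convex_segment y x).norm_image_sub_le_of_norm_hasFDerivWithin_le' (f' := fderiv ℝ ρ)
      (fun w hw => ?_) (fun w hw => ?_) (left_mem_segment ℝ y x) (right_mem_segment ℝ y x)
    · exact ((hρ.contDiffAt (hV.mem_nhds (hball (hs hw)).1.2)).differentiableAt
        (by norm_num)).hasFDerivAt.hasFDerivWithinAt
    · refine (hLip.norm_sub_le (hball (hs hw)).1.1 (hball hyb').1.1).trans ?_
      refine mul_le_mul_of_nonneg_left ?_ M.2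
      have := (convex_closedBall y ‖h‖).segment_subset (Metric.mem_closedBall_self (norm_nonneg _))
        (show x ∈ Metric.closedBall y ‖h‖ by rw [Metric.mem_closedBall, dist_eq_norm]) hw
      rwa [Metric.mem_closedBall, dist_eq_norm] at this
  have hx0 : ρ x < 0 := by
    have : x ∈ {x | x ∈ V ∧ ρ x < 0} := hΩV ▸ ⟨hx, (hball hxb).1.2⟩
    exact this.2
  have hdir : fderiv ℝ ρ y (x - y) = ‖gradient ρ y‖ * inner ℝ h ν := by
    rw [hν, inner_smul_right, ← mul_assoc, mul_inv_cancel₀ hg0.ne', one_mul, ← inner_gradient,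
      real_inner_comm]
  have hRm : R' * (2 * (M + 1)) ≤ m := by
    have := hR'le.trans (min_le_right _ _)
    rwa [le_div_iff₀ (by positivity)] at this
  have hM0 : (0 : ℝ) ≤ M := M.2
  rw [Real.norm_eq_abs, abs_le, hdir, ← hh] at htaylor
  have k0 : 0 < inner ℝ h ν := by nlinarith [sq_nonneg ‖h‖]
  have k1 : m * inner ℝ h ν ≤ ‖gradient ρ y‖ * inner ℝ h ν :=
    mul_le_mul_of_nonneg_right hgy.le k0.le
  have k2 : R' * (2 * (M + 1)) * inner ℝ h ν ≤ m * inner ℝ h ν :=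
    mul_le_mul_of_nonneg_right hRm k0.le
  have k3 : (M + 1 : ℝ) * ‖h‖ ^ 2 ≤ (M + 1) * (2 * R' * inner ℝ h ν) :=
    mul_le_mul_of_nonneg_left hineq.le (by positivity)
  nlinarith [htaylor.1, sq_nonneg ‖h‖]

/-- A bounded domain with `C²` boundary satisfies a uniform exterior ball condition. -/
theorem HasC2Boundary.exists_exteriorBall (hC : HasC2Boundary Ω)
    (hΩ : Bornology.IsBounded (Ω : Set (RSpace n))) :
    ∃ R > 0, ∀ y ∈ frontier (Ω : Set (RSpace n)), ∃ z, ‖y - z‖ = R ∧ ∀ x ∈ Ω, R ≤ ‖x - z‖ := by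
  have hK : IsCompact (frontier (Ω : Set (RSpace n))) :=
    Metric.isCompact_of_isClosed_isBounded isClosed_frontier
      (hΩ.closure.subset frontier_subset_closure)
  have key : ∃ R > 0, ∀ y ∈ frontier (Ω : Set (RSpace n)) ∩ frontier (Ω : Set (RSpace n)),
      ∀ R' : ℝ, 0 < R' → R' ≤ R → ∃ z, ‖y - z‖ = R' ∧ ∀ x ∈ Ω, R' ≤ ‖x - z‖ := by
    -- Compactness of the boundary; allowing every R' ≤ R makes the property pass to finite unions
    -- by taking the minimum.
    refine hK.induction_on (p := fun s => ∃ R > 0, ∀ y ∈ frontier (Ω : Set (RSpace n)) ∩ s,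
      ∀ R' : ℝ, 0 < R' → R' ≤ R → ∃ z, ‖y - z‖ = R' ∧ ∀ x ∈ Ω, R' ≤ ‖x - z‖) ?_ ?_ ?_ ?_
    · exact ⟨1, one_pos, fun y hy => hy.2.elim⟩
    · rintro s t hst ⟨R, hR, h⟩
      exact ⟨R, hR, fun y hy => h y ⟨hy.1, hst hy.2⟩⟩
    · rintro s t ⟨R, hR, h⟩ ⟨S, hS, h'⟩
      refine ⟨min R S, lt_min hR hS, fun y hy R' h0 hle => ?_⟩
      rcases hy.2 with hy' | hy'
      · exact h y ⟨hy.1, hy'⟩ R' h0 (hle.trans (min_le_left _ _))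
      · exact h' y ⟨hy.1, hy'⟩ R' h0 (hle.trans (min_le_right _ _))
    · intro x hx
      obtain ⟨r, hr, R, hR, h⟩ := hC.exists_local_exteriorBall hx
      exact ⟨Metric.ball x r, mem_nhdsWithin_of_mem_nhds (Metric.ball_mem_nhds x hr), R, hR, h⟩
  obtain ⟨R, hR, h⟩ := key
  exact ⟨R, hR, fun y hy => h y ⟨hy, hy⟩ R hR le_rfl⟩

/-- The Laplacian of a function of `‖x - z‖ ^ 2`. -/
theorem laplacian_comp_norm_sq {θ θ' θ'' : ℝ → ℝ} (h1 : ∀ t, 0 ≤ t → HasDerivAt θ (θ' t) t)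
    (h2 : ∀ t, 0 ≤ t → HasDerivAt θ' (θ'' t) t) {z x : RSpace n}
    (hf : ContDiffAt ℝ 2 (fun y => θ (‖y - z‖ ^ 2)) x) :
    Δ (fun y : RSpace n => θ (‖y - z‖ ^ 2)) x =
      4 * ‖x - z‖ ^ 2 * θ'' (‖x - z‖ ^ 2) + 2 * n * θ' (‖x - z‖ ^ 2) := by
  have hN : ∀ y : RSpace n, HasFDerivAt (fun y => ‖y - z‖ ^ 2) (2 • innerSL ℝ (y - z)) y :=
    fun y => by simpa using ((hasFDerivAt_id y).sub_const z).norm_sq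
  have e1 : ∀ y v, fderiv ℝ (fun y : RSpace n => θ (‖y - z‖ ^ 2)) y v =
      θ' (‖y - z‖ ^ 2) * (2 * inner ℝ (y - z) v) := fun y v => by
    have a1 : fderiv ℝ (fun y : RSpace n => θ (‖y - z‖ ^ 2)) y = _ :=
      ((h1 _ (sq_nonneg _)).comp_hasFDerivAt y (hN y)).fderiv
    rw [a1]
    simp [inner_sub_left]
  rw [laplacian_eq_sum_fderiv hf]
  simp only [e1]
  have e2 : ∀ i : Fin n, fderiv ℝ (fun y : RSpace n =>
      θ' (‖y - z‖ ^ 2) * (2 * inner ℝ (y - z) (stdVec i))) x (stdVec i) =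
      4 * θ'' (‖x - z‖ ^ 2) * (inner ℝ (x - z) (stdVec i) * inner ℝ (x - z) (stdVec i)) +
        2 * θ' (‖x - z‖ ^ 2) := fun i => by
    have a1 := (h2 _ (sq_nonneg ‖x - z‖)).comp_hasFDerivAt x (hN x)
    have a2 : HasFDerivAt (fun y : RSpace n => 2 * inner ℝ (y - z) (stdVec i))
        ((2 : ℝ) • innerSL ℝ (stdVec i)) x := by
      have : (fun y : RSpace n => 2 * inner ℝ (y - z) (stdVec i)) =
          fun y => 2 * innerSL ℝ (stdVec i) (y - z) := by
        ext y; rw [innerSL_apply_apply, real_inner_comm]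
      rw [this]
      simpa using ((innerSL ℝ (stdVec i)).hasFDerivAt.comp x
        ((hasFDerivAt_id x).sub_const z)).const_mul 2
    have a3 := (a1.mul a2).fderiv
    simp only [Function.comp_def] at a3
    have a4 : fderiv ℝ (fun y : RSpace n =>
      θ' (‖y - z‖ ^ 2) * (2 * inner ℝ (y - z) (stdVec i))) x = _ := a3
    rw [a4]
    simp [inner_sub_left]
    ring
  rw [Finset.sum_congr rfl fun i _ => e2 i, Finset.sum_add_distrib, ← Finset.mul_sum,
    ← inner_eq_sum_stdVec, real_inner_self_eq_norm_sq]
  simp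
  ring

theorem le_of_ae_le_of_continuousOn {f g : RSpace n → ℝ} (hf : ContinuousOn f (Ω : Set (RSpace n)))
    (hg : ContinuousOn g (Ω : Set (RSpace n)))
    (h : ∀ᵐ x ∂(volume.restrict (Ω : Set (RSpace n))), f x ≤ g x) : ∀ x ∈ Ω, f x ≤ g x := by
  intro x hx
  have := eqOn_of_ae_eq_of_continuousOn (hf.sup hg) hg (by
    filter_upwards [h] with y hy using sup_eq_right.2 hy) hx
  exact sup_eq_right.1 this

/-- The variational solution grows at most linearly away from the boundary. -/
theorem HasC2Boundary.exists_abs_le_mul_norm_sub (hC : HasC2Boundary Ω) (hn : 2 ≤ n)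
    (hΩ : Bornology.IsBounded (Ω : Set (RSpace n))) {u U : RSpace n → ℝ} {g : RSpace n → RSpace n}
    {F : 𝓓(Ω, ℝ)} (hu : IsW10 Ω 2 u g) (hsol : IsWeakSol Ω g F)
    (hU : ContinuousOn U (Ω : Set (RSpace n)))
    (huU : u =ᵐ[volume.restrict (Ω : Set (RSpace n))] U) :
    ∃ C, 0 ≤ C ∧ ∀ y ∈ frontier (Ω : Set (RSpace n)), ∀ x ∈ Ω, |U x| ≤ C * ‖x - y‖ := by
  obtain ⟨R, hR, hball⟩ := hC.exists_exteriorBall hΩ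
  obtain ⟨B, hB0, hB⟩ := F.bounded
  obtain ⟨D, hD0, hD⟩ := hΩ.subset_closedBall_lt 0 0
  have hn0 : (0 : ℝ) < n := by exact_mod_cast (by omega : 0 < n)
  set L : ℝ := 2 * D + R with hL
  -- αR² = n makes 4α|x - z|² - 2n at least 2n outside the exterior ball.
  set α : ℝ := n / R ^ 2 with hα
  have hα0 : 0 < α := by positivity
  have hαR : α * R ^ 2 = n := by rw [hα]; field_simp
  -- Chosen so that -Δw ≥ B on Ω, where |x - z| ≤ L bounds the exponential from below by exp(-αL²).
  set K : ℝ := B * Real.exp (α * L ^ 2) / (2 * n * α) with hK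
  have hK0 : 0 ≤ K := by positivity
  have hL0 : 0 < L := by positivity
  refine ⟨K * α * (2 * L), by positivity, fun y hy => ?_⟩
  obtain ⟨z, hyz, hz⟩ := hball y hy
  have hyD : ‖y‖ ≤ D := by
    have := closure_minimal hD Metric.isClosed_closedBall (frontier_subset_closure hy)
    simpa using this
  have hsL : ∀ x ∈ Ω, ‖x - z‖ ≤ ‖x - y‖ + R ∧ ‖x - z‖ ≤ L := fun x hx => by
    have h1 : ‖x‖ ≤ D := by simpa using hD hx
    have h2 : ‖x - z‖ ≤ ‖x - y‖ + ‖y - z‖ := norm_sub_le_norm_sub_add_norm_sub x y z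
    have h3 : ‖x - y‖ ≤ ‖x‖ + ‖y‖ := norm_sub_le _ _
    constructor <;> linarith
  set E₀ := Real.exp (-(α * R ^ 2)) with hE₀
  -- The barrier: zero on the sphere |x - z| = R, which passes through y, and nonnegative on Ω.
  set w : RSpace n → ℝ := fun x => K * (E₀ - Real.exp (-(α * ‖x - z‖ ^ 2))) with hw
  have hws : ContDiff ℝ ∞ w := by
    have : ContDiff ℝ ∞ fun x : RSpace n => ‖x - z‖ ^ 2 :=
      (contDiff_id.sub contDiff_const).norm_sq ℝ
    exact contDiff_const.mul (contDiff_const.sub (Real.contDiff_exp.comp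
      (contDiff_const.mul this).neg))
  have hexp : ∀ t : ℝ, HasDerivAt (fun t => Real.exp (-(α * t))) (-α * Real.exp (-(α * t))) t :=
    fun t => by
      have := ((hasDerivAt_id t).const_mul α).neg.exp
      simpa [mul_comm] using this
  have hΔ : ∀ x, -Δ w x = K * α * Real.exp (-(α * ‖x - z‖ ^ 2)) * (4 * (α * ‖x - z‖ ^ 2) - 2 * n) :=
    fun x => by
      have := laplacian_comp_norm_sq (z := z) (x := x)
        (θ := fun t => K * (E₀ - Real.exp (-(α * t))))
        (θ' := fun t => K * α * Real.exp (-(α * t)))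
        (θ'' := fun t => K * α * (-α * Real.exp (-(α * t))))
        (fun t _ => (((hexp t).const_sub E₀).const_mul K).congr_deriv (by ring))
        (fun t _ => (hexp t).const_mul _) (hws.of_le (by norm_cast)).contDiffAt
      rw [this]
      ring
  have hge : ∀ x ∈ Ω, (n : ℝ) ≤ α * ‖x - z‖ ^ 2 := fun x hx => by
    rw [← hαR]
    have := hz x hx
    gcongr
  have hw0 : ∀ x ∈ Ω, 0 ≤ w x := fun x hx => by
    refine mul_nonneg hK0 (sub_nonneg.2 (Real.exp_le_exp.2 (neg_le_neg ?_)))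
    rw [hαR]
    exact hge x hx
  have hsup : ∀ x ∈ Ω, B ≤ -Δ w x := fun x hx => by
    rw [hΔ]
    have h1 : Real.exp (-(α * L ^ 2)) ≤ Real.exp (-(α * ‖x - z‖ ^ 2)) := by
      have := (hsL x hx).2
      gcongr
    have h2 : 2 * (n : ℝ) ≤ 4 * (α * ‖x - z‖ ^ 2) - 2 * n := by linarith [hge x hx]
    calc B = K * α * Real.exp (-(α * L ^ 2)) * (2 * n) := by
          rw [hK, Real.exp_neg]; field_simp
      _ ≤ _ := by gcongr
  -- The inequality exp(-s) ≥ 1 - s bounds w by Kα(|x - z|² - R²), and |x - z|² - R² factors as (|x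
  -- - z| - R)(|x - z| + R) ≤ 2L|x - y|.
  have hwle : ∀ x ∈ Ω, w x ≤ K * α * (2 * L) * ‖x - y‖ := fun x hx => by
    have h1 : E₀ - Real.exp (-(α * ‖x - z‖ ^ 2)) ≤ α * (‖x - z‖ ^ 2 - R ^ 2) := by
      have e : Real.exp (-(α * ‖x - z‖ ^ 2)) = E₀ * Real.exp (-(α * (‖x - z‖ ^ 2 - R ^ 2))) := by
        rw [hE₀, ← Real.exp_add]; congr 1; ring
      have h2 := Real.add_one_le_exp (-(α * (‖x - z‖ ^ 2 - R ^ 2)))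
      have h3 : E₀ ≤ 1 := Real.exp_le_one_iff.2 (by nlinarith [sq_nonneg R])
      have h4 : 0 ≤ α * (‖x - z‖ ^ 2 - R ^ 2) := by linarith [hge x hx]
      have h5 : 0 < E₀ := Real.exp_pos _
      rw [e]
      nlinarith
    have h2 : ‖x - z‖ ^ 2 - R ^ 2 ≤ 2 * L * ‖x - y‖ := by
      have h3 := hsL x hx
      have h4 := hz x hx
      have h5 := norm_nonneg (x - y)
      have h6 : R ≤ L := by rw [hL]; linarith
      nlinarith
    calc w x ≤ K * (α * (2 * L * ‖x - y‖)) := by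
          refine mul_le_mul_of_nonneg_left (h1.trans ?_) hK0
          gcongr
      _ = _ := by ring
  have lF : LocallyIntegrableOn F (Ω : Set (RSpace n)) :=
    F.continuous.continuousOn.locallyIntegrableOn Ω.isOpen.measurableSet
  have k1 := hu.ae_le_of_supersolution hn hΩ lF hsol hws hw0 fun x hx =>
    ((le_abs_self _).trans (hB x)).trans (hsup x hx)
  have k2 := (hu.const_smul (-1)).ae_le_of_supersolution hn hΩ (F := (-1 : ℝ) • ⇑F)
    (lF.smul (-1 : ℝ)) (hsol.const_smul (-1)) hws hw0 fun x hx => by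
      refine le_trans ?_ ((hB x).trans (hsup x hx))
      simpa using neg_le_abs (F x)
  refine fun x hx => le_trans ?_ (hwle x hx)
  refine le_of_ae_le_of_continuousOn (Ω := Ω) hU.abs hws.continuous.continuousOn ?_ x hx
  filter_upwards [k1, k2, huU] with x h1 h2 h3
  rw [← h3]
  exact abs_le'.2 ⟨h1, by simpa using h2⟩

end Barrier

/-! ### Regularity up to the boundary -/

section Regularity

variable {n : ℕ} {Ω : Opens (RSpace n)}

theorem IsW10.congr {p : ℝ≥0∞} {u w : RSpace n → ℝ} {g h : RSpace n → RSpace n}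
    (hu : IsW10 Ω p u g) (huw : u =ᵐ[volume.restrict (Ω : Set (RSpace n))] w)
    (hgh : g =ᵐ[volume.restrict (Ω : Set (RSpace n))] h) : IsW10 Ω p w h := by
  obtain ⟨h1, h2, φ, h3, h4⟩ := hu
  refine ⟨h1.ae_eq huw, h2.ae_eq hgh, φ, ?_, ?_⟩
  · exact h3.congr fun k => eLpNorm_congr_ae (EventuallyEq.rfl.sub huw)
  · exact h4.congr fun k => eLpNorm_congr_ae (EventuallyEq.rfl.sub hgh)

theorem IsWeakSol.congr {g h : RSpace n → RSpace n} {F : RSpace n → ℝ} (hg : IsWeakSol Ω g F)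
    (hgh : g =ᵐ[volume.restrict (Ω : Set (RSpace n))] h) : IsWeakSol Ω h F := fun φ => by
  rw [← hg φ]
  refine integral_congr_ae ?_
  filter_upwards [hgh] with x hx
  rw [hx]

/-- The variational solution with smooth data, in its smooth version. -/
structure IsRegularSol (Ω : Opens (RSpace n)) (F : 𝓓(Ω, ℝ)) (U : RSpace n → ℝ) : Prop where
  isW10 : IsW10 Ω 2 U (gradient U)
  isWeakSol : IsWeakSol Ω (gradient U) F
  contDiffOn : ContDiffOn ℝ ∞ U (Ω : Set (RSpace n))
  eq_zero : ∀ x, x ∉ Ω → U x = 0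
  exists_bound : ∃ C, 0 ≤ C ∧ ∀ x ∈ Ω,
    |U x| ≤ C * Metric.infDist x (Ω : Set (RSpace n))ᶜ ∧ ‖gradient U x‖ ≤ C

theorem mem_shrink_iff (hne : ((Ω : Set (RSpace n))ᶜ).Nonempty) {r : ℝ} (hr : 0 ≤ r)
    {x : RSpace n} : x ∈ shrink Ω r ↔ r < Metric.infDist x (Ω : Set (RSpace n))ᶜ := by
  rw [mem_shrink, Metric.mem_cthickening_iff,
    ENNReal.le_ofReal_iff_toReal_le (Metric.infEDist_ne_top hne) hr, not_le]
  rfl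

theorem nonempty_compl_of_isBounded (hn : 2 ≤ n) (hΩ : Bornology.IsBounded (Ω : Set (RSpace n))) :
    ((Ω : Set (RSpace n))ᶜ).Nonempty := by
  have : Nontrivial (RSpace n) := by
    refine Module.nontrivial_of_finrank_pos (R := ℝ) ?_
    rw [finrank_euclideanSpace_fin]; omega
  by_contra h
  rw [not_nonempty_iff_eq_empty, compl_empty_iff] at h
  exact NormedSpace.unbounded_univ ℝ (RSpace n) (h ▸ hΩ)

theorem exists_mem_frontier_infDist_eq (hne : ((Ω : Set (RSpace n))ᶜ).Nonempty) {x : RSpace n}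
    (hx : x ∈ Ω) : ∃ y ∈ frontier (Ω : Set (RSpace n)),
      Metric.infDist x (Ω : Set (RSpace n))ᶜ = ‖x - y‖ := by
  obtain ⟨y, hy, hxy⟩ := Ω.isOpen.isClosed_compl.exists_infDist_eq_dist hne x
  refine ⟨y, ?_, by rw [hxy, dist_eq_norm]⟩
  rw [Ω.isOpen.frontier_eq]
  refine ⟨?_, hy⟩
  have hd : Metric.infDist x (Ω : Set (RSpace n))ᶜ ≠ 0 :=
    ((Ω.isOpen.isClosed_compl.notMem_iff_infDist_pos hne).1 fun h => h hx).ne'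
  refine closure_mono (Metric.ball_infDist_compl_subset (x := x)) ?_
  rw [closure_ball x hd, Metric.mem_closedBall, dist_comm, hxy]

/-- Barriers give |U| ≤ C·dist to the complement. For the gradient at x, U is represented at scale r
= dist/4: the mollification of U has Lipschitz constant of order sup|U|/r, with sup|U| ≤ 6Cr on the
ball used, and the average of F inherits a Lipschitz constant from F. Neither bound depends on x. -/
theorem exists_isRegularSol (hn : 2 ≤ n) (hΩ : Bornology.IsBounded (Ω : Set (RSpace n)))
    (hC : HasC2Boundary Ω) (F : 𝓓(Ω, ℝ)) : ∃ U, IsRegularSol Ω F U := by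
  have := isFiniteMeasure_restrict_of_isBounded hΩ
  have hne := nonempty_compl_of_isBounded hn hΩ
  obtain ⟨u, g, hu, hsol⟩ := exists_isW10_isWeakSol hn hΩ F
  have lF : LocallyIntegrableOn F (Ω : Set (RSpace n)) :=
    F.continuous.continuousOn.locallyIntegrableOn Ω.isOpen.measurableSet
  have hug := hu.hasWeakGradient one_le_two
  obtain ⟨v, hv, huv⟩ := (hsol.hasWeakLaplacian lF hug).exists_contDiffOn
    (hu.memLp.integrable one_le_two)
  set U := (Ω : Set (RSpace n)).indicator v with hUdef
  have hUv : EqOn U v (Ω : Set (RSpace n)) := fun x hx => indicator_of_mem hx v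
  have hU : ContDiffOn ℝ ∞ U (Ω : Set (RSpace n)) := hv.congr hUv
  have huU : u =ᵐ[volume.restrict (Ω : Set (RSpace n))] U := by
    filter_upwards [huv, ae_restrict_mem Ω.isOpen.measurableSet] with x hx hxΩ
    rw [hx, hUv hxΩ]
  have hU0 : ∀ x, x ∉ Ω → U x = 0 := fun x hx => indicator_of_notMem hx v
  have hgU : g =ᵐ[volume.restrict (Ω : Set (RSpace n))] gradient U :=
    hug.ae_unique (hasWeakGradient_of_contDiffOn (hU.of_le (by simp))) huU
  have hW := hu.congr huU hgU
  have hS := hsol.congr hgU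
  obtain ⟨C, hC0, hCd⟩ := hC.exists_abs_le_mul_norm_sub hn hΩ hu hsol hU.continuousOn huU
  have hd : ∀ x ∈ Ω, |U x| ≤ C * Metric.infDist x (Ω : Set (RSpace n))ᶜ := fun x hx => by
    obtain ⟨y, hy, hxy⟩ := exists_mem_frontier_infDist_eq hne hx
    rw [hxy]
    exact hCd y hy x hx
  obtain ⟨ρ, ψ, h⟩ := exists_isMollifierPair n
  obtain ⟨C₁, hC₁0, hC₁⟩ := h.exists_abs_mollify_sub_le
  obtain ⟨L, hL⟩ := F.contDiff_one.lipschitzWith_of_hasCompactSupport F.hasCompactSupport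
    (by norm_num)
  obtain ⟨y₀, hy₀⟩ := id hne
  -- The centre y₀ lies outside Ω, so D dominates the distance to the complement and hence every
  -- scale r used below.
  obtain ⟨D, hD⟩ := hΩ.subset_closedBall y₀
  have f1 := h.isFiniteMeasure_potMeasure D
  set M := (potMeasure ψ D).real univ
  have hUi : Integrable U := by
    have : IntegrableOn U (Ω : Set (RSpace n)) := hW.memLp.integrable one_le_two
    have h2 := this.integrable_indicator Ω.isOpen.measurableSet
    rwa [hUdef, indicator_indicator, inter_self] at h2
  have hUind : (Ω : Set (RSpace n)).indicator U = U := by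
    rw [hUdef, indicator_indicator, inter_self]
  have hLap := hS.hasWeakLaplacian lF (hW.hasWeakGradient one_le_two)
  refine ⟨U, hW, hS, hU, hU0, max C (C₁ * (6 * C) + M * L), le_max_of_le_left hC0,
    fun x hx => ⟨(hd x hx).trans (mul_le_mul_of_nonneg_right (le_max_left _ _)
      Metric.infDist_nonneg), le_trans ?_ (le_max_right _ _)⟩⟩
  have hdpos : 0 < Metric.infDist x (Ω : Set (RSpace n))ᶜ :=
    (Ω.isOpen.isClosed_compl.notMem_iff_infDist_pos hne).1 fun h => h hx
  set r := Metric.infDist x (Ω : Set (RSpace n))ᶜ / 4 with hr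
  have hr0 : 0 < r := by positivity
  have hrD : r ≤ D := by
    have h1 : dist x y₀ ≤ D := hD hx
    have h2 := Metric.infDist_le_dist_of_mem (x := x) hy₀
    rw [hr]; linarith
  have f2 := h.isFiniteMeasure_potMeasure r
  have hrep := eqOn_of_ae_eq_of_continuousOn (Ω := shrink Ω r)
    (hU.continuousOn.mono (shrink_le r)) (Continuous.continuousOn
      ((h.contDiff_mollify hr0 (v := (Ω : Set (RSpace n)).indicator U)
          (hUind.symm ▸ hUi.locallyIntegrable)).add
        (avg_contDiff ((potMeasure ψ r).map Neg.neg) F.contDiff F.hasCompactSupport)).continuous)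
    (hLap.ae_eq_mollify_add_avg h hr0 (hW.memLp.integrable one_le_two))
  rw [hUind] at hrep
  have hxr : x ∈ shrink Ω r := (mem_shrink_iff hne hr0.le).2 (by rw [hr]; linarith)
  rw [norm_gradient]
  refine norm_fderiv_le_of_lip' ℝ (by positivity) ?_
  filter_upwards [(shrink Ω r).isOpen.mem_nhds hxr, Metric.ball_mem_nhds x hr0] with y hy hyx
  rw [hrep hy, hrep hxr]
  have hyx' : ‖y - x‖ < r := by rwa [Metric.mem_ball, dist_eq_norm] at hyx
  have e1 := hC₁ r (6 * C * r) U x y hr0 (by positivity) hUi.locallyIntegrable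
    (by rw [norm_sub_rev]; exact hyx'.le) fun z hz => by
      by_cases hzΩ : z ∈ Ω
      · refine (hd z hzΩ).trans ?_
        have h1 := Metric.infDist_le_infDist_add_dist (s := (Ω : Set (RSpace n))ᶜ) (x := z) (y := x)
        rw [dist_comm, dist_eq_norm] at h1
        have h2 : Metric.infDist z (Ω : Set (RSpace n))ᶜ ≤ 6 * r := by linarith
        calc _ ≤ C * (6 * r) := mul_le_mul_of_nonneg_left h2 hC0
          _ = _ := by ring
      · rw [hU0 z hzΩ, abs_zero]; positivity
  have e2 := abs_avg_sub_le ((potMeasure ψ r).map Neg.neg) F.continuous F.hasCompactSupport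
    (L := L) (fun a b => by simpa using hL.norm_sub_le a b) x y
  have e3 : ((potMeasure ψ r).map Neg.neg).real univ ≤ M := by
    rw [measureReal_def, Measure.map_apply measurable_neg MeasurableSet.univ, preimage_univ]
    exact ENNReal.toReal_mono (measure_ne_top _ _) (potMeasure_mono ψ hrD)
  have e4 : C₁ * (6 * C * r) / r = C₁ * (6 * C) := by field_simp
  rw [e4] at e1
  have e5 : ((potMeasure ψ r).map Neg.neg).real univ * L * ‖x - y‖ ≤ M * L * ‖x - y‖ := by
    gcongr
  rw [norm_sub_rev, norm_sub_rev y x, Real.norm_eq_abs, add_mul]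
  rw [abs_le] at *
  constructor <;> linarith [e1.1, e1.2, e2.1, e2.2]

theorem IsRegularSol.continuous {F : 𝓓(Ω, ℝ)}
    {U : RSpace n → ℝ} (h : IsRegularSol Ω F U) : Continuous U := by
  obtain ⟨C, hC0, hC⟩ := h.exists_bound
  rw [continuous_iff_continuousAt]
  intro x
  by_cases hx : x ∈ Ω
  · exact h.contDiffOn.continuousOn.continuousAt (Ω.isOpen.mem_nhds hx)
  · have hle : ∀ y, ‖U y‖ ≤ C * Metric.infDist y (Ω : Set (RSpace n))ᶜ := fun y => by
      by_cases hy : y ∈ Ω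
      · exact (hC y hy).1
      · rw [h.eq_zero y hy, norm_zero]
        exact mul_nonneg hC0 Metric.infDist_nonneg
    have hlim : Tendsto (fun y => C * Metric.infDist y (Ω : Set (RSpace n))ᶜ) (𝓝 x) (𝓝 0) := by
      have := ((Metric.continuous_infDist_pt (Ω : Set (RSpace n))ᶜ).const_mul C).tendsto x
      rwa [Metric.infDist_zero_of_mem (s := (Ω : Set (RSpace n))ᶜ) hx, mul_zero] at this
    rw [ContinuousAt, h.eq_zero x hx]
    exact squeeze_zero_norm hle hlim

end Regularity

/-! ### Uniqueness in `W^{1,1}_0` -/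

section Uniqueness

variable {n : ℕ} {Ω : Opens (RSpace n)}

/-- Smooth cutoff functions adapted to the distance to a set. -/
theorem exists_cutoff_infDist (A : Set (RSpace n)) : ∃ C, 0 ≤ C ∧ ∀ ε : ℝ, 0 < ε →
    ∃ χ : RSpace n → ℝ, ContDiff ℝ ∞ χ ∧ (∀ x, |χ x| ≤ 1) ∧
      (∀ x, Metric.infDist x A < ε → χ x = 0) ∧ (∀ x, 3 * ε < Metric.infDist x A → χ x = 1) ∧
      ∀ x, ‖gradient χ x‖ ≤ C / ε := by
  obtain ⟨ρ, ψ, h⟩ := exists_isMollifierPair n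
  obtain ⟨C, hC0, hC⟩ := h.exists_abs_mollify_sub_le
  refine ⟨C, hC0, fun ε hε => ?_⟩
  set d := fun x => Metric.infDist x A with hd
  -- The indicator of {d ≥ 2ε} is mollified at scale ε, over which d varies by at most ε; this
  -- yields 0 for d < ε and 1 for d > 3ε.
  set S : Set (RSpace n) := {x | 2 * ε ≤ d x} with hS
  have hSm : MeasurableSet S := by
    refine IsClosed.measurableSet ?_
    exact isClosed_le continuous_const (Metric.continuous_infDist_pt A)
  set v : RSpace n → ℝ := S.indicator fun _ => 1 with hv
  have hv1 : ∀ x, |v x| ≤ 1 := fun x => by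
    by_cases hx : x ∈ S <;> simp [hv, hx]
  have hvi : LocallyIntegrable v := by
    have : LocallyIntegrable (fun _ : RSpace n => (1 : ℝ)) := locallyIntegrable_const 1
    exact this.indicator hSm
  have hdist : ∀ x y : RSpace n, ‖y‖ ≤ 1 → |d (x - ε • y) - d x| ≤ ε := fun x y hy => by
    have := (Metric.lipschitz_infDist_pt A).dist_le_mul (x - ε • y) x
    rw [NNReal.coe_one, one_mul, Real.dist_eq, dist_eq_norm] at this
    refine this.trans ?_
    rw [sub_sub_cancel_left, norm_neg, norm_smul, Real.norm_of_nonneg hε.le]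
    nlinarith
  have hρ : ∀ {a : RSpace n → ℝ} {c : ℝ}, (∀ y, ‖y‖ ≤ 1 → a y = c) → ∀ y, ρ y * a y = ρ y * c :=
    fun ha y => by
      rcases le_or_gt ‖y‖ 1 with hy | hy
      · rw [ha y hy]
      · rw [h.eq_zero y hy.le, zero_mul, zero_mul]
  refine ⟨mollify ρ ε v, h.contDiff_mollify hε hvi, fun x => ?_, fun x hx => ?_, fun x hx => ?_,
    fun x => ?_⟩
  · rw [mollify_eq_integral ρ hε, ← Real.norm_eq_abs]
    refine (norm_integral_le_of_norm_le (g := ρ)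
      (h.contDiff.continuous.integrable_of_hasCompactSupport h.hasCompactSupport)
      (Eventually.of_forall fun y => ?_)).trans_eq h.integral_eq_one
    rw [norm_mul, Real.norm_of_nonneg (h.nonneg y)]
    exact mul_le_of_le_one_right (h.nonneg y) (hv1 _)
  · rw [mollify_eq_integral ρ hε]
    have : ∀ y, ‖y‖ ≤ 1 → v (x - ε • y) = 0 := fun y hy => by
      refine indicator_of_notMem (fun hmem => ?_) _
      have h1 : 2 * ε ≤ d (x - ε • y) := hmem
      have h2 : d x < ε := hx
      linarith [(abs_le.1 (hdist x y hy)).2]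
    simp only [hρ this, mul_zero, integral_zero]
  · rw [mollify_eq_integral ρ hε]
    have : ∀ y, ‖y‖ ≤ 1 → v (x - ε • y) = 1 := fun y hy => by
      refine indicator_of_mem ?_ _
      have h2 : 3 * ε < d x := hx
      show 2 * ε ≤ d (x - ε • y)
      linarith [(abs_le.1 (hdist x y hy)).1]
    simp only [hρ this, mul_one, h.integral_eq_one]
  · rw [norm_gradient]
    refine norm_fderiv_le_of_lip' ℝ (by positivity) ?_
    filter_upwards [Metric.ball_mem_nhds x hε] with y hy
    have hyx : ‖x - y‖ ≤ ε := by
      rw [Metric.mem_ball, dist_comm, dist_eq_norm] at hy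
      exact hy.le
    have := hC ε 1 v x y hε zero_le_one hvi hyx fun z _ => hv1 z
    rw [norm_sub_rev, norm_sub_rev y x, Real.norm_eq_abs]
    simpa using this

/-- Weak solutions in `W^{1,1}_0` can be tested with regular solutions of the dual problem. -/
theorem IsW10.integral_inner_gradient_eq {v : RSpace n → ℝ} {g : RSpace n → RSpace n}
    (hv : IsW10 Ω 1 v g) {G : 𝓓(Ω, ℝ)} {U : RSpace n → ℝ} (hU : IsRegularSol Ω G U) :
    ∫ x in (Ω : Set (RSpace n)), inner ℝ (g x) (gradient U x) =
      ∫ x in (Ω : Set (RSpace n)), v x * G x := by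
  obtain ⟨C, hC0, hC⟩ := hU.exists_bound
  obtain ⟨B, hB0, hB⟩ := G.bounded
  obtain ⟨φ, h1, h2⟩ := hv.exists_seq
  have lU := MemLp.locallyIntegrableOn_opens one_le_two hU.isW10.memLp_grad
  have lv := MemLp.locallyIntegrableOn_opens le_rfl hv.memLp
  have lG : LocallyIntegrableOn G (Ω : Set (RSpace n)) :=
    G.continuous.continuousOn.locallyIntegrableOn Ω.isOpen.measurableSet
  have hCae : ∀ᵐ x ∂(volume.restrict (Ω : Set (RSpace n))), ‖gradient U x‖ ≤ C := by
    filter_upwards [ae_restrict_mem Ω.isOpen.measurableSet] with x hx using (hC x hx).2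
  have i0 : Integrable (fun x => inner ℝ (g x) (gradient U x))
      (volume.restrict (Ω : Set (RSpace n))) := by
    refine ((memLp_one_iff_integrable.1 hv.memLp_grad).norm.mul_const C).mono'
      (hv.memLp_grad.aestronglyMeasurable.inner hU.isW10.memLp_grad.aestronglyMeasurable) ?_
    filter_upwards [hCae] with x hx
    exact (norm_inner_le_norm _ _).trans (by gcongr)
  -- Test functions approximating v are admissible in the equation for U. Since ∇U and G are
  -- bounded, convergence in W^{1,1} is enough to pass to the limit.
  have t1 : Tendsto (fun k => ∫ x in (Ω : Set (RSpace n)),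
      inner ℝ (gradient (φ k) x) (gradient U x)) atTop
      (𝓝 (∫ x in (Ω : Set (RSpace n)), inner ℝ (g x) (gradient U x))) := by
    refine tendsto_integral_of_norm_sub_le (C := C) h2 (fun k => ?_) i0 fun k => ?_
    · simpa only [real_inner_comm] using IsWeakSol.integrable_inner lU (φ k)
    · filter_upwards [hCae] with x hx
      rw [← inner_sub_left, mul_comm]
      exact (abs_real_inner_le_norm _ _).trans (by gcongr)
  have t2 : Tendsto (fun k => ∫ x in (Ω : Set (RSpace n)), φ k x * G x) atTop
      (𝓝 (∫ x in (Ω : Set (RSpace n)), v x * G x)) := by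
    refine tendsto_integral_of_norm_sub_le (C := B) h1 (fun k => ?_) (G.integrable_mul lv)
      fun k => Eventually.of_forall fun x => ?_
    · simpa only [mul_comm] using (φ k).integrable_mul lG
    · rw [← sub_mul, abs_mul, mul_comm]
      exact mul_le_mul_of_nonneg_right (hB x) (abs_nonneg _)
  refine tendsto_nhds_unique t1 (t2.congr fun k => ?_)
  have := hU.isWeakSol (φ k)
  simp only [real_inner_comm, mul_comm] at this ⊢
  exact this.symm

/-- The product of a regular solution with a cutoff function, as a test function. -/
def IsRegularSol.cutoff (hΩ : Bornology.IsBounded (Ω : Set (RSpace n))) {F : 𝓓(Ω, ℝ)}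
    {U : RSpace n → ℝ} (hU : IsRegularSol Ω F U) {χ : RSpace n → ℝ} (hχ : ContDiff ℝ ∞ χ) {ε : ℝ}
    (hε : 0 < ε) (h0 : ∀ x, Metric.infDist x (Ω : Set (RSpace n))ᶜ < ε → χ x = 0) : 𝓓(Ω, ℝ) :=
  have hts : tsupport (fun x => χ x * U x) ⊆ Ω := by
    have h1 : tsupport (fun x => χ x * U x) ⊆
        {x | ε ≤ Metric.infDist x (Ω : Set (RSpace n))ᶜ} := by
      refine closure_minimal (fun x hx => ?_)
        (isClosed_le continuous_const (Metric.continuous_infDist_pt _))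
      by_contra h
      exact hx (by simp [h0 x (not_le.1 h)])
    intro x hx
    by_contra hxΩ
    have h2 : ε ≤ Metric.infDist x (Ω : Set (RSpace n))ᶜ := h1 hx
    rw [Metric.infDist_zero_of_mem (s := (Ω : Set (RSpace n))ᶜ) hxΩ] at h2
    linarith
  { toFun := fun x => χ x * U x
    contDiff' := by
      rw [contDiff_iff_contDiffAt]
      intro x
      by_cases hx : x ∈ Ω
      · exact hχ.contDiffAt.mul (hU.contDiffOn.contDiffAt (Ω.isOpen.mem_nhds hx))
      · refine (contDiffAt_const (c := (0 : ℝ))).congr_of_eventuallyEq ?_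
        filter_upwards [(isClosed_tsupport (fun x => χ x * U x)).isOpen_compl.mem_nhds
          fun h => hx (hts h)] with y hy
        exact image_eq_zero_of_notMem_tsupport (f := fun x => χ x * U x) hy
    hasCompactSupport' :=
      Metric.isCompact_of_isClosed_isBounded (isClosed_tsupport _) (hΩ.subset hts)
    tsupport_subset' := hts }

theorem IsRegularSol.cutoff_apply (hΩ : Bornology.IsBounded (Ω : Set (RSpace n))) {F : 𝓓(Ω, ℝ)}
    {U : RSpace n → ℝ} (hU : IsRegularSol Ω F U) {χ : RSpace n → ℝ} (hχ : ContDiff ℝ ∞ χ) {ε : ℝ}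
    (hε : 0 < ε) (h0 : ∀ x, Metric.infDist x (Ω : Set (RSpace n))ᶜ < ε → χ x = 0) :
    ⇑(hU.cutoff hΩ hχ hε h0) = fun x => χ x * U x := rfl

/-- A weakly divergence free integrable field is orthogonal to the gradients of regular
solutions. -/
theorem IsWeakSol.integral_inner_gradient_eq_zero
    (hΩ : Bornology.IsBounded (Ω : Set (RSpace n))) (hne : ((Ω : Set (RSpace n))ᶜ).Nonempty)
    {g : RSpace n → RSpace n} (hgi : IntegrableOn g (Ω : Set (RSpace n))) (hg : IsWeakSol Ω g 0)
    {G : 𝓓(Ω, ℝ)} {U : RSpace n → ℝ} (hU : IsRegularSol Ω G U) :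
    ∫ x in (Ω : Set (RSpace n)), inner ℝ (g x) (gradient U x) = 0 := by
  obtain ⟨C, hC0, hC⟩ := hU.exists_bound
  obtain ⟨C₁, hC₁0, hcut⟩ := exists_cutoff_infDist (Ω : Set (RSpace n))ᶜ
  set ε : ℕ → ℝ := fun k => 1 / (k + 1 : ℝ) with hε
  have hε0 : ∀ k, 0 < ε k := fun k => by positivity
  choose χ hχ hχ1 hχ0 hχe hχg using fun k => hcut (ε k) (hε0 k)
  have hgrad : ∀ k, ∀ x ∈ Ω, gradient (hU.cutoff hΩ (hχ k) (hε0 k) (hχ0 k)) x =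
      χ k x • gradient U x + U x • gradient (χ k) x := fun k x hx => by
    rw [hU.cutoff_apply]
    exact gradient_mul ((hχ k).differentiable (by simp) x)
      ((hU.contDiffOn.contDiffAt (Ω.isOpen.mem_nhds hx)).differentiableAt (by simp))
  -- the gradient of the cutoff vanishes away from the boundary
  have hgχ : ∀ k x, 3 * ε k < Metric.infDist x (Ω : Set (RSpace n))ᶜ → gradient (χ k) x = 0 :=
    fun k x hx => by
      have : χ k =ᶠ[𝓝 x] fun _ => (1 : ℝ) := by
        filter_upwards [(isOpen_lt continuous_const
          (Metric.continuous_infDist_pt (Ω : Set (RSpace n))ᶜ)).mem_nhds hx] with y hy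
        exact hχe k y hy
      rw [gradient, this.fderiv_eq]
      simp
  -- The delicate term is U∇χ: ∇χ is O(1/ε) and vanishes where the distance exceeds 3ε, while U is
  -- O(ε) on the remaining layer. This is where the linear decay of U at the boundary is needed.
  have hbound : ∀ k, ∀ x ∈ Ω, ‖χ k x • gradient U x + U x • gradient (χ k) x‖ ≤
      C + C * 3 * C₁ := fun k x hx => by
    refine (norm_add_le _ _).trans (add_le_add ?_ ?_)
    · rw [norm_smul, Real.norm_eq_abs]
      calc _ ≤ 1 * C := mul_le_mul (hχ1 k x) (hC x hx).2 (norm_nonneg _) zero_le_one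
        _ = C := one_mul _
    · rcases le_or_gt (Metric.infDist x (Ω : Set (RSpace n))ᶜ) (3 * ε k) with h | h
      · rw [norm_smul, Real.norm_eq_abs]
        have h1 : |U x| ≤ C * (3 * ε k) := (hC x hx).1.trans (mul_le_mul_of_nonneg_left h hC0)
        calc _ ≤ C * (3 * ε k) * (C₁ / ε k) :=
              mul_le_mul h1 (hχg k x) (norm_nonneg _) (by have := hε0 k; positivity)
          _ = C * 3 * C₁ := by have := (hε0 k).ne'; field_simp
      · rw [hgχ k x h, smul_zero, norm_zero]; positivity
  have hlim : Tendsto (fun k => ∫ x in (Ω : Set (RSpace n)),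
      inner ℝ (g x) (gradient (hU.cutoff hΩ (hχ k) (hε0 k) (hχ0 k)) x)) atTop
      (𝓝 (∫ x in (Ω : Set (RSpace n)), inner ℝ (g x) (gradient U x))) := by
    refine tendsto_integral_of_dominated_convergence (fun x => ‖g x‖ * (C + C * 3 * C₁))
      (fun k => (IsWeakSol.integrable_inner hgi.locallyIntegrableOn _).aestronglyMeasurable)
      (hgi.norm.mul_const _) (fun k => ?_) ?_
    · filter_upwards [ae_restrict_mem Ω.isOpen.measurableSet] with x hx
      rw [hgrad k x hx]
      exact (norm_inner_le_norm _ _).trans (by gcongr; exact hbound k x hx)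
    · filter_upwards [ae_restrict_mem Ω.isOpen.measurableSet] with x hx
      refine tendsto_const_nhds.congr' ?_
      have hd : 0 < Metric.infDist x (Ω : Set (RSpace n))ᶜ :=
        (Ω.isOpen.isClosed_compl.notMem_iff_infDist_pos hne).1 fun h => h hx
      have h3 : Tendsto (fun k => 3 * ε k) atTop (𝓝 0) := by
        simpa [hε] using (tendsto_one_div_add_atTop_nhds_zero_nat (𝕜 := ℝ)).const_mul 3
      filter_upwards [h3.eventually_lt_const hd] with k hk
      rw [hgrad k x hx, hχe k x hk, hgχ k x hk, smul_zero, add_zero, one_smul]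
  refine tendsto_nhds_unique hlim (tendsto_const_nhds.congr fun k => ?_)
  rw [hg]
  simp

/-- Uniqueness for the Dirichlet problem in `W^{1,1}_0`. -/
theorem IsW10.ae_eq_zero_of_isWeakSol (hn : 2 ≤ n)
    (hΩ : Bornology.IsBounded (Ω : Set (RSpace n))) (hC : HasC2Boundary Ω) {v : RSpace n → ℝ}
    {g : RSpace n → RSpace n} (hv : IsW10 Ω 1 v g) (hg : IsWeakSol Ω g 0) :
    v =ᵐ[volume.restrict (Ω : Set (RSpace n))] 0 := by
  refine ae_eq_of_integral_testFunction (MemLp.locallyIntegrableOn_opens le_rfl hv.memLp)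
    locallyIntegrableOn_zero fun G => ?_
  -- Duality: U solves the problem with datum G, so ∫vG = ∫⟨g, ∇U⟩ = 0.
  obtain ⟨U, hU⟩ := exists_isRegularSol hn hΩ hC G
  rw [← hv.integral_inner_gradient_eq hU, hg.integral_inner_gradient_eq_zero hΩ
    (nonempty_compl_of_isBounded hn hΩ) (memLp_one_iff_integrable.1 hv.memLp_grad) hU]
  simp

end Uniqueness

/-! ### The logarithmic potential in the plane -/

section PlanarKernel

variable {Ω : Opens (RSpace 2)}

theorem integral_fun_norm_plane (f : ℝ → ℝ) :
    ∫ x : RSpace 2, f ‖x‖ = 2 * Real.pi * ∫ r in Ioi (0 : ℝ), r * f r := by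
  rw [integral_fun_norm_addHaar, finrank_euclideanSpace_fin, measureReal_def,
    EuclideanSpace.volume_ball_fin_two]
  simp [mul_assoc, Real.pi_pos.le]

/-- The Laplacian of the regularized logarithmic potential, up to sign and scaling. -/
def planeKernel (x : RSpace 2) : ℝ := Real.pi⁻¹ * ((1 + ‖x‖ ^ 2) ^ 2)⁻¹

theorem planeKernel_nonneg (x : RSpace 2) : 0 ≤ planeKernel x := by
  unfold planeKernel; positivity

theorem continuous_planeKernel : Continuous planeKernel := by
  unfold planeKernel
  have : ∀ x : RSpace 2, ((1 + ‖x‖ ^ 2) ^ 2) ≠ 0 := fun x => by positivity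
  fun_prop (disch := assumption)

/-- An antiderivative with value -1/(2π) at 0 and limit 0 at infinity; in polar coordinates it makes
`planeKernel` a probability density. -/
theorem hasDerivAt_planeKernel_radial (r : ℝ) :
    HasDerivAt (fun r : ℝ => -(Real.pi⁻¹ * (1 + r ^ 2)⁻¹) / 2)
      (r * (Real.pi⁻¹ * ((1 + r ^ 2) ^ 2)⁻¹)) r := by
  have h0 : (1 + r ^ 2) ≠ 0 := by positivity
  have h1 : HasDerivAt (fun r : ℝ => 1 + r ^ 2) (2 * r) r := by
    simpa using (hasDerivAt_pow 2 r).const_add 1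
  refine (((h1.fun_inv h0).const_mul Real.pi⁻¹).neg.div_const 2).congr_deriv ?_
  field_simp

theorem tendsto_planeKernel_radial :
    Tendsto (fun r : ℝ => -(Real.pi⁻¹ * (1 + r ^ 2)⁻¹) / 2) atTop (𝓝 0) := by
  have h1 : Tendsto (fun r : ℝ => 1 + r ^ 2) atTop atTop :=
    tendsto_atTop_add_const_left _ _ (tendsto_pow_atTop two_ne_zero)
  simpa using ((h1.inv_tendsto_atTop.const_mul Real.pi⁻¹).neg).div_const 2

theorem integrable_planeKernel : Integrable planeKernel := by
  have := integrableOn_Ioi_deriv_of_nonneg' (a := 0)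
    (fun r _ => hasDerivAt_planeKernel_radial r)
    (fun r (hr : 0 < r) => by positivity) tendsto_planeKernel_radial
  refine (integrable_fun_norm_addHaar (volume : Measure (RSpace 2))
    (f := fun r : ℝ => Real.pi⁻¹ * ((1 + r ^ 2) ^ 2)⁻¹)).2 ?_
  simpa [finrank_euclideanSpace_fin] using this

theorem integral_planeKernel : ∫ x, planeKernel x = 1 := by
  have h1 := integral_Ioi_of_hasDerivAt_of_nonneg' (a := 0)
    (fun r _ => hasDerivAt_planeKernel_radial r)
    (fun r (hr : 0 < r) => by positivity) tendsto_planeKernel_radial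
  have h2 := integral_fun_norm_plane fun r : ℝ => Real.pi⁻¹ * ((1 + r ^ 2) ^ 2)⁻¹
  rw [h1] at h2
  unfold planeKernel
  rw [h2]
  have := Real.pi_ne_zero
  norm_num
  field_simp

/-- Uniform approximation from below by mollification. -/
theorem TestFunction.exists_abs_le_mollify (F : 𝓓(Ω, ℝ)) : ∃ η : ℕ → ℝ, (∀ k, 0 ≤ η k) ∧
    Tendsto η atTop (𝓝 0) ∧ ∀ (k : ℕ) (x : RSpace 2),
      |F x| ≤ mollify planeKernel (1 / (k + 1 : ℝ)) (fun z => |F z|) x + η k := by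
  obtain ⟨B, hB0, hB⟩ := F.bounded
  obtain ⟨L, hL⟩ := F.contDiff_one.lipschitzWith_of_hasCompactSupport F.hasCompactSupport
    (by norm_num)
  have hc := continuous_planeKernel
  -- The increment of F over a step εy is at most min(Lε|y|, 2B); the cap 2B supplies an integrable
  -- majorant independent of k.
  have hle : ∀ (k : ℕ) (y : RSpace 2),
      ‖planeKernel y * min (L * (1 / (k + 1 : ℝ) * ‖y‖)) (2 * B)‖ ≤ planeKernel y * (2 * B) :=
    fun k y => by
      have h0 : 0 ≤ min (L * (1 / (k + 1 : ℝ) * ‖y‖)) (2 * B) := by positivity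
      rw [norm_mul, Real.norm_of_nonneg (planeKernel_nonneg y), Real.norm_of_nonneg h0]
      exact mul_le_mul_of_nonneg_left (min_le_right _ _) (planeKernel_nonneg y)
  have hi : ∀ k : ℕ, Integrable fun y : RSpace 2 =>
      planeKernel y * min (L * (1 / (k + 1 : ℝ) * ‖y‖)) (2 * B) := fun k =>
    (integrable_planeKernel.mul_const (2 * B)).mono'
      (Continuous.aestronglyMeasurable (by fun_prop)) (Eventually.of_forall (hle k))
  refine ⟨fun k => ∫ y, planeKernel y * min (L * (1 / (k + 1 : ℝ) * ‖y‖)) (2 * B), fun k =>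
    integral_nonneg fun y => mul_nonneg (planeKernel_nonneg y) (by positivity), ?_, fun k x => ?_⟩
  · have := tendsto_integral_of_dominated_convergence (μ := (volume : Measure (RSpace 2)))
      (F := fun (k : ℕ) y => planeKernel y * min (L * (1 / (k + 1 : ℝ) * ‖y‖)) (2 * B))
      (f := fun _ => 0) (fun y => planeKernel y * (2 * B)) (fun k => (hi k).aestronglyMeasurable)
      (integrable_planeKernel.mul_const _) (fun k => Eventually.of_forall (hle k))
      (Eventually.of_forall fun y => by
        have h1 : Tendsto (fun k : ℕ => L * (1 / (k + 1 : ℝ) * ‖y‖)) atTop (𝓝 0) := by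
          simpa using ((tendsto_one_div_add_atTop_nhds_zero_nat (𝕜 := ℝ)).mul_const
            ‖y‖).const_mul (L : ℝ)
        have h2 := (h1.min (tendsto_const_nhds (x := 2 * B))).const_mul (planeKernel y)
        rwa [min_eq_left (by positivity), mul_zero] at h2)
    simpa using this
  · have hk : (0 : ℝ) < 1 / (k + 1 : ℝ) := by positivity
    have hFc := F.continuous
    have i1 : Integrable fun y => planeKernel y * |F (x - (1 / (k + 1 : ℝ)) • y)| := by
      refine (integrable_planeKernel.mul_const B).mono'
        (Continuous.aestronglyMeasurable (by fun_prop)) (Eventually.of_forall fun y => ?_)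
      rw [norm_mul, Real.norm_of_nonneg (planeKernel_nonneg y), Real.norm_eq_abs, abs_abs]
      exact mul_le_mul_of_nonneg_left (hB _) (planeKernel_nonneg y)
    rw [mollify_eq_integral _ hk, ← integral_add i1 (hi k)]
    calc |F x| = ∫ y, planeKernel y * |F x| := by
          rw [integral_mul_const, integral_planeKernel, one_mul]
      _ ≤ _ := by
        refine integral_mono (integrable_planeKernel.mul_const _) (i1.add (hi k)) fun y => ?_
        show planeKernel y * |F x| ≤ planeKernel y * |F (x - (1 / (k + 1 : ℝ)) • y)| +
          planeKernel y * min (L * (1 / (k + 1 : ℝ) * ‖y‖)) (2 * B)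
        rw [← mul_add]
        refine mul_le_mul_of_nonneg_left ?_ (planeKernel_nonneg y)
        rw [← min_add_add_left]
        refine le_min ?_ ?_
        · have h1 := hL.norm_sub_le x (x - (1 / (k + 1 : ℝ)) • y)
          rw [sub_sub_cancel, norm_smul, Real.norm_of_nonneg hk.le, Real.norm_eq_abs] at h1
          linarith [abs_sub_abs_le_abs_sub (F x) (F (x - (1 / (k + 1 : ℝ)) • y))]
        · linarith [hB x, abs_nonneg (F (x - (1 / (k + 1 : ℝ)) • y))]

/-- The regularized logarithmic potential. -/
def logKernel (A ε : ℝ) (x : RSpace 2) : ℝ :=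
  (4 * Real.pi)⁻¹ * (Real.log (A ^ 2 + ε ^ 2) - Real.log (‖x‖ ^ 2 + ε ^ 2))

theorem contDiff_logKernel (A : ℝ) {ε : ℝ} (hε : 0 < ε) : ContDiff ℝ ∞ (logKernel A ε) := by
  have h1 : ContDiff ℝ ∞ fun x : RSpace 2 => ‖x‖ ^ 2 + ε ^ 2 :=
    (contDiff_id.norm_sq ℝ).add contDiff_const
  exact contDiff_const.mul (contDiff_const.sub (h1.log fun x => by positivity))

/-- For θ(t) = log(t + ε²) and t = |x|², the planar Laplacian is 4tθ'' + 4θ' = 4ε²/(t + ε²)²;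
dividing by 4π gives the kernel rescaled to ε. -/
theorem laplacian_logKernel (A : ℝ) {ε : ℝ} (hε : 0 < ε) (x : RSpace 2) :
    Δ (logKernel A ε) x = -((ε ^ 2)⁻¹ * planeKernel (ε⁻¹ • x)) := by
  have hd : ∀ t : ℝ, 0 ≤ t → HasDerivAt (fun t => Real.log (t + ε ^ 2)) (t + ε ^ 2)⁻¹ t :=
    fun t ht => by
      have h0 : t + ε ^ 2 ≠ 0 := by positivity
      simpa using ((hasDerivAt_id t).add_const (ε ^ 2)).log h0
  have hd2 : ∀ t : ℝ, 0 ≤ t → HasDerivAt (fun t => (t + ε ^ 2)⁻¹) (-((t + ε ^ 2) ^ 2)⁻¹) t :=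
    fun t ht => by
      have h0 : t + ε ^ 2 ≠ 0 := by positivity
      refine (((hasDerivAt_id t).add_const (ε ^ 2)).fun_inv h0).congr_deriv ?_
      simp [neg_div]
  have := laplacian_comp_norm_sq (n := 2) (z := 0) (x := x)
    (θ := fun t => (4 * Real.pi)⁻¹ * (Real.log (A ^ 2 + ε ^ 2) - Real.log (t + ε ^ 2)))
    (θ' := fun t => -(4 * Real.pi)⁻¹ * (t + ε ^ 2)⁻¹)
    (θ'' := fun t => -(4 * Real.pi)⁻¹ * -((t + ε ^ 2) ^ 2)⁻¹)
    (fun t ht => (((hd t ht).const_sub _).const_mul _).congr_deriv (by ring))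
    (fun t ht => (hd2 t ht).const_mul _) (by
      have h : ContDiffAt ℝ 2 (fun x : RSpace 2 =>
        (4 * Real.pi)⁻¹ * (Real.log (A ^ 2 + ε ^ 2) - Real.log (‖x‖ ^ 2 + ε ^ 2))) x :=
        ((contDiff_logKernel A hε).of_le (by norm_cast)).contDiffAt
      simpa only [sub_zero] using h)
  simp only [sub_zero] at this
  unfold logKernel
  rw [this]
  have h0 : ‖x‖ ^ 2 + ε ^ 2 ≠ 0 := by positivity
  have h1 : 1 + (ε⁻¹ * ‖x‖) ^ 2 ≠ 0 := by positivity
  have hπ := Real.pi_ne_zero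
  rw [planeKernel, norm_smul, norm_inv, Real.norm_of_nonneg hε.le]
  have h2 : 1 + (ε⁻¹ * ‖x‖) ^ 2 = (‖x‖ ^ 2 + ε ^ 2) / ε ^ 2 := by field_simp; ring
  rw [h2]
  field_simp
  push_cast
  ring

theorem logKernel_nonneg {A ε : ℝ} (hε : 0 < ε) {x : RSpace 2} (hx : ‖x‖ ≤ A) :
    0 ≤ logKernel A ε x := by
  refine mul_nonneg (by positivity) (sub_nonneg.2 (Real.log_le_log (by positivity) ?_))
  gcongr

/-- The 4π cancels the normalization of the kernel, leaving a regularization of the singularity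
|x|^{-2p}, integrable in the plane for p < 1. -/
theorem exp_mul_logKernel {A ε : ℝ} (hε : 0 < ε) (p : ℝ) (x : RSpace 2) :
    Real.exp (4 * Real.pi * p * logKernel A ε x) =
      ((A ^ 2 + ε ^ 2) / (‖x‖ ^ 2 + ε ^ 2)) ^ p := by
  have h0 : 0 < A ^ 2 + ε ^ 2 := by positivity
  have h1 : 0 < ‖x‖ ^ 2 + ε ^ 2 := by positivity
  rw [Real.rpow_def_of_pos (by positivity), Real.log_div h0.ne' h1.ne', logKernel]
  have := Real.pi_ne_zero
  congr 1
  field_simp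

/-- The exponential integral of the regularized logarithm over a disc. -/
theorem setIntegral_exp_logKernel_le {A ε p : ℝ} (hA : 0 ≤ A) (hε : 0 < ε) (hp1 : p < 1) :
    ∫ x in Metric.closedBall (0 : RSpace 2) A, Real.exp (4 * Real.pi * p * logKernel A ε x) ≤
      Real.pi * (A ^ 2 + ε ^ 2) / (1 - p) := by
  have hp : 0 < 1 - p := by linarith
  have h0 : 0 < A ^ 2 + ε ^ 2 := by positivity
  have e1 : ∫ x in Metric.closedBall (0 : RSpace 2) A,
      Real.exp (4 * Real.pi * p * logKernel A ε x) =
      ∫ x : RSpace 2, (Iic A).indicator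
        (fun r => ((A ^ 2 + ε ^ 2) / (r ^ 2 + ε ^ 2)) ^ p) ‖x‖ := by
    rw [← integral_indicator Metric.isClosed_closedBall.measurableSet]
    congr 1; ext x
    simp only [indicator, mem_closedBall_zero_iff, mem_Iic, exp_mul_logKernel hε]
  have e2 : ∫ r in Ioi (0 : ℝ), r * (Iic A).indicator
      (fun r => ((A ^ 2 + ε ^ 2) / (r ^ 2 + ε ^ 2)) ^ p) r =
      ∫ r in (0 : ℝ)..A, r * ((A ^ 2 + ε ^ 2) / (r ^ 2 + ε ^ 2)) ^ p := by
    rw [intervalIntegral.integral_of_le hA, ← Ioi_inter_Iic, ← setIntegral_indicator measurableSet_Iic]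
    refine integral_congr_ae (Eventually.of_forall fun r => ?_)
    by_cases hr : r ∈ Iic A <;> simp [hr]
  have hd : ∀ r : ℝ, HasDerivAt
      (fun r : ℝ => (A ^ 2 + ε ^ 2) ^ p * (r ^ 2 + ε ^ 2) ^ (1 - p) / (2 * (1 - p)))
      (r * ((A ^ 2 + ε ^ 2) / (r ^ 2 + ε ^ 2)) ^ p) r := fun r => by
    have h1 : 0 < r ^ 2 + ε ^ 2 := by positivity
    have h2 : HasDerivAt (fun r : ℝ => r ^ 2 + ε ^ 2) (2 * r) r := by
      simpa using (hasDerivAt_pow 2 r).add_const (ε ^ 2)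
    refine (((h2.rpow_const (p := 1 - p) (Or.inl h1.ne')).const_mul
      ((A ^ 2 + ε ^ 2) ^ p)).div_const (2 * (1 - p))).congr_deriv ?_
    rw [Real.div_rpow h0.le h1.le, show 1 - p - 1 = -p by ring, Real.rpow_neg h1.le]
    field_simp
  have hcont : Continuous fun r : ℝ => r * ((A ^ 2 + ε ^ 2) / (r ^ 2 + ε ^ 2)) ^ p := by
    have h1 : ∀ r : ℝ, r ^ 2 + ε ^ 2 ≠ 0 := fun r => by positivity
    have h2 : Continuous fun r : ℝ => (A ^ 2 + ε ^ 2) / (r ^ 2 + ε ^ 2) := by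
      fun_prop (disch := assumption)
    exact continuous_id.mul (h2.rpow_const fun r => Or.inl (by positivity))
  rw [e1, integral_fun_norm_plane, e2, intervalIntegral.integral_eq_sub_of_hasDerivAt
    (fun r _ => hd r) (hcont.intervalIntegrable _ _)]
  have e3 : (A ^ 2 + ε ^ 2) ^ p * (A ^ 2 + ε ^ 2) ^ (1 - p) = A ^ 2 + ε ^ 2 := by
    rw [← Real.rpow_add h0]; simp
  rw [e3]
  -- The primitive is nonnegative at r = 0, and this contribution is dropped.
  have h3 : 0 ≤ (A ^ 2 + ε ^ 2) ^ p * ((0 : ℝ) ^ 2 + ε ^ 2) ^ (1 - p) / (2 * (1 - p)) := by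
    positivity
  calc _ ≤ 2 * Real.pi * ((A ^ 2 + ε ^ 2) / (2 * (1 - p))) := by
        have := Real.pi_pos
        gcongr
        linarith
    _ = _ := by field_simp

end PlanarKernel

/-! ### The Brezis–Merle inequality -/

section BrezisMerle

variable {Ω : Opens (RSpace 2)}

/-- Domination of the variational solution by a logarithmic potential. -/
theorem IsW10.ae_abs_le_logKernel (hΩ : Bornology.IsBounded (Ω : Set (RSpace 2))) {F : 𝓓(Ω, ℝ)}
    {u : RSpace 2 → ℝ} {g : RSpace 2 → RSpace 2} (hu : IsW10 Ω 2 u g) (hsol : IsWeakSol Ω g F)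
    {D W ε η : ℝ} (hD : ∀ x ∈ Ω, ∀ y ∈ Ω, ‖x - y‖ ≤ D) (hW : ∀ x ∈ Ω, ‖x‖ ≤ W) (hε : 0 < ε)
    (hη : 0 ≤ η) (hFη : ∀ x, |F x| ≤ mollify planeKernel ε (fun z => |F z|) x + η) :
    ∀ᵐ x ∂(volume.restrict (Ω : Set (RSpace 2))),
      |u x| ≤ (∫ z, logKernel D ε (x - z) * |F z|) + η * (W ^ 2 / 4) := by
  have hFi : Integrable fun z => |F z| :=
    (F.continuous.integrable_of_hasCompactSupport F.hasCompactSupport).abs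
  have hκ := contDiff_logKernel D hε
  -- A cutoff makes the kernel a test function. Differences of points of Ω have norm at most D, so
  -- values on Ω are unaffected, and the margin 1 keeps the equality valid in a neighbourhood, as
  -- the Laplacian requires.
  obtain ⟨χ, hχ, -⟩ := exists_testFunction_eq_one (Ω := (⊤ : Opens (RSpace 2)))
    (isCompact_closedBall (0 : RSpace 2) (D + 1)) (subset_univ _)
  set K := χ.smoothMul (logKernel D ε) hκ with hK
  have hKeq : ∀ x : RSpace 2, ‖x‖ ≤ D + 1 → K x = logKernel D ε x := fun x hx => by
    rw [hK, TestFunction.smoothMul_apply, hχ x (mem_closedBall_zero_iff.2 hx), mul_one]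
  have hKΔ : ∀ x : RSpace 2, ‖x‖ < D + 1 →
      Δ (K : RSpace 2 → ℝ) x = -((ε ^ 2)⁻¹ * planeKernel (ε⁻¹ • x)) := fun x hx => by
    rw [← laplacian_logKernel D hε]
    suffices e : (K : RSpace 2 → ℝ) =ᶠ[𝓝 x] logKernel D ε from
      (InnerProductSpace.laplacian_congr_nhds e).eq_of_nhds
    filter_upwards [(isOpen_lt continuous_norm continuous_const).mem_nhds hx] with y hy
    exact hKeq y (le_of_lt hy)
  set κ : Measure (RSpace 2) := volume.withDensity fun z => ENNReal.ofReal |F z| with hκdef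
  have : IsFiniteMeasure κ := isFiniteMeasure_withDensity_ofReal hFi.2
  have hint : ∀ f : RSpace 2 → ℝ, ∫ z, f z ∂κ = ∫ z, f z * |F z| := fun f => by
    have hm : Measurable fun z => ENNReal.ofReal |F z| :=
      ENNReal.measurable_ofReal.comp F.continuous.abs.measurable
    rw [hκdef, integral_withDensity_eq_integral_toReal_smul hm
      (Eventually.of_forall fun _ => ENNReal.ofReal_lt_top)]
    congr 1; ext z
    rw [ENNReal.toReal_ofReal (abs_nonneg _), smul_eq_mul, mul_comm]
  have havg : ContDiff ℝ ∞ (avg κ K) := avg_contDiff κ K.contDiff K.hasCompactSupport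
  have havgx : ∀ x ∈ Ω, avg κ K x = ∫ z, logKernel D ε (x - z) * |F z| := fun x hx => by
    rw [avg, hint]
    congr 1; ext z
    by_cases hz : z ∈ Ω
    · rw [hKeq _ ((hD x hx z hz).trans (by linarith))]
    · rw [F.eq_zero_of_notMem hz, abs_zero, mul_zero, mul_zero]
  have havgΔ : ∀ x ∈ Ω, Δ (avg κ K) x = -mollify planeKernel ε (fun z => |F z|) x :=
    fun x hx => by
      rw [laplacian_avg, avg, hint, mollify, ← integral_neg]
      congr 1; ext z
      by_cases hz : z ∈ Ω
      · rw [hKΔ _ ((hD x hx z hz).trans_lt (by linarith)), neg_mul]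
      · rw [F.eq_zero_of_notMem hz, abs_zero, mul_zero, mul_zero, neg_zero]
  -- In the plane -Δ((W² - |x|²)/4) = 1, so this term compensates the error η; it is nonnegative on
  -- Ω.
  set q : RSpace 2 → ℝ := fun x => η * ((W ^ 2 - ‖x - 0‖ ^ 2) / 4) with hq
  have hqs : ContDiff ℝ ∞ q :=
    contDiff_const.mul ((contDiff_const.sub
      ((contDiff_id.sub contDiff_const).norm_sq ℝ)).div_const 4)
  have hqΔ : ∀ x, Δ q x = -η := fun x => by
    rw [laplacian_comp_norm_sq (n := 2) (z := 0) (x := x) (θ := fun t => η * ((W ^ 2 - t) / 4))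
      (θ' := fun _ => η * (-1 / 4)) (θ'' := fun _ => 0)
      (fun t _ => (((hasDerivAt_id t).const_sub (W ^ 2)).div_const 4).const_mul η)
      (fun t _ => hasDerivAt_const t _) (hqs.of_le (by norm_cast)).contDiffAt]
    push_cast
    ring
  have hq0 : ∀ x ∈ Ω, 0 ≤ q x := fun x hx => by
    have h1 := hW x hx
    have h2 : ‖x‖ ^ 2 ≤ W ^ 2 := by gcongr
    refine mul_nonneg hη (div_nonneg ?_ (by norm_num))
    rw [sub_zero]; linarith
  have hw : ContDiff ℝ ∞ (avg κ K + q) := havg.add hqs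
  have hw0 : ∀ x ∈ Ω, 0 ≤ (avg κ K + q) x := fun x hx => by
    refine add_nonneg ?_ (hq0 x hx)
    rw [havgx x hx]
    refine integral_nonneg fun z => ?_
    by_cases hz : z ∈ Ω
    · exact mul_nonneg (logKernel_nonneg hε (hD x hx z hz)) (abs_nonneg _)
    · rw [F.eq_zero_of_notMem hz, abs_zero, mul_zero]; exact le_rfl
  have hsup : ∀ x ∈ Ω, |F x| ≤ -Δ (avg κ K + q) x := fun x hx => by
    rw [ContDiffAt.laplacian_add (havg.of_le (by norm_cast)).contDiffAt
      (hqs.of_le (by norm_cast)).contDiffAt, havgΔ x hx, hqΔ]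
    linarith [hFη x]
  have lF : LocallyIntegrableOn F (Ω : Set (RSpace 2)) :=
    F.continuous.continuousOn.locallyIntegrableOn Ω.isOpen.measurableSet
  have k1 := hu.ae_le_of_supersolution le_rfl hΩ lF hsol hw hw0 fun x hx =>
    (le_abs_self _).trans (hsup x hx)
  have k2 := (hu.const_smul (-1)).ae_le_of_supersolution le_rfl hΩ (F := (-1 : ℝ) • ⇑F)
    (lF.smul (-1 : ℝ)) (hsol.const_smul (-1)) hw hw0 fun x hx => by
      refine le_trans ?_ (hsup x hx)
      simpa using neg_le_abs (F x)
  filter_upwards [k1, k2, ae_restrict_mem Ω.isOpen.measurableSet] with x h1 h2 hx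
  have h3 : (avg κ K + q) x ≤ (∫ z, logKernel D ε (x - z) * |F z|) + η * (W ^ 2 / 4) := by
    rw [Pi.add_apply, havgx x hx]
    refine add_le_add le_rfl (mul_le_mul_of_nonneg_left ?_ hη)
    linarith [sq_nonneg ‖x - 0‖]
  exact (abs_le'.2 ⟨h1, by simpa using h2⟩).trans h3

/-- Jensen's inequality for the exponential function. -/
theorem mul_exp_integral_le {α : Type*} [MeasurableSpace α] {μ : Measure α} {κ f : α → ℝ} {a : ℝ}
    (hf0 : ∀ z, 0 ≤ f z) (hf : Integrable f μ) (hκ : Integrable (fun z => κ z * f z) μ)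
    (he : Integrable (fun z => Real.exp (a * κ z) * f z) μ) (hN : 0 < ∫ z, f z ∂μ) :
    (∫ z, f z ∂μ) * Real.exp (a * (∫ z, κ z * f z ∂μ) / ∫ z, f z ∂μ) ≤
      ∫ z, Real.exp (a * κ z) * f z ∂μ := by
  set N := ∫ z, f z ∂μ with hNdef
  -- The tangent line of the exponential at the mean m gives exp(aκ) ≥ exp(m)(1 + aκ - m), which is
  -- integrated against f.
  set m := a * (∫ z, κ z * f z ∂μ) / N with hm
  have i1 : Integrable (fun z => Real.exp m * (1 - m) * f z + Real.exp m * a * (κ z * f z)) μ :=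
    (hf.const_mul _).add (hκ.const_mul _)
  calc N * Real.exp m = ∫ z, (Real.exp m * (1 - m) * f z + Real.exp m * a * (κ z * f z)) ∂μ := by
        rw [integral_add (hf.const_mul _) (hκ.const_mul _), integral_const_mul, integral_const_mul,
          ← hNdef]
        have : a * (∫ z, κ z * f z ∂μ) = m * N := by rw [hm]; field_simp
        rw [mul_assoc (Real.exp m) a, this]
        ring
    _ ≤ _ := by
        refine integral_mono i1 he fun z => ?_
        show Real.exp m * (1 - m) * f z + Real.exp m * a * (κ z * f z) ≤ Real.exp (a * κ z) * f z
        have h1 := Real.add_one_le_exp (a * κ z - m)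
        have h2 : Real.exp (a * κ z) = Real.exp m * Real.exp (a * κ z - m) := by
          rw [← Real.exp_add]; congr 1; ring
        rw [h2]
        have h3 := mul_le_mul_of_nonneg_left h1 (mul_nonneg (Real.exp_pos m).le (hf0 z))
        nlinarith

theorem lintegral_exp_logKernel_le {A ε p : ℝ} (hA : 0 ≤ A) (hε : 0 < ε) (hp1 : p < 1)
    {S : Set (RSpace 2)} {z : RSpace 2} (hS : ∀ x ∈ S, ‖x - z‖ ≤ A) (hSm : MeasurableSet S) :
    ∫⁻ x in S, ENNReal.ofReal (Real.exp (4 * Real.pi * p * logKernel A ε (x - z))) ≤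
      ENNReal.ofReal (Real.pi * (A ^ 2 + ε ^ 2) / (1 - p)) := by
  set G : RSpace 2 → ℝ≥0∞ := fun y =>
    ENNReal.ofReal (Real.exp (4 * Real.pi * p * logKernel A ε y)) with hG
  have hc : Continuous fun y => Real.exp (4 * Real.pi * p * logKernel A ε y) := by
    have := (contDiff_logKernel A hε).continuous
    fun_prop
  have hB : MeasurableSet (Metric.closedBall (0 : RSpace 2) A) :=
    Metric.isClosed_closedBall.measurableSet
  calc ∫⁻ x in S, G (x - z)
      ≤ ∫⁻ x in S, (Metric.closedBall (0 : RSpace 2) A).indicator G (x - z) := by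
        refine setLIntegral_mono' hSm fun x hx => ?_
        rw [indicator_of_mem (mem_closedBall_zero_iff.2 (hS x hx))]
    _ ≤ ∫⁻ x, (Metric.closedBall (0 : RSpace 2) A).indicator G (x - z) :=
        setLIntegral_le_lintegral _ _
    _ = ∫⁻ y in Metric.closedBall (0 : RSpace 2) A, G y := by
        rw [lintegral_sub_right_eq_self ((Metric.closedBall (0 : RSpace 2) A).indicator G) z,
          lintegral_indicator hB]
    _ = ENNReal.ofReal (∫ y in Metric.closedBall (0 : RSpace 2) A,
          Real.exp (4 * Real.pi * p * logKernel A ε y)) :=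
        (ofReal_integral_eq_lintegral_ofReal
          (hc.continuousOn.integrableOn_compact (isCompact_closedBall _ _))
          (Eventually.of_forall fun y => (Real.exp_pos _).le)).symm
    _ ≤ _ := ENNReal.ofReal_le_ofReal (setIntegral_exp_logKernel_le hA hε hp1)

/-- Jensen for the probability density |F|/N takes the exponential inside the logarithmic potential.
Tonelli then leaves, for each z in Ω, the exponential of a single translated kernel, whose integral
over Ω is bounded uniformly in z because Ω lies in the disc of radius D about z. -/
theorem IsW10.lintegral_exp_le_of_mollify (hΩ : Bornology.IsBounded (Ω : Set (RSpace 2)))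
    {F : 𝓓(Ω, ℝ)} {u : RSpace 2 → ℝ} {g : RSpace 2 → RSpace 2} (hu : IsW10 Ω 2 u g)
    (hsol : IsWeakSol Ω g F) {D W ε η p : ℝ} (hD0 : 0 ≤ D)
    (hD : ∀ x ∈ Ω, ∀ y ∈ Ω, ‖x - y‖ ≤ D) (hW : ∀ x ∈ Ω, ‖x‖ ≤ W) (hε : 0 < ε)
    (hη : 0 ≤ η) (hFη : ∀ x, |F x| ≤ mollify planeKernel ε (fun z => |F z|) x + η)
    (hp0 : 0 ≤ p) (hp1 : p < 1) (hN : 0 < ∫ z, |F z|) :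
    ∫⁻ x in (Ω : Set (RSpace 2)),
        ENNReal.ofReal (Real.exp (4 * Real.pi * p * |u x| / ∫ z, |F z|)) ≤
      ENNReal.ofReal (Real.exp (4 * Real.pi * p * (η * (W ^ 2 / 4)) / ∫ z, |F z|) *
        (Real.pi * (D ^ 2 + ε ^ 2) / (1 - p))) := by
  set N := ∫ z, |F z| with hNdef
  set a := 4 * Real.pi * p with ha
  have ha0 : 0 ≤ a := by have := Real.pi_pos; positivity
  set E := Real.exp (a * (η * (W ^ 2 / 4)) / N) with hE
  have hE0 : 0 < E := Real.exp_pos _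
  have hκ := (contDiff_logKernel D hε).continuous
  have hFc := F.continuous
  have hFs : HasCompactSupport fun z => |F z| := F.hasCompactSupport.comp_left abs_zero
  have hFi : Integrable fun z => |F z| := hFc.abs.integrable_of_hasCompactSupport hFs
  have i1 : ∀ x, Integrable fun z => logKernel D ε (x - z) * |F z| := fun x =>
    Continuous.integrable_of_hasCompactSupport (by fun_prop) hFs.mul_left
  have i2 : ∀ x, Integrable fun z => Real.exp (a * logKernel D ε (x - z)) * |F z| := fun x =>
    Continuous.integrable_of_hasCompactSupport (by fun_prop) hFs.mul_left
  have hpt : ∀ᵐ x ∂(volume.restrict (Ω : Set (RSpace 2))), ENNReal.ofReal (Real.exp (a * |u x| / N)) ≤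
      ENNReal.ofReal (E * N⁻¹) *
        ∫⁻ z, ENNReal.ofReal (Real.exp (a * logKernel D ε (x - z)) * |F z|) := by
    filter_upwards [hu.ae_abs_le_logKernel hΩ hsol hD hW hε hη hFη] with x hx
    rw [← ofReal_integral_eq_lintegral_ofReal (i2 x) (Eventually.of_forall fun z =>
      mul_nonneg (Real.exp_pos _).le (abs_nonneg _)), ← ENNReal.ofReal_mul (by positivity)]
    refine ENNReal.ofReal_le_ofReal ?_
    have hJ := mul_exp_integral_le (a := a) (fun z => abs_nonneg (F z)) hFi (i1 x) (i2 x) hN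
    rw [← hNdef] at hJ
    calc Real.exp (a * |u x| / N)
        ≤ Real.exp (a * ((∫ z, logKernel D ε (x - z) * |F z|) + η * (W ^ 2 / 4)) / N) := by
          gcongr
      _ = E * Real.exp (a * (∫ z, logKernel D ε (x - z) * |F z|) / N) := by
          rw [hE, ← Real.exp_add]; congr 1; ring
      _ = E * N⁻¹ * (N * Real.exp (a * (∫ z, logKernel D ε (x - z) * |F z|) / N)) := by
          field_simp
      _ ≤ _ := by gcongr
  have hmeas : Measurable fun q : RSpace 2 × RSpace 2 =>
      ENNReal.ofReal (Real.exp (a * logKernel D ε (q.1 - q.2)) * |F q.2|) := by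
    refine ENNReal.measurable_ofReal.comp (Continuous.measurable ?_)
    fun_prop
  refine (lintegral_mono_ae hpt).trans ?_
  rw [lintegral_const_mul' _ _ ENNReal.ofReal_ne_top,
    lintegral_lintegral_swap (f := fun x z =>
      ENNReal.ofReal (Real.exp (a * logKernel D ε (x - z)) * |F z|)) hmeas.aemeasurable]
  have hz : ∀ z, ∫⁻ x in (Ω : Set (RSpace 2)),
      ENNReal.ofReal (Real.exp (a * logKernel D ε (x - z)) * |F z|) ≤
      ENNReal.ofReal (Real.pi * (D ^ 2 + ε ^ 2) / (1 - p)) * ENNReal.ofReal |F z| := fun z => by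
    by_cases hzΩ : z ∈ Ω
    · simp only [ENNReal.ofReal_mul (Real.exp_pos _).le]
      rw [lintegral_mul_const' _ _ ENNReal.ofReal_ne_top]
      gcongr
      exact lintegral_exp_logKernel_le hD0 hε hp1 (fun x hx => hD x hx z hzΩ)
        Ω.isOpen.measurableSet
    · simp [F.eq_zero_of_notMem hzΩ]
  calc _ ≤ ENNReal.ofReal (E * N⁻¹) * ∫⁻ z, ENNReal.ofReal (Real.pi * (D ^ 2 + ε ^ 2) / (1 - p)) *
        ENNReal.ofReal |F z| := by gcongr; exact hz _
    _ = ENNReal.ofReal (E * N⁻¹) * (ENNReal.ofReal (Real.pi * (D ^ 2 + ε ^ 2) / (1 - p)) *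
        ENNReal.ofReal N) := by
      rw [lintegral_const_mul' _ _ ENNReal.ofReal_ne_top, hNdef,
        ofReal_integral_eq_lintegral_ofReal hFi (Eventually.of_forall fun z => abs_nonneg _)]
    _ = ENNReal.ofReal (E * (Real.pi * (D ^ 2 + ε ^ 2) / (1 - p))) := by
      have hp : 0 < 1 - p := by linarith
      rw [← ENNReal.ofReal_mul (by have := Real.pi_pos; positivity),
        ← ENNReal.ofReal_mul (by positivity)]
      congr 1
      field_simp
    _ ≤ _ := le_rfl

/-- The Brezis–Merle inequality for smooth data. -/
theorem IsW10.lintegral_exp_le (hΩ : Bornology.IsBounded (Ω : Set (RSpace 2)))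
    {F : 𝓓(Ω, ℝ)} {u : RSpace 2 → ℝ} {g : RSpace 2 → RSpace 2} (hu : IsW10 Ω 2 u g)
    (hsol : IsWeakSol Ω g F) {δ : ℝ} (hδ : 0 < δ) (hδ' : δ < 4 * Real.pi)
    (hN : 0 < ∫ z in (Ω : Set (RSpace 2)), |F z|) :
    ∫⁻ x in (Ω : Set (RSpace 2)), ENNReal.ofReal
        (Real.exp ((4 * Real.pi - δ) * |u x| / ∫ z in (Ω : Set (RSpace 2)), |F z|)) ≤
      ENNReal.ofReal (4 * Real.pi ^ 2 / δ * Metric.diam (Ω : Set (RSpace 2)) ^ 2) := by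
  have hFN : ∫ z in (Ω : Set (RSpace 2)), |F z| = ∫ z, |F z| :=
    setIntegral_opens_eq fun x hx => by rw [F.eq_zero_of_notMem hx, abs_zero]
  rw [hFN] at hN ⊢
  obtain ⟨W, hW⟩ := hΩ.subset_closedBall 0
  obtain ⟨η, hη0, hη, hFη⟩ := F.exists_abs_le_mollify
  have hπ := Real.pi_pos
  -- Chosen so that 4πp = 4π - δ; then 1 - p = δ/(4π) turns the disc bound πD²/(1-p) into 4π²D²/δ
  -- once ε and η tend to 0.
  set p : ℝ := 1 - δ / (4 * Real.pi) with hp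
  have hp1 : p < 1 := by rw [hp]; linarith [div_pos hδ (by positivity : 0 < 4 * Real.pi)]
  have hp0 : 0 ≤ p := by
    rw [hp, sub_nonneg, div_le_one (by positivity)]
    exact hδ'.le
  have hap : 4 * Real.pi - δ = 4 * Real.pi * p := by rw [hp]; field_simp
  rw [hap]
  have hk := fun k : ℕ => hu.lintegral_exp_le_of_mollify hΩ hsol Metric.diam_nonneg
    (fun x hx y hy => by
      rw [← dist_eq_norm]
      exact Metric.dist_le_diam_of_mem hΩ hx hy) (fun x hx => mem_closedBall_zero_iff.1 (hW hx))
    (by positivity : (0 : ℝ) < 1 / (k + 1 : ℝ)) (hη0 k) (hFη k) hp0 hp1 hN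
  refine ge_of_tendsto (x := atTop) ?_ (Eventually.of_forall hk)
  refine ENNReal.tendsto_ofReal ?_
  have t0 := tendsto_one_div_add_atTop_nhds_zero_nat (𝕜 := ℝ)
  have t1 : Tendsto (fun k => Real.exp (4 * Real.pi * p * (η k * (W ^ 2 / 4)) / ∫ z, |F z|)) atTop
      (𝓝 1) := by
    have := (((hη.mul_const (W ^ 2 / 4)).const_mul (4 * Real.pi * p)).div_const
      (∫ z, |F z|)).rexp
    simpa using this
  have t2 : Tendsto (fun k : ℕ => Real.pi * (Metric.diam (Ω : Set (RSpace 2)) ^ 2 +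
      (1 / (k + 1 : ℝ)) ^ 2) / (1 - p)) atTop
      (𝓝 (4 * Real.pi ^ 2 / δ * Metric.diam (Ω : Set (RSpace 2)) ^ 2)) := by
    have := (((t0.pow 2).const_add (Metric.diam (Ω : Set (RSpace 2)) ^ 2)).const_mul
      Real.pi).div_const (1 - p)
    convert this using 2
    rw [show 1 - p = δ / (4 * Real.pi) by rw [hp]; ring]
    field_simp
    ring
  simpa using t1.mul t2

/-- Passage to the limit in the Brezis–Merle inequality. -/
theorem lintegral_exp_le_of_tendsto {α : Type*} [MeasurableSpace α] {μ : Measure α} {a : ℝ}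
    {B : ℝ≥0∞} {U : ℕ → α → ℝ} {u : α → ℝ} {N : ℕ → ℝ} {N₀ : ℝ}
    (hU : ∀ j, AEStronglyMeasurable (U j) μ) (hu : AEStronglyMeasurable u μ)
    (hlim : Tendsto (fun j => eLpNorm (U j - u) 1 μ) atTop (𝓝 0)) (hN₀ : 0 < N₀)
    (hN : Tendsto N atTop (𝓝 N₀))
    (hle : ∀ j, 0 < N j → ∫⁻ x, ENNReal.ofReal (Real.exp (a * |U j x| / N j)) ∂μ ≤ B) :
    ∫⁻ x, ENNReal.ofReal (Real.exp (a * |u x| / N₀)) ∂μ ≤ B := by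
  obtain ⟨ns, hns, hae⟩ :=
    (tendstoInMeasure_of_tendsto_eLpNorm one_ne_zero hU hu hlim).exists_seq_tendsto_ae
  have hNs := hN.comp hns.tendsto_atTop
  have hconv : ∀ᵐ x ∂μ, Tendsto
      (fun j => ENNReal.ofReal (Real.exp (a * |U (ns j) x| / N (ns j)))) atTop
      (𝓝 (ENNReal.ofReal (Real.exp (a * |u x| / N₀)))) := by
    filter_upwards [hae] with x hx
    exact ENNReal.tendsto_ofReal (((hx.abs.const_mul a).div hNs hN₀.ne').rexp)
  -- Fatou's lemma along the almost everywhere convergent subsequence; N j is eventually positive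
  -- because its limit is.
  calc ∫⁻ x, ENNReal.ofReal (Real.exp (a * |u x| / N₀)) ∂μ
      = ∫⁻ x, liminf (fun j => ENNReal.ofReal (Real.exp (a * |U (ns j) x| / N (ns j)))) atTop ∂μ :=
        lintegral_congr_ae (by filter_upwards [hconv] with x hx using hx.liminf_eq.symm)
    _ ≤ liminf (fun j => ∫⁻ x, ENNReal.ofReal (Real.exp (a * |U (ns j) x| / N (ns j))) ∂μ) atTop := by
        refine lintegral_liminf_le' fun j => ?_
        have hc : Continuous fun t : ℝ => Real.exp (a * |t| / N (ns j)) := by fun_prop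
        exact (hc.comp_aestronglyMeasurable (hU (ns j))).aemeasurable.ennreal_ofReal
    _ ≤ B := by
        refine liminf_le_of_frequently_le' (Eventually.frequently ?_)
        filter_upwards [hNs.eventually_const_lt hN₀] with j hj
        exact hle _ hj

end BrezisMerle

/-! ### Local regularity -/

section LocalRegularity

variable {n : ℕ} {Ω V : Opens (RSpace n)}

/-- A test function on a smaller open set, as a test function on a larger one. -/
def TestFunction.extend (h : V ≤ Ω) (φ : 𝓓(V, ℝ)) : 𝓓(Ω, ℝ) :=
  ⟨φ, φ.contDiff, φ.hasCompactSupport, φ.tsupport_subset.trans h⟩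

theorem TestFunction.coe_extend (h : V ≤ Ω) (φ : 𝓓(V, ℝ)) : ⇑(φ.extend h) = ⇑φ := rfl

theorem TestFunction.setIntegral_mul_extend (h : V ≤ Ω) (φ : 𝓓(V, ℝ)) (u : RSpace n → ℝ) :
    ∫ x in (Ω : Set (RSpace n)), u x * φ x = ∫ x in (V : Set (RSpace n)), u x * φ x := by
  rw [setIntegral_opens_eq fun x hx => by rw [φ.eq_zero_of_notMem fun hV => hx (h hV), mul_zero],
    setIntegral_opens_eq fun x hx => by rw [φ.eq_zero_of_notMem hx, mul_zero]]

theorem HasWeakGradient.mono {u : RSpace n → ℝ} {g : RSpace n → RSpace n}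
    (hg : HasWeakGradient Ω u g) (h : V ≤ Ω) : HasWeakGradient V u g := by
  refine ⟨hg.1.mono_set h, hg.2.1.mono_set h, fun φ v => ?_⟩
  have := hg.2.2 (φ.extend h) v
  simp only [TestFunction.coe_extend] at this
  rw [φ.setIntegral_mul_extend h fun x => inner ℝ (g x) v] at this
  rw [← this]
  exact ((φ.dderiv v).setIntegral_mul_extend h u).symm

theorem HasWeakLaplacian.mono {u f : RSpace n → ℝ} (hu : HasWeakLaplacian Ω u f) (h : V ≤ Ω) :
    HasWeakLaplacian V u f := by
  refine ⟨hu.1.mono_set h, hu.2.1.mono_set h, fun φ => ?_⟩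
  have := hu.2.2 (φ.extend h)
  simp only [TestFunction.coe_extend] at this
  rw [φ.setIntegral_mul_extend h f] at this
  rw [← this]
  have e := φ.lap.setIntegral_mul_extend h u
  simp only [TestFunction.lap_apply] at e
  exact e.symm

theorem HasWeakGradient.add {u w : RSpace n → ℝ} {g k : RSpace n → RSpace n}
    (hu : HasWeakGradient Ω u g) (hw : HasWeakGradient Ω w k) :
    HasWeakGradient Ω (u + w) (g + k) := by
  refine ⟨hu.1.add hw.1, hu.2.1.add hw.2.1, fun φ v => ?_⟩
  simp only [Pi.add_apply, inner_add_left, add_mul]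
  have i1 := (φ.dderiv v).integrable_mul hu.1
  have i2 := (φ.dderiv v).integrable_mul hw.1
  simp only [TestFunction.dderiv_apply] at i1 i2
  rw [integral_add i1 i2,
    integral_add (φ.integrable_mul (LocallyIntegrableOn.inner_right hu.2.1 v))
      (φ.integrable_mul (LocallyIntegrableOn.inner_right hw.2.1 v)), hu.2.2, hw.2.2]
  ring

/-- Split u = v + w with v the limit solution on V for the datum -f, which requires no boundary
regularity of V. The remainder w is weakly harmonic, hence smooth and harmless on compact sets. The
gradient obtained serves all q at once. -/
theorem exists_hasWeakGradient_of_integrableOn (hn : 2 ≤ n)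
    (hV : Bornology.IsBounded (V : Set (RSpace n))) {u f : RSpace n → ℝ}
    (hu : IntegrableOn u (V : Set (RSpace n))) (hf : IntegrableOn f (V : Set (RSpace n)))
    (h : HasWeakLaplacian V u f) :
    ∃ g, HasWeakGradient V u g ∧ ∀ q : ℝ, 1 ≤ q → q < (n : ℝ) / ((n : ℝ) - 1) →
      ∀ K : Set (RSpace n), IsCompact K → K ⊆ V →
        MemLp u (ENNReal.ofReal q) (volume.restrict K) ∧
        MemLp g (ENNReal.ofReal q) (volume.restrict K) := by
  have hn' : (2 : ℝ) ≤ n := by exact_mod_cast hn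
  have := isFiniteMeasure_restrict_of_isBounded hV
  have hq : (1 : ℝ) < (n : ℝ) / ((n : ℝ) - 1) := by rw [lt_div_iff₀ (by linarith)]; linarith
  have hf' : IntegrableOn (fun x => -f x) (V : Set (RSpace n)) := hf.neg
  obtain ⟨v, gv, hlim⟩ := exists_isLimitSol hn hV hf'
  have hW := hlim.isW10 hn hV hf' le_rfl hq
  rw [ENNReal.ofReal_one] at hW
  have hvg := hW.hasWeakGradient le_rfl
  have hvL := (hlim.isWeakSol hn hV hf').hasWeakLaplacian hf'.locallyIntegrableOn hvg
  have hdiff : HasWeakLaplacian V (u - v) (fun x => -(0 : 𝓓(V, ℝ)) x) := by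
    refine ⟨h.1.sub hvL.1, ?_, fun φ => ?_⟩
    · simpa using locallyIntegrableOn_zero
    · have e1 := h.2.2 φ
      have e2 := hvL.2.2 φ
      simp only [neg_neg] at e2
      have i1 := φ.lap.integrable_mul h.1
      have i2 := φ.lap.integrable_mul hvL.1
      simp only [TestFunction.lap_apply] at i1 i2
      simp only [Pi.sub_apply, sub_mul]
      rw [integral_sub i1 i2, e1, e2]
      simp
  obtain ⟨w, hw, huw⟩ := hdiff.exists_contDiffOn
    (hu.sub (memLp_one_iff_integrable.1 hW.memLp))
  have hu_eq : v + w =ᵐ[volume.restrict (V : Set (RSpace n))] u := by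
    filter_upwards [huw] with x hx
    rw [Pi.add_apply, ← hx, Pi.sub_apply, add_sub_cancel]
  have hw1 : ContDiffOn ℝ 1 w (V : Set (RSpace n)) := hw.of_le (by simp)
  have hgw : ContinuousOn (gradient w) (V : Set (RSpace n)) :=
    (LinearIsometryEquiv.continuous _).comp_continuousOn
      (hw1.continuousOn_fderiv_of_isOpen V.isOpen le_rfl)
  have hcomp : ∀ {E : Type} [NormedAddCommGroup E] {a : RSpace n → E} {K : Set (RSpace n)}
      (p : ℝ≥0∞), ContinuousOn a (V : Set (RSpace n)) → IsCompact K → K ⊆ V →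
      MemLp a p (volume.restrict K) := by
    intro E _ a K p ha hK hKV
    have : IsFiniteMeasure (volume.restrict K) := isFiniteMeasure_restrict.2 hK.measure_ne_top
    obtain ⟨C, hC⟩ := hK.exists_bound_of_continuousOn (ha.mono hKV)
    refine MemLp.of_bound ((ha.mono hKV).aestronglyMeasurable_of_isCompact hK
      hK.measurableSet) C ?_
    filter_upwards [ae_restrict_mem hK.measurableSet] with x hx using hC x hx
  refine ⟨gv + gradient w, (hvg.add (hasWeakGradient_of_contDiffOn hw1)).congr hu_eq
    EventuallyEq.rfl, fun q hq1 hq K hK hKV => ?_⟩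
  have hWq := hlim.isW10 hn hV hf' hq1 hq
  have hle : volume.restrict K ≤ volume.restrict (V : Set (RSpace n)) :=
    Measure.restrict_mono hKV le_rfl
  constructor
  · exact ((hWq.memLp.mono_measure hle).add (hcomp _ hw.continuousOn hK hKV)).ae_eq
      (ae_mono hle hu_eq)
  · exact (hWq.memLp_grad.mono_measure hle).add (hcomp _ hgw hK hKV)

/-- An exhaustion of `Ω` by bounded open sets. -/
def exhaustion (Ω : Opens (RSpace n)) (k : ℕ) : Opens (RSpace n) :=
  shrink Ω (1 / (k + 1 : ℝ)) ⊓ ⟨Metric.ball 0 (k + 1 : ℝ), Metric.isOpen_ball⟩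

theorem exhaustion_mono : Monotone (exhaustion Ω) := by
  intro k l hkl x hx
  have hkl' : (k : ℝ) ≤ l := by exact_mod_cast hkl
  refine ⟨fun h => hx.1 ?_, Metric.ball_subset_ball (by linarith) hx.2⟩
  refine Metric.cthickening_mono ?_ _ h
  gcongr

theorem exhaustion_le (k : ℕ) : exhaustion Ω k ≤ Ω := fun _ hx => shrink_le _ hx.1

theorem isBounded_exhaustion (k : ℕ) : Bornology.IsBounded (exhaustion Ω k : Set (RSpace n)) :=
  Metric.isBounded_ball.subset fun _ hx => hx.2

theorem exists_subset_exhaustion {K : Set (RSpace n)} (hK : IsCompact K) (hKΩ : K ⊆ Ω) :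
    ∃ k, K ⊆ exhaustion Ω k := by
  refine hK.elim_directed_cover (fun k => (exhaustion Ω k : Set (RSpace n)))
    (fun k => (exhaustion Ω k).isOpen) (fun x hx => ?_)
    (directed_of_isDirected_le fun k l hkl => exhaustion_mono hkl)
  obtain ⟨k, hk⟩ := iUnion_shrink (hKΩ hx)
  obtain ⟨l, hl⟩ := exists_nat_gt ‖x‖
  refine mem_iUnion.2 ⟨max k l, ?_, ?_⟩
  · intro h
    refine hk (Metric.cthickening_mono ?_ _ h)
    have : (k : ℝ) ≤ (max k l : ℕ) := by exact_mod_cast le_max_left k l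
    gcongr
  · have : (l : ℝ) ≤ (max k l : ℕ) := by exact_mod_cast le_max_right k l
    refine mem_ball_zero_iff.2 ?_
    linarith

theorem exists_compact_exhaustion_subset (k : ℕ) :
    ∃ K : Set (RSpace n), IsCompact K ∧ (exhaustion Ω k : Set (RSpace n)) ⊆ K ∧ K ⊆ Ω := by
  have hr : (0 : ℝ) < 1 / (k + 1 : ℝ) := by positivity
  refine ⟨(Metric.thickening (1 / (k + 1 : ℝ)) (Ω : Set (RSpace n))ᶜ)ᶜ ∩
    Metric.closedBall 0 (k + 1 : ℝ), ?_, ?_, ?_⟩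
  · exact (isCompact_closedBall _ _).inter_left Metric.isOpen_thickening.isClosed_compl
  · exact fun x hx => ⟨fun h => hx.1 (Metric.thickening_subset_cthickening _ _ h),
      Metric.ball_subset_closedBall hx.2⟩
  · intro x hx
    by_contra h
    exact hx.1 (Metric.self_subset_thickening hr _ h)

/-- Weak gradients on the members of an exhaustion can be glued. -/
theorem exists_hasWeakGradient_of_exhaustion {u : RSpace n → ℝ} {g : ℕ → RSpace n → RSpace n}
    (hu : LocallyIntegrableOn u (Ω : Set (RSpace n)))
    (hg : ∀ k, HasWeakGradient (exhaustion Ω k) u (g k)) :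
    ∃ G, HasWeakGradient Ω u G ∧
      ∀ k, G =ᵐ[volume.restrict (exhaustion Ω k : Set (RSpace n))] g k := by
  classical
  -- With the first available index, only g m with m ≤ k occurs on the k-th set, and there it agrees
  -- almost everywhere with g k by uniqueness of weak gradients.
  let G : RSpace n → RSpace n := fun x =>
    if h : ∃ k, x ∈ exhaustion Ω k then g (Nat.find h) x else 0
  have hG : ∀ k, G =ᵐ[volume.restrict (exhaustion Ω k : Set (RSpace n))] g k := fun k => by
    have h1 : ∀ m, ∀ᵐ x ∂(volume.restrict (exhaustion Ω k : Set (RSpace n))),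
        m ≤ k → x ∈ exhaustion Ω m → g m x = g k x := fun m => by
      by_cases hm : m ≤ k
      · have h2 := (hg m).ae_unique ((hg k).mono (exhaustion_mono hm)) EventuallyEq.rfl
        have h3 := (ae_restrict_iff' (exhaustion Ω m).isOpen.measurableSet).1 h2
        filter_upwards [ae_restrict_of_ae h3] with x hx _ hxm using hx hxm
      · exact Eventually.of_forall fun x h => absurd h hm
    filter_upwards [ae_all_iff.2 h1, ae_restrict_mem (exhaustion Ω k).isOpen.measurableSet]
      with x hx hxk
    have h : ∃ k, x ∈ exhaustion Ω k := ⟨k, hxk⟩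
    simp only [G, dif_pos h]
    exact hx _ (Nat.find_min' h hxk) (Nat.find_spec h)
  refine ⟨G, ⟨hu, ?_, ?_⟩, hG⟩
  · intro x hx
    obtain ⟨k, hk⟩ := exists_subset_exhaustion (isCompact_singleton (x := x))
      (singleton_subset_iff.2 hx)
    have hxk : x ∈ (exhaustion Ω k : Set (RSpace n)) := hk rfl
    obtain ⟨t, ht, hint⟩ := locallyIntegrableOn_congr_ae (hg k).2.1 (hG k).symm x hxk
    rw [(exhaustion Ω k).isOpen.nhdsWithin_eq hxk] at ht
    exact ⟨t, mem_nhdsWithin_of_mem_nhds ht, hint⟩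
  · intro φ v
    obtain ⟨k, hk⟩ := exists_subset_exhaustion φ.hasCompactSupport φ.tsupport_subset
    let φ' : 𝓓(exhaustion Ω k, ℝ) := ⟨φ, φ.contDiff, φ.hasCompactSupport, hk⟩
    have e1 := ((hg k).congr EventuallyEq.rfl (hG k).symm).2.2 φ' v
    have e2 := φ'.setIntegral_mul_extend (exhaustion_le k) fun x => inner ℝ (G x) v
    have e3 := (φ'.dderiv v).setIntegral_mul_extend (exhaustion_le k) u
    exact e3.trans (e1.trans (congrArg Neg.neg e2.symm))

/-- Local `W^{1,q}` regularity of functions with locally integrable Laplacian. -/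
theorem HasWeakLaplacian.memW1Loc (hn : 2 ≤ n) {u f : RSpace n → ℝ} (h : HasWeakLaplacian Ω u f)
    {q : ℝ} (hq1 : 1 ≤ q) (hq : q < (n : ℝ) / ((n : ℝ) - 1)) : MemW1Loc Ω (ENNReal.ofReal q) u := by
  have hint : ∀ {a : RSpace n → ℝ} (k : ℕ), LocallyIntegrableOn a (Ω : Set (RSpace n)) →
      IntegrableOn a (exhaustion Ω k : Set (RSpace n)) := fun k ha => by
    obtain ⟨K, hK, hkK, hKΩ⟩ := exists_compact_exhaustion_subset (Ω := Ω) k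
    exact (ha.integrableOn_compact_subset hKΩ hK).mono_set hkK
  choose g hg hgq using fun k => exists_hasWeakGradient_of_integrableOn hn
    (isBounded_exhaustion (Ω := Ω) k) (hint k h.1) (hint k h.2.1) (h.mono (exhaustion_le k))
  obtain ⟨G, hG, hGg⟩ := exists_hasWeakGradient_of_exhaustion h.1 hg
  refine ⟨G, hG, fun K hK hKΩ => ?_⟩
  obtain ⟨k, hk⟩ := exists_subset_exhaustion hK hKΩ
  obtain ⟨h1, h2⟩ := hgq k q hq1 hq K hK hk
  exact ⟨h1, h2.ae_eq (ae_mono (Measure.restrict_mono hk le_rfl) (hGg k).symm)⟩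

end LocalRegularity

/-! ### The Dirichlet problem with integrable data -/

section Dirichlet

variable {n : ℕ} {Ω : Opens (RSpace n)}

theorem TendstoL1.tendsto_integral {f : RSpace n → ℝ} (hf : IntegrableOn f (Ω : Set (RSpace n))) {F : ℕ → 𝓓(Ω, ℝ)}
    (hF : TendstoL1 Ω F f) :
    Tendsto (fun j => ∫ x in (Ω : Set (RSpace n)), |F j x - f x|) atTop (𝓝 0) := by
  have h1 := (ENNReal.tendsto_toReal ENNReal.zero_ne_top).comp hF
  rw [ENNReal.toReal_zero] at h1
  refine h1.congr fun j => ?_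
  have hi : Integrable (⇑(F j) - f) (volume.restrict (Ω : Set (RSpace n))) :=
    (memLp_one_iff_integrable.1 ((F j).memLp 1 _)).sub hf
  rw [Function.comp_apply, eLpNorm_one_eq_ofReal hi,
    ENNReal.toReal_ofReal (integral_nonneg fun x => abs_nonneg _)]
  rfl

theorem IsLimitSol.tendsto {f u₀ : RSpace n → ℝ} {g₀ : RSpace n → RSpace n} (h : IsLimitSol Ω f u₀ g₀)
    (hf : IntegrableOn f (Ω : Set (RSpace n))) {F : ℕ → 𝓓(Ω, ℝ)} (hF : TendstoL1 Ω F f)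
    {U : ℕ → RSpace n → ℝ} {G : ℕ → RSpace n → RSpace n} (hU : ∀ j, IsW10 Ω 2 (U j) (G j))
    (hsol : ∀ j, IsWeakSol Ω (G j) (F j)) {q : ℝ} (hq1 : 1 ≤ q)
    (hq : q < (n : ℝ) / ((n : ℝ) - 1)) :
    Tendsto (fun j => eLpNorm (U j - u₀) (ENNReal.ofReal q)
        (volume.restrict (Ω : Set (RSpace n)))) atTop (𝓝 0) ∧
      Tendsto (fun j => eLpNorm (G j - g₀) (ENNReal.ofReal q)
        (volume.restrict (Ω : Set (RSpace n)))) atTop (𝓝 0) := by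
  obtain ⟨C, hC⟩ := h.bound q hq1 hq
  -- The summand 1/(j+1) makes c j positive and strictly larger than the error, as
  -- `IsLimitSol.bound` demands.
  set c : ℕ → ℝ := fun j =>
    (∫ x in (Ω : Set (RSpace n)), |F j x - f x|) + 1 / (j + 1 : ℝ) with hc
  have hc0 : ∀ j, 0 < c j := fun j =>
    add_pos_of_nonneg_of_pos (integral_nonneg fun x => abs_nonneg _) (by positivity)
  have hcl : Tendsto (fun j => C * ENNReal.ofReal (c j)) atTop (𝓝 0) := by
    have h1 : Tendsto c atTop (𝓝 0) := by
      simpa [hc] using (hF.tendsto_integral hf).add tendsto_one_div_add_atTop_nhds_zero_nat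
    simpa using ENNReal.Tendsto.const_mul (a := (C : ℝ≥0∞)) (ENNReal.tendsto_ofReal h1)
      (Or.inr ENNReal.coe_ne_top)
  have key := fun j => hC (F j) (U j) (G j) (c j) (hU j) (hsol j) (hc0 j)
    (lt_add_of_pos_right _ (by positivity))
  exact ⟨tendsto_of_tendsto_of_tendsto_of_le_of_le tendsto_const_nhds hcl (fun _ => zero_le)
      fun j => (key j).1,
    tendsto_of_tendsto_of_tendsto_of_le_of_le tendsto_const_nhds hcl (fun _ => zero_le)
      fun j => (key j).2⟩

theorem exists_tendstoL1 (hΩ : Bornology.IsBounded (Ω : Set (RSpace n))) {f : RSpace n → ℝ}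
    (hf : IntegrableOn f (Ω : Set (RSpace n))) : ∃ F : ℕ → 𝓓(Ω, ℝ), TendstoL1 Ω F f := by
  choose F hF using fun j : ℕ => exists_testFunction_eLpNorm_sub_le hΩ hf
    (ε := 1 / (j + 1 : ℝ)) (by positivity)
  refine ⟨F, tendsto_of_tendsto_of_tendsto_of_le_of_le tendsto_const_nhds ?_ (fun _ => zero_le) hF⟩
  simpa using ENNReal.tendsto_ofReal (tendsto_one_div_add_atTop_nhds_zero_nat (𝕜 := ℝ))

/-- The difference u - u₀ lies in W^{1,1}_0 and solves the homogeneous problem. -/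
theorem IsLimitSol.ae_eq_of_memW10 (hn : 2 ≤ n) (hΩ : Bornology.IsBounded (Ω : Set (RSpace n)))
    (hC : HasC2Boundary Ω) {f u₀ u : RSpace n → ℝ} {g₀ : RSpace n → RSpace n}
    (h : IsLimitSol Ω f u₀ g₀) (hf : IntegrableOn f (Ω : Set (RSpace n)))
    (hu : MemW10 Ω 1 u) (hL : HasWeakLaplacian Ω u (fun x => -f x)) :
    u =ᵐ[volume.restrict (Ω : Set (RSpace n))] u₀ := by
  have hn' : (2 : ℝ) ≤ n := by exact_mod_cast hn
  obtain ⟨g, hg, hW⟩ := hu.exists_isW10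
  have hW₀ := h.isW10 hn hΩ hf le_rfl (by rw [lt_div_iff₀ (by linarith)]; linarith)
  rw [ENNReal.ofReal_one] at hW₀
  have hsol := (hL.isWeakSol hg).sub (MemLp.locallyIntegrableOn_opens le_rfl hW.memLp_grad)
    (MemLp.locallyIntegrableOn_opens le_rfl hW₀.memLp_grad) hf.locallyIntegrableOn
    hf.locallyIntegrableOn (h.isWeakSol hn hΩ hf)
  rw [sub_self] at hsol
  filter_upwards [(hW.sub le_rfl hW₀).ae_eq_zero_of_isWeakSol hn hΩ hC hsol] with x hx
  exact sub_eq_zero.1 hx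

/-- The bound for smooth data does not depend on the datum; it passes to the limit because the
solutions converge in L¹ and the norms of the data converge to that of f, which is positive. -/
theorem IsLimitSol.lintegral_exp_le {Ω : Opens (RSpace 2)}
    (hΩ : Bornology.IsBounded (Ω : Set (RSpace 2))) {f u₀ : RSpace 2 → ℝ}
    {g₀ : RSpace 2 → RSpace 2} (h : IsLimitSol Ω f u₀ g₀)
    (hf : IntegrableOn f (Ω : Set (RSpace 2)))
    (hN : 0 < ∫ x in (Ω : Set (RSpace 2)), |f x|) {δ : ℝ} (hδ : 0 < δ) (hδ' : δ < 4 * Real.pi) :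
    ∫⁻ x in (Ω : Set (RSpace 2)), ENNReal.ofReal
        (Real.exp ((4 * Real.pi - δ) * |u₀ x| / ∫ y in (Ω : Set (RSpace 2)), |f y|)) ≤
      ENNReal.ofReal (4 * Real.pi ^ 2 / δ * Metric.diam (Ω : Set (RSpace 2)) ^ 2) := by
  obtain ⟨F, hF⟩ := exists_tendstoL1 hΩ hf
  choose U G hU hsol using fun j => exists_isW10_isWeakSol le_rfl hΩ (F j)
  have hlim := (h.tendsto hf hF hU hsol le_rfl (by norm_num)).1
  rw [ENNReal.ofReal_one] at hlim
  have hiF : ∀ j, Integrable (F j) (volume.restrict (Ω : Set (RSpace 2))) := fun j =>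
    memLp_one_iff_integrable.1 ((F j).memLp 1 _)
  refine lintegral_exp_le_of_tendsto (fun j => (hU j).memLp.aestronglyMeasurable) h.aesm hlim hN
    (tendsto_integral_of_norm_sub_le (C := 1) (h := fun j => ⇑(F j)) hF (fun j => (hiF j).abs)
      hf.abs fun j => Eventually.of_forall fun x => ?_)
    fun j hj => (hU j).lintegral_exp_le hΩ (hsol j) hδ hδ' hj
  rw [one_mul]
  exact abs_abs_sub_abs_le_abs_sub _ _

end Dirichlet

end

theorem mainTheorem6 (n : ℕ) (hn : 2 ≤ n) (Ω : Opens (RSpace n)) :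
    -- local regularity, on an arbitrary open set
    (∀ u f : RSpace n → ℝ,
      LocallyIntegrableOn u (Ω : Set (RSpace n)) →
      LocallyIntegrableOn f (Ω : Set (RSpace n)) →
      HasWeakLaplacian Ω u f →
      MemW1Loc Ω 1 u ∧
      ∀ q : ℝ, 1 ≤ q → q < (n : ℝ) / ((n : ℝ) - 1) → MemW1Loc Ω (ENNReal.ofReal q) u) ∧
    -- the Dirichlet problem with integrable right-hand side
    (Bornology.IsBounded (Ω : Set (RSpace n)) → HasC2Boundary Ω →
      ∀ f : RSpace n → ℝ, IntegrableOn f (Ω : Set (RSpace n)) →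
      ∃ u₀ : RSpace n → ℝ,
        (∀ q : ℝ, 1 ≤ q → q < (n : ℝ) / ((n : ℝ) - 1) → MemW10 Ω (ENNReal.ofReal q) u₀) ∧
        HasWeakLaplacian Ω u₀ (fun x => -f x) ∧
        -- `u₀` is the limit of the smooth approximate solutions
        (∃ F : ℕ → 𝓓(Ω, ℝ), TendstoL1 Ω F f) ∧
        (∀ F : ℕ → 𝓓(Ω, ℝ), TendstoL1 Ω F f →
          (∃ U : ℕ → RSpace n → ℝ, AreApproxSolutions Ω F U ∧
            ∀ j, ContDiffOn ℝ ∞ (U j) (Ω : Set (RSpace n)) ∧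
              ContinuousOn (U j) (closure (Ω : Set (RSpace n))) ∧
              ∀ x ∈ frontier (Ω : Set (RSpace n)), U j x = 0) ∧
          (∀ U : ℕ → RSpace n → ℝ, AreApproxSolutions Ω F U →
            ∀ q : ℝ, 1 ≤ q → q < (n : ℝ) / ((n : ℝ) - 1) →
              TendstoW1 Ω (ENNReal.ofReal q) U u₀)) ∧
        -- every `W^{1,1}_0` solution is `u₀`, and satisfies the Brezis-Merle inequality
        (∀ u : RSpace n → ℝ, MemW10 Ω 1 u → HasWeakLaplacian Ω u (fun x => -f x) →
          u =ᵐ[volume.restrict (Ω : Set (RSpace n))] u₀ ∧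
          (n = 2 → 0 < ∫ x in (Ω : Set (RSpace n)), |f x| →
            ∀ δ : ℝ, 0 < δ → δ < 4 * Real.pi →
              ∫⁻ x in (Ω : Set (RSpace n)), ENNReal.ofReal
                  (Real.exp ((4 * Real.pi - δ) * |u x| / ∫ y in (Ω : Set (RSpace n)), |f y|)) ≤
                ENNReal.ofReal
                  (4 * Real.pi ^ 2 / δ * Metric.diam (Ω : Set (RSpace n)) ^ 2)))) := by
  have hn' : (2 : ℝ) ≤ n := by exact_mod_cast hn
  have hq1 : (1 : ℝ) < (n : ℝ) / ((n : ℝ) - 1) := by rw [lt_div_iff₀ (by linarith)]; linarith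
  refine ⟨fun u f _ _ h => ⟨?_, fun q h1 h2 => h.memW1Loc hn h1 h2⟩, fun hΩ hC f hf => ?_⟩
  -- The exponent 1 is the case q = 1, admissible because n/(n-1) > 1.
  · simpa using h.memW1Loc hn le_rfl hq1
  have := isFiniteMeasure_restrict_of_isBounded hΩ
  obtain ⟨u₀, g₀, hlim⟩ := exists_isLimitSol hn hΩ hf
  have hW := fun (q : ℝ) (h1 : 1 ≤ q) (h2 : q < (n : ℝ) / ((n : ℝ) - 1)) =>
    hlim.isW10 hn hΩ hf h1 h2
  have hg₀ := (hW 1 le_rfl hq1).hasWeakGradient (by simp)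
  refine ⟨u₀, fun q h1 h2 => (hW q h1 h2).memW10 (ENNReal.one_le_ofReal.2 h1),
    (hlim.isWeakSol hn hΩ hf).hasWeakLaplacian hf.locallyIntegrableOn hg₀,
    exists_tendstoL1 hΩ hf, fun F hF => ⟨?_, fun U hU q h1 h2 => ?_⟩, fun u hu hL => ?_⟩
  · choose U hU using fun j => exists_isRegularSol hn hΩ hC (F j)
    have lF : ∀ j, LocallyIntegrableOn (F j) (Ω : Set (RSpace n)) := fun j =>
      (F j).continuous.continuousOn.locallyIntegrableOn Ω.isOpen.measurableSet
    refine ⟨U, fun j => ⟨(hU j).isW10.memW10 one_le_two, (hU j).isWeakSol.hasWeakLaplacian (lF j)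
      ((hU j).isW10.hasWeakGradient one_le_two)⟩, fun j => ⟨(hU j).contDiffOn,
      (hU j).continuous.continuousOn, fun x hx => (hU j).eq_zero x ?_⟩⟩
    rw [Ω.isOpen.frontier_eq] at hx
    exact hx.2
  · choose G hG hUG using fun j => (hU j).1.exists_isW10
    obtain ⟨t1, t2⟩ := hlim.tendsto hf hF hUG (fun j => (hU j).2.isWeakSol (hG j)) h1 h2
    exact ⟨G, g₀, hG, hg₀, t1, t2⟩
  · have hu₀ := hlim.ae_eq_of_memW10 hn hΩ hC hf hu hL
    refine ⟨hu₀, ?_⟩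
    rintro rfl hN δ hδ hδ'
    refine le_of_eq_of_le (lintegral_congr_ae ?_) (hlim.lintegral_exp_le hΩ hf hN hδ hδ')
    filter_upwards [hu₀] with x hx
    rw [hx]
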